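/- \textbf{Setting.} Let $\mathcal L$ be the free Lie algebra over $\mathbb R$ on generators $A_1,A_2,\dots$. A nested commutator of $A_{n_1},\dots,A_{n_m}$ has order $n_1+\dots+n_m$. Order the formal nested commutators as follows: fewer commutators is smaller, $A_i<A_j$ if $i<j$, and $[X,Y]<[V,W]$ (equally many commutators) if $X<V$, or $X=V$ and $Y<W$. The Hall elements are: all $A_i$; $[A_i,A_j]$ with $i<j$; and $[X,[Y,Z]]$ with $X,Y,Z,[Y,Z]$ Hall elements and $Y\le X<[Y,Z]$. Let $P_0=1$, $P_1(x)=2x-1$, $P_{n+1}(x)=\frac{2n+1}{n+1}(2x-1)P_n(x)-\frac{n}{n+1}P_{n-1}(x)$ (shifted Legendre polynomials). The Magnus expansion of a function $A(t)$ is $\Omega=\sum_{n\ge1}\Omega_n$, where $\Omega_n(t)=\int_0^t\dot\Omega_n$, $\dot\Omega_1=A$ and $$\dot\Omega_n=-\sum_{m=1}^{n-1}\frac1{(m+1)!}\sum_{\substack{n_1,\dots,n_m,k\ge1\\ n_1+\dots+n_m+k=n}}[\Omega_{n_1},[\Omega_{n_2},\dots,[\Omega_{n_m},\dot\Omega_k]\dots]].$$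 Let $N\ge 0$ be even, $s\ge0$, and let $f_{i,n}\in\mathbb R$ ($1\le i\le s$, $1\le n\le N$); put $\Omega_i=\sum_{n=1}^N f_{i,n}A_n$ in products of exponentials. Let $\tilde\Omega$ be the formal Lie series (graded by order) with $e^{\tilde\Omega}=e^{\Omega_1}e^{\Omega_2}\cdots e^{\Omega_s}$, and let $\Omega^{(N)}\in\mathcal L$ be the sum of the Magnus terms $\Omega_1,\dots,\Omega_N$ at $x=1$ for $A(x)=\sum_{n=1}^N P_{n-1}(x)A_n$. The \emph{order condition} of a Hall element $h$ of order at most $N$ says that $h$ has the same coefficient in the Hall basis expansions of $\tilde\Omega$ (its part of order at most $N$) and of $\Omega^{(N)}$. \textbf{Theorem.} The Hall elements form a basis of $\mathcal L$, $\tilde\Omega$ exists and is unique, and the following hold. (a) For $n\le N$ the order condition of $A_n$ is $\sum_{i=1}^s f_{i,n}=\delta_{n,1}$. If $N\ge3$, the order condition of $[A_1,A_2]$ is $\sum_{1\le i<j\le s}(f_{i,1}f_{j,2}-f_{j,1}f_{i,2})=-\frac13$. (b) (R1) If $f_{s-i+1,n}=(-1)^{n+1}f_{i,n}$ for all $i$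 and all $n\le N$, then the order conditions of all Hall elements of even order at most $N$ hold. (c) (R2) If $f_{i,n}=0$ for all $i$ and all $N/2<n\le N$, then the order conditions of all Hall elements of order at most $N$ that contain some $A_n$ with $n>N/2$ hold. (d) Suppose the hypotheses of (b) and (c) hold, and the order conditions hold for all Hall elements of odd order at most $N$ in the generators $A_n$, $n\le N/2$. Then all order conditions of order at most $N$ hold, and for every real Banach algebra $\mathcal A$ and every $A:\mathbb R\to\mathcal A$ that is analytic at $0$, with $$A_n=A_n(\delta t)=(2n-1)\,\delta t\int_0^1A(x\,\delta t)P_{n-1}(x)\,dx ,$$ the Magnus expansion $\Omega(\delta t)$ of $A$ converges for all sufficiently small $\delta t$ and $$e^{\Omega_1}e^{\Omega_2}\cdots e^{\Omega_s}-\exp\Omega(\delta t)=O(\delta t^{N+1})\qquad(\delta t\to0).$$ (e) For $N=4,6,8$ there are exactly $2$, $7$, $22$ Hall elements as in (d) (odd order at most $N$, generators $A_n$ with $n\le N/2$). They are those elements, of order at most $N$ and with all generators among $A_1,\dots,A_{N/2}$, of the list $A_1$, $A_3$, $[A_1,A_2]$, $[A_1,A_4]$, $[A_2,A_3]$, $[A_3,A_4]$,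 $[A_1,[A_1,A_3]]$, $[A_2,[A_1,A_2]]$, $[A_2,[A_1,A_4]]$, $[A_2,[A_2,A_3]]$, $[A_3,[A_1,A_3]]$, $[A_4,[A_1,A_2]]$, $[A_1,[A_1,[A_1,A_2]]]$, $[A_1,[A_1,[A_1,A_4]]]$, $[A_2,[A_1,[A_1,A_3]]]$, $[A_2,[A_2,[A_1,A_2]]]$, $[A_3,[A_1,[A_1,A_2]]]$, $[[A_1,A_2],[A_1,A_3]]$, $[A_1,[A_1,[A_1,[A_1,A_3]]]]$, $[A_2,[A_1,[A_1,[A_1,A_2]]]]$, $[[A_1,A_2],[A_1,[A_1,A_2]]]$, $[A_1,[A_1,[A_1,[A_1,[A_1,A_2]]]]]$. -/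

import Mathlib

open Filter Topology

noncomputable section

namespace CFET

/-! ### Nested commutators of the generators and the Hall basis -/

/-- Formal nested commutators of the generators `A₁, A₂, …`; `gen n` stands for `Aₙ`. -/
inductive LieWord : Type
  | gen (n : ℕ+) : LieWord
  | br (x y : LieWord) : LieWord

namespace LieWord

instance : Bracket LieWord LieWord := ⟨br⟩

/-- The number of commutators a word is composed of. -/
def commutators : LieWord → ℕ
  | gen _ => 0
  | br x y => commutators x + commutators y + 1

/-- The order `n₁ + ⋯ + nₘ` of a nested commutator of `A_{n₁}, …, A_{nₘ}`. -/
def order : LieWord → ℕ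
  | gen n => n
  | br x y => order x + order y

/-- `Contains n w`: the generator `Aₙ` occurs in `w`. -/
def Contains (n : ℕ+) : LieWord → Prop
  | gen k => n = k
  | br x y => Contains n x ∨ Contains n y

/-- The order on words: a word with fewer commutators is smaller, generators are ordered by
their index, and commutators with equally many commutators lexicographically. -/
def Lt : LieWord → LieWord → Prop
  | gen i, gen j => i < j
  | gen _, br _ _ => True
  | br _ _, gen _ => False
  | br x y, br v w =>
      commutators (br x y) < commutators (br v w) ∨
        (commutators (br x y) = commutators (br v w) ∧ (Lt x v ∨ (x = v ∧ Lt y w)))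

/-- Membership in the Hall basis. -/
inductive IsHall : LieWord → Prop
  | gen (n : ℕ+) : IsHall (gen n)
  | pair (i j : ℕ+) : i < j → IsHall (br (gen i) (gen j))
  | nest (x y z : LieWord) : IsHall x → IsHall y → IsHall z → IsHall (br y z) →
      (Lt y x ∨ y = x) → Lt x (br y z) → IsHall (br x (br y z))

end LieWord

/-- The free Lie algebra over `ℝ` on the generators `A₁, A₂, …`. -/
abbrev FreeLie : Type := FreeLieAlgebra ℝ ℕ+

/-- The element of the free Lie algebra that a formal nested commutator denotes. -/
def LieWord.toLie : LieWord → FreeLie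
  | .gen n => FreeLieAlgebra.of ℝ n
  | .br x y => ⁅x.toLie, y.toLie⁆

/-- The elements of the Hall basis. -/
abbrev HallElement : Type := {w : LieWord // w.IsHall}

/-- The Hall element `Aₙ`. -/
def hallGen (n : ℕ+) : HallElement := ⟨.gen n, .gen n⟩

/-- The Hall element `[A₁, A₂]`. -/
def hallA₁A₂ : HallElement := ⟨.br (.gen 1) (.gen 2), .pair 1 2 (by decide)⟩

open LieWord in
/-- The table of the 22 odd Hall elements up to order 8 with generators `A₁, …, A₄`. -/
def hallTable : List LieWord :=
  [gen 1, gen 3,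
   ⁅gen 1, gen 2⁆, ⁅gen 1, gen 4⁆, ⁅gen 2, gen 3⁆, ⁅gen 3, gen 4⁆,
   ⁅gen 1, ⁅gen 1, gen 3⁆⁆, ⁅gen 2, ⁅gen 1, gen 2⁆⁆, ⁅gen 2, ⁅gen 1, gen 4⁆⁆,
   ⁅gen 2, ⁅gen 2, gen 3⁆⁆, ⁅gen 3, ⁅gen 1, gen 3⁆⁆, ⁅gen 4, ⁅gen 1, gen 2⁆⁆,
   ⁅gen 1, ⁅gen 1, ⁅gen 1, gen 2⁆⁆⁆, ⁅gen 1, ⁅gen 1, ⁅gen 1, gen 4⁆⁆⁆,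
   ⁅gen 2, ⁅gen 1, ⁅gen 1, gen 3⁆⁆⁆, ⁅gen 2, ⁅gen 2, ⁅gen 1, gen 2⁆⁆⁆,
   ⁅gen 3, ⁅gen 1, ⁅gen 1, gen 2⁆⁆⁆, ⁅⁅gen 1, gen 2⁆, ⁅gen 1, gen 3⁆⁆,
   ⁅gen 1, ⁅gen 1, ⁅gen 1, ⁅gen 1, gen 3⁆⁆⁆⁆, ⁅gen 2, ⁅gen 1, ⁅gen 1, ⁅gen 1, gen 2⁆⁆⁆⁆,
   ⁅⁅gen 1, gen 2⁆, ⁅gen 1, ⁅gen 1, gen 2⁆⁆⁆,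
   ⁅gen 1, ⁅gen 1, ⁅gen 1, ⁅gen 1, ⁅gen 1, gen 2⁆⁆⁆⁆⁆]

/-- The Hall elements of odd order at most `N` in the generators `Aₙ` with `n ≤ N / 2`. -/
def remainingElements (N : ℕ) : Set HallElement :=
  {h | Odd h.1.order ∧ h.1.order ≤ N ∧ ∀ n : ℕ+, h.1.Contains n → 2 * (n : ℕ) ≤ N}

/-! ### The Magnus recursion -/

section Magnus

variable {L : Type*} [AddCommGroup L] [Bracket L L] [Module ℝ L]

/-- The sum of `[Ω_{n₁}, [Ω_{n₂}, … [Ω_{nₘ}, Ω̇ₖ] … ]]` over all `n₁, …, nₘ, k ≥ 1` with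
`n₁ + ⋯ + nₘ + k = n` (for `n ≥ 1`); here `W` is the sequence `Ω` and `D` the sequence `Ω̇`. -/
def nestedSum (W D : ℕ → L) : ℕ → ℕ → L
  | 0, n => D n
  | m + 1, n => ∑ j ∈ Finset.Ico 1 n, ⁅W j, nestedSum W D m (n - j)⁆

/-- The terms `Ω̇ₙ` of the Magnus recursion for the coefficient `a` in a Lie algebra `L` of
functions of `t`, with the integration `∫₀ᵗ` given by `I`: `Ω̇₁ = a` and
`Ω̇ₙ = - ∑_{m=1}^{n-1} 1/(m+1)! ∑_{n₁+⋯+nₘ+k=n} [Ω_{n₁}, … [Ω_{nₘ}, Ω̇ₖ] … ]` with `Ωⱼ = I Ω̇ⱼ`.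
The value at `0` is a dummy. Only indices below `n` occur in the sum for `n`, so that the
tests `j < n` do not change it; they make the termination of the recursion visible. -/
def magnusDot (I : L → L) (a : L) : ℕ → L
  | 0 => 0
  | 1 => a
  | n + 2 => - ∑ m ∈ Finset.Icc 1 (n + 1), (((m + 1).factorial : ℝ)⁻¹) •
      nestedSum (fun j => if _h : j < n + 2 then I (magnusDot I a j) else 0)
        (fun k => if _h : k < n + 2 then magnusDot I a k else 0) m (n + 2)

/-- The terms `Ωₙ = ∫₀ᵗ Ω̇ₙ` of the Magnus expansion. -/
def magnusTerm (I : L → L) (a : L) (n : ℕ) : L := I (magnusDot I a n)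

end Magnus

/-- The shifted Legendre polynomials on `[0, 1]`, normalized by `Pₙ(1) = 1`. -/
def legendreP : ℕ → Polynomial ℝ
  | 0 => 1
  | 1 => 2 * Polynomial.X - 1
  | n + 2 =>
      Polynomial.C ((2 * (n + 1 : ℝ) + 1) / (n + 2)) * (2 * Polynomial.X - 1) * legendreP (n + 1)
        - Polynomial.C ((n + 1 : ℝ) / (n + 2)) * legendreP n

/-! ### The Magnus expansion in the free Lie algebra -/

open scoped TensorProduct

/-- Polynomials in the scaled time `x = t / δt` with coefficients in the free Lie algebra. -/
abbrev PolyLie : Type := Polynomial ℝ ⊗[ℝ] FreeLie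

/-- The primitive `p ↦ ∫₀ˣ p` of polynomials: `xⁿ ↦ xⁿ⁺¹ / (n + 1)`. -/
def polyPrimitive : Polynomial ℝ →ₗ[ℝ] Polynomial ℝ :=
  (Polynomial.basisMonomials ℝ).constr ℝ
    (fun n : ℕ => Polynomial.monomial (n + 1) ((n + 1 : ℝ)⁻¹))

/-- `∑_{n=1}^N Pₙ₋₁(x) Aₙ`, the Legendre expansion of `δt A(x δt)` with formal `Aₙ`. -/
def formalA (N : ℕ) : PolyLie :=
  ∑ k ∈ Finset.range N, legendreP k ⊗ₜ[ℝ] (FreeLieAlgebra.of ℝ k.succPNat)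

/-- The value of a polynomial with coefficients in the free Lie algebra at `x = 1`. -/
def evalOne (z : PolyLie) : FreeLie :=
  TensorProduct.lid ℝ FreeLie (LinearMap.rTensor FreeLie (Polynomial.leval (1 : ℝ)) z)

/-- The Legendre expansion of `Ω(δt)` in nested commutators of `A₁, …, A_N`: the Legendre
expansion of `A` is inserted into the Magnus recursion. As `Ωₙ` is a sum of `(n-1)`-fold nested
commutators, the terms `n ≤ N` give all terms of order at most `N`. -/
def magnusLie (N : ℕ) : FreeLie :=
  ∑ n ∈ Finset.Icc 1 N,
    evalOne (magnusTerm (fun z => LinearMap.rTensor FreeLie polyPrimitive z) (formalA N) n)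

/-! ### The exponent of a product of exponentials -/

/-- The free associative algebra over `ℝ` on the generators `A₁, A₂, …`. -/
abbrev FreeAssoc : Type := FreeAlgebra ℝ ℕ+

section

attribute [local instance 100] LieRing.ofAssociativeRing

/-- The canonical map of the free Lie algebra to the free associative algebra, under which
brackets become commutators `a * b - b * a`. -/
def toAssoc : FreeLie →ₗ⁅ℝ⁆ FreeAssoc := FreeLieAlgebra.lift ℝ (FreeAlgebra.ι ℝ)

end

/-- The exponential `∑ₖ aᵏ / k!` of a formal power series `a` without constant term. -/
def formalExp (a : PowerSeries FreeAssoc) : PowerSeries FreeAssoc :=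
  PowerSeries.mk fun d =>
    ∑ k ∈ Finset.range (d + 1), ((k.factorial : ℝ)⁻¹) • PowerSeries.coeff d (a ^ k)

/-- `Ωᵢ = ∑_{n=1}^N fᵢₙ Aₙ`, where a formal variable (standing for `δt`) records that `Aₙ` is a
term of order `n`. -/
def formalExponent {s : ℕ} (N : ℕ) (f : Fin s → ℕ+ → ℝ) (i : Fin s) : PowerSeries FreeAssoc :=
  ∑ k ∈ Finset.range N,
    PowerSeries.monomial (k + 1) (f i k.succPNat • FreeAlgebra.ι ℝ k.succPNat)

/-- `W = ∑_d W d` is the formal Lie series with `exp W = exp Ω₁ exp Ω₂ ⋯ exp Ωₛ`, where `W d` is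
the part of order `d`. -/
def IsCfetExponent {s : ℕ} (N : ℕ) (f : Fin s → ℕ+ → ℝ) (W : ℕ → FreeLie) : Prop :=
  W 0 = 0 ∧
    formalExp (PowerSeries.mk fun d => toAssoc (W d)) =
      (List.ofFn fun i : Fin s => formalExp (formalExponent N f i)).prod

/-- The order condition of the Hall element `h` (meant for `h` of order at most `N`): the
exponent `W` of the product of exponentials and the Magnus expansion have the same prefactor
at `h`. -/
def OrderCondition (b : Module.Basis HallElement ℝ FreeLie) (N : ℕ) (W : ℕ → FreeLie)
    (h : HallElement) : Prop :=
  b.repr (∑ d ∈ Finset.range (N + 1), W d) h = b.repr (magnusLie N) h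

/-! ### Rules for the coefficients -/

/-- Rule (R1): `f_{s-i+1,n} = (-1)^{n+1} f_{i,n}`. -/
def TimeSymmetric {s : ℕ} (N : ℕ) (f : Fin s → ℕ+ → ℝ) : Prop :=
  ∀ (i : Fin s) (n : ℕ+), (n : ℕ) ≤ N → f i.rev n = (-1) ^ ((n : ℕ) + 1) * f i n

/-- Rule (R2): `f_{i,n} = 0` for `n > N / 2`. -/
def HalfSupported {s : ℕ} (N : ℕ) (f : Fin s → ℕ+ → ℝ) : Prop :=
  ∀ (i : Fin s) (n : ℕ+), (n : ℕ) ≤ N → N < 2 * (n : ℕ) → f i n = 0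

/-! ### The propagators -/

section Propagators

variable {𝔸 : Type*} [NormedRing 𝔸] [NormedAlgebra ℝ 𝔸]

/-- The Legendre coefficient `Aₙ = (2n-1) δt ∫₀¹ A(x δt) Pₙ₋₁(x) dx`. -/
def legendreCoeff (A : ℝ → 𝔸) (δt : ℝ) (n : ℕ+) : 𝔸 :=
  ((2 * (n : ℕ) - 1 : ℝ) * δt) • ∫ x in (0 : ℝ)..1, (legendreP n.natPred).eval x • A (x * δt)

/-- `e^{Ω₁} e^{Ω₂} ⋯ e^{Ωₛ}` with `Ωᵢ = ∑_{n=1}^N fᵢₙ Aₙ`. -/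
def cfetProduct {s : ℕ} (N : ℕ) (f : Fin s → ℕ+ → ℝ) (A : ℝ → 𝔸) (δt : ℝ) : 𝔸 :=
  (List.ofFn fun i : Fin s => NormedSpace.exp
    (∑ k ∈ Finset.range N, f i k.succPNat • legendreCoeff A δt k.succPNat)).prod

/-- The term `Ωₙ(t)` of the Magnus expansion for `A(t)`. -/
def magnusFun (A : ℝ → 𝔸) (n : ℕ) (t : ℝ) : 𝔸 :=
  magnusTerm (fun (F : ℝ → 𝔸) (u : ℝ) => ∫ v in (0 : ℝ)..u, F v) A n t

/-- The product of exponentials with coefficients `f` agrees with `exp Ω(δt)`,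
`Ω = ∑_{n ≥ 1} Ωₙ`, up to `O(δt^{N+1})`; this includes the convergence of the Magnus expansion
for small `δt`. -/
def AgreesWithMagnus {s : ℕ} (N : ℕ) (f : Fin s → ℕ+ → ℝ) (A : ℝ → 𝔸) : Prop :=
  (∀ᶠ δt in 𝓝 (0 : ℝ), Summable fun n : ℕ => magnusFun A (n + 1) δt) ∧
    (fun δt : ℝ => cfetProduct N f A δt - NormedSpace.exp (∑' n : ℕ, magnusFun A (n + 1) δt))
      =O[𝓝 (0 : ℝ)] (fun δt : ℝ => δt ^ (N + 1))

end Propagators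

end CFET

end

open Filter Topology

noncomputable section

namespace CFET

/-! ### Words and their order -/

namespace LieWord

/-! Basis. Jacobi's identity rewrites a non-Hall bracket in terms of brackets whose smaller factor
is larger, and this terminates, so Hall elements span (`lie_mem_bracketSpan`). Their images in the
free associative algebra are independent by Lazard elimination: the least remaining word is made to
act as a derivation, and bracketing with it creates new free letters (`elimRep_elimEval`,
`elimEval_independent`). Hence `toAssoc` is injective, and Lie elements may be compared as
noncommutative power series in a variable `T` that counts the order. There the exponential is
injective (`eqBelow_of_powExp`), and a product of exponentials of Lie series is again one
(`exists_powExp_eq_mul`); together these give existence and uniqueness of the exponent of the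
product.

Magnus. The recursion says that `dexp_Ω Ω̇ = A`, sorted by the number of factors. So `exp Ω` solves
`Y' = A Y` up to order `N` (`magnus_ode`, `exists_flow`), and every statement about the Legendre
form of `Ω` becomes one about this flow at time `1`.

Rule (R1). Under `x ↦ 1 - x`, `T ↦ -T` the coefficient `∑ Pₙ₋₁ Aₙ Tⁿ` changes sign, which makes the
flow time symmetric, `exp Ω(T) exp Ω(-T) = 1`; hence `Ω` is odd in `T` (`magnusLie_even`). The
product of exponentials has the same symmetry (`exponent_even`).

Rule (R2). Expanded in words, the flow consists of iterated integrals of Legendre polynomials. A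
letter `Aₙ` with `n > N / 2` brings a polynomial `Pₙ₋₁` of degree higher than that of everything it
is integrated against, so words of order at most `N` containing it do not contribute
(`IsFlow.polyIntegral_eq_zero`). Both exponents then have coordinate `0` at the Hall elements
concerned.

The first conditions are read off from a representation by strictly upper triangular `3 × 3`
matrices, in which only `A_p`, `A_q` and `[A_p, A_q]` survive.

Analysis. A Catalan majorant bounds the `n`-th Magnus term by `(8 K |t|)ⁿ` (`norm_magnusFun_le`).
Orthogonality gives `Aₙ = O(δtⁿ)`, and the Magnus recursion of functions follows the formal
recursion up to `O(δt^(N+1))` (`substRel_magnusDot`). Equal Hall coordinates up to order `N`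
therefore give propagators that agree to that order (`agreesWithMagnus_of_orderCondition`). -/

theorem one_le_order : ∀ w : LieWord, 1 ≤ w.order
  | gen n => n.pos
  | br x y => by have := one_le_order x; simp only [order]; omega

theorem finite_order_le (n : ℕ) : {w : LieWord | w.order ≤ n}.Finite := by
  induction n with
  | zero =>
    convert Set.finite_empty
    ext w
    have := one_le_order w
    simp only [Set.mem_ofPred_eq, Set.mem_empty_iff_false, iff_false]; omega
  | succ n ih =>
    refine (((Set.finite_le_nat (n + 1)).preimage PNat.coe_injective.injOn).image gen |>.union
      (ih.image2 br ih)).subset ?_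
    rintro (k | ⟨x, y⟩) h
    · exact Or.inl ⟨k, h, rfl⟩
    · have hx := one_le_order x
      have hy := one_le_order y
      simp only [Set.mem_ofPred_eq, order] at h
      exact Or.inr ⟨x, by simp only [Set.mem_ofPred_eq]; omega, y,
        by simp only [Set.mem_ofPred_eq]; omega, rfl⟩

theorem lt_of_commutators_lt {x y : LieWord} (h : x.commutators < y.commutators) : Lt x y := by
  cases x <;> cases y <;> simp_all [Lt, commutators]

theorem Lt.commutators_le {x y : LieWord} (h : Lt x y) : x.commutators ≤ y.commutators := by
  cases x <;> cases y <;> simp_all [Lt, commutators]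
  omega

theorem lt_irrefl : ∀ x : LieWord, ¬ Lt x x
  | gen n => by simp [Lt]
  | br x y => by simp [Lt, lt_irrefl x, lt_irrefl y]

theorem Lt.trans : ∀ {x y z : LieWord}, Lt x y → Lt y z → Lt x z
  | gen _, gen _, gen _, h₁, h₂ => by simp only [Lt] at *; exact h₁.trans h₂
  | gen _, _, br _ _, _, _ => by simp [Lt]
  | br _ _, gen _, _, h₁, _ => by simp [Lt] at h₁
  | _, br _ _, gen _, _, h₂ => by simp [Lt] at h₂
  | br x y, br v w, br s t, h₁, h₂ => by
    simp only [Lt] at *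
    rcases h₁ with h₁ | ⟨e₁, h₁⟩ <;> rcases h₂ with h₂ | ⟨e₂, h₂⟩
    · exact Or.inl (h₁.trans h₂)
    · exact Or.inl (e₂ ▸ h₁)
    · exact Or.inl (e₁ ▸ h₂)
    · refine Or.inr ⟨e₁.trans e₂, ?_⟩
      rcases h₁ with h₁ | ⟨rfl, h₁⟩ <;> rcases h₂ with h₂ | ⟨rfl, h₂⟩
      · exact Or.inl (h₁.trans h₂)
      · exact Or.inl h₁
      · exact Or.inl h₂
      · exact Or.inr ⟨rfl, h₁.trans h₂⟩

theorem lt_trichotomy : ∀ x y : LieWord, Lt x y ∨ x = y ∨ Lt y x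
  | gen i, gen j => by simpa [Lt] using _root_.lt_trichotomy i j
  | gen _, br _ _ => by simp [Lt]
  | br _ _, gen _ => by simp [Lt]
  | br x y, br v w => by
    have h₁ := lt_trichotomy x v
    have h₂ := lt_trichotomy y w
    have h₃ := _root_.lt_trichotomy (br x y).commutators (br v w).commutators
    simp only [Lt, br.injEq]
    grind

theorem Lt.asymm {x y : LieWord} (h : Lt x y) : ¬ Lt y x := fun h' => lt_irrefl x (h.trans h')

/-- This unifies the constructors for brackets in one recursive criterion. Totality of the order
allows the condition `y ≤ x` to be stated as `¬ Lt x y`. -/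
theorem isHall_br_iff {x w : LieWord} : IsHall (br x w) ↔
    IsHall x ∧ IsHall w ∧ Lt x w ∧ ∀ y z, w = br y z → ¬ Lt x y := by
  constructor
  · rintro (_ | ⟨i, j, h⟩ | ⟨_, y, z, hx, hy, hz, hyz, h₁, h₂⟩)
    · exact ⟨.gen i, .gen j, h, by simp⟩
    · refine ⟨hx, hyz, h₂, ?_⟩
      rintro _ _ ⟨⟩
      rcases h₁ with h₁ | rfl
      · exact h₁.asymm
      · exact lt_irrefl _
  · rintro ⟨hx, hw, h₁, h₂⟩
    cases w with
    | gen j =>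
      cases x with
      | gen i => exact .pair i j h₁
      | br _ _ => simp [Lt] at h₁
    | br y z =>
      have hyz : IsHall y ∧ IsHall z := by
        cases hw with
        | pair i j h => exact ⟨.gen i, .gen j⟩
        | nest _ _ _ hx hy hz hyz => exact ⟨hx, hyz⟩
      refine .nest x y z hx hyz.1 hyz.2 hw ?_ h₁
      rcases lt_trichotomy x y with h | rfl | h
      · exact absurd h (h₂ y z rfl)
      · exact Or.inr rfl
      · exact Or.inl h

/-! ### Hall elements span -/

/-- The span of the Hall elements of order `n` whose left factor is not smaller than `x`. -/
def bracketSpan (n : ℕ) (x : LieWord) : Submodule ℝ FreeLie :=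
  Submodule.span ℝ {l | ∃ u v, IsHall (br u v) ∧ (br u v).order = n ∧ ¬ Lt u x ∧
    l = (br u v).toLie}

theorem bracketSpan_anti {n : ℕ} {x y : LieWord} (h : Lt x y) :
    bracketSpan n y ≤ bracketSpan n x := by
  refine Submodule.span_mono ?_
  rintro _ ⟨u, v, h₁, h₂, h₃, rfl⟩
  exact ⟨u, v, h₁, h₂, fun h' => h₃ (h'.trans h), rfl⟩

/-- Double induction, upward on the order and downward on the smaller factor `x`. The lower bound on
left factors in `bracketSpan` is carried along because it is what keeps the words produced by
Jacobi's identity above `x`. -/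
theorem lie_mem_bracketSpan (n : ℕ) : ∀ x y : LieWord, IsHall x → IsHall y →
    x.order + y.order = n → Lt x y → ⁅x.toLie, y.toLie⁆ ∈ bracketSpan n x := by
  induction n using Nat.strong_induction_on with
  | _ n ih =>
  -- Only finitely many words have order at most `n`, so the number of them above `x` measures the
  -- downward induction.
  have key : ∀ k : ℕ, ∀ x y : LieWord, IsHall x → IsHall y → x.order + y.order = n → Lt x y →
      {w : LieWord | w.order ≤ n ∧ Lt x w}.ncard = k → ⁅x.toLie, y.toLie⁆ ∈ bracketSpan n x := by
    intro k
    induction k using Nat.strong_induction_on with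
    | _ k ihk =>
    rintro x y hx hy hn hlt rfl
    have inner : ∀ a b : LieWord, IsHall a → IsHall b → a.order + b.order = n → Lt x a → Lt x b →
        ⁅a.toLie, b.toLie⁆ ∈ bracketSpan n x := by
      have aux : ∀ a b : LieWord, IsHall a → IsHall b → a.order + b.order = n → Lt x a →
          Lt a b → ⁅a.toLie, b.toLie⁆ ∈ bracketSpan n x := by
        intro a b ha hb hab hxa hlt'
        refine bracketSpan_anti hxa (ihk _ ?_ a b ha hb hab hlt' rfl)
        refine Set.ncard_lt_ncard ⟨fun w hw => ⟨hw.1, hxa.trans hw.2⟩, fun h => ?_⟩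
          ((finite_order_le n).subset fun w hw => hw.1)
        exact lt_irrefl a (h ⟨by omega, hxa⟩).2
      intro a b ha hb hab hxa hxb
      rcases lt_trichotomy a b with h | rfl | h
      · exact aux a b ha hb hab hxa h
      · simp
      · rw [← lie_skew]
        exact Submodule.neg_mem _ (aux b a hb ha (by omega) hxb h)
    by_cases hH : IsHall (br x y)
    · exact Submodule.subset_span ⟨x, y, hH, hn, lt_irrefl x, rfl⟩
    · cases y with
      | gen j => exact absurd (isHall_br_iff.2 ⟨hx, hy, hlt, by simp⟩) hH
      | br y z =>
        have hxy : Lt x y := by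
          by_contra h
          exact hH (isHall_br_iff.2 ⟨hx, hy, hlt, by rintro _ _ ⟨⟩; exact h⟩)
        obtain ⟨hy', hz', hyz, -⟩ := isHall_br_iff.1 hy
        have hxz := hxy.trans hyz
        have o₁ := one_le_order y
        have o₂ := one_le_order z
        simp only [order] at hn
        have h₁ := ih (x.order + y.order) (by omega) x y hx hy' rfl hxy
        have h₂ := ih (x.order + z.order) (by omega) x z hx hz' rfl hxz
        have big : ∀ u v, ¬ Lt u x → Lt x (br u v) := by
          intro u v h
          apply lt_of_commutators_lt
          have : x.commutators ≤ u.commutators := by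
            by_contra h'
            exact h (lt_of_commutators_lt (not_le.1 h'))
          simp only [commutators]; omega
        change ⁅x.toLie, ⁅y.toLie, z.toLie⁆⁆ ∈ _
        -- `[x,[y,z]] = [[x,y],z] + [y,[x,z]]`. The inner brackets have order below `n` and expand
        -- into words above `x`; both factors of each outer bracket are then above `x`, which is the
        -- case `inner`.
        rw [leibniz_lie]
        refine Submodule.add_mem _ ?_ ?_
        · clear h₂
          refine Submodule.span_induction (p := fun l _ => ⁅l, z.toLie⁆ ∈ bracketSpan n x)
            ?_ ?_ ?_ ?_ h₁
          · rintro _ ⟨u, v, huv, ho, hu, rfl⟩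
            exact inner _ _ huv hz' (by omega) (big u v hu) hxz
          · simp
          · intro a b _ _ ha hb
            rw [add_lie]; exact Submodule.add_mem _ ha hb
          · intro t a _ ha
            rw [smul_lie]; exact Submodule.smul_mem _ t ha
        · clear h₁
          refine Submodule.span_induction (p := fun l _ => ⁅y.toLie, l⁆ ∈ bracketSpan n x)
            ?_ ?_ ?_ ?_ h₂
          · rintro _ ⟨u, v, huv, ho, hu, rfl⟩
            exact inner _ _ hy' huv (by omega) hxy (big u v hu)
          · simp
          · intro a b _ _ ha hb
            rw [lie_add]; exact Submodule.add_mem _ ha hb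
          · intro t a _ ha
            rw [lie_smul]; exact Submodule.smul_mem _ t ha
  exact fun x y hx hy hn hlt => key _ x y hx hy hn hlt rfl

end LieWord

open LieWord

/-- Such a `p` is a Lie subalgebra; the universal map into it, followed by the inclusion, fixes the
generators and so is the identity. -/
theorem freeLie_induction {p : Submodule ℝ FreeLie} (of : ∀ n, FreeLieAlgebra.of ℝ n ∈ p)
    (lie : ∀ x ∈ p, ∀ y ∈ p, ⁅x, y⁆ ∈ p) : p = ⊤ := by
  let K : LieSubalgebra ℝ FreeLie := { p with lie_mem' := fun {x y} hx hy => lie x hx y hy }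
  let F : FreeLie →ₗ⁅ℝ⁆ K := FreeLieAlgebra.lift ℝ fun n => ⟨FreeLieAlgebra.of ℝ n, of n⟩
  have h : K.incl.comp F = LieHom.id := by
    ext n
    simp [F]
  rw [eq_top_iff]
  intro x _
  have := congrArg (fun f : FreeLie →ₗ⁅ℝ⁆ FreeLie => f x) h
  simp only [LieHom.comp_apply, LieHom.id_apply] at this
  rw [← this]
  exact (F x).2

theorem span_hall : Submodule.span ℝ (Set.range fun h : HallElement => h.1.toLie) = ⊤ := by
  refine freeLie_induction (fun n => Submodule.subset_span ⟨hallGen n, rfl⟩) ?_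
  have step : ∀ x y : LieWord, IsHall x → IsHall y → Lt x y → ⁅x.toLie, y.toLie⁆ ∈
      Submodule.span ℝ (Set.range fun h : HallElement => h.1.toLie) := by
    intro x y hx hy hlt
    refine Submodule.span_mono ?_ (lie_mem_bracketSpan _ x y hx hy rfl hlt)
    rintro _ ⟨u, v, h, -, -, rfl⟩
    exact ⟨⟨_, h⟩, rfl⟩
  intro x hx y hy
  refine Submodule.span_induction₂ (p := fun x y _ _ => ⁅x, y⁆ ∈
    Submodule.span ℝ (Set.range fun h : HallElement => h.1.toLie)) ?_ ?_ ?_ ?_ ?_ ?_ ?_ hx hy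
  · rintro _ _ ⟨⟨u, hu⟩, rfl⟩ ⟨⟨v, hv⟩, rfl⟩
    rcases lt_trichotomy u v with h | rfl | h
    · exact step u v hu hv h
    · simp
    · rw [← lie_skew]
      exact Submodule.neg_mem _ (step v u hv hu h)
  · simp
  · simp
  · intro a b c _ _ _ ha hb
    rw [add_lie]; exact Submodule.add_mem _ ha hb
  · intro a b c _ _ _ ha hb
    rw [lie_add]; exact Submodule.add_mem _ ha hb
  · intro t a b _ _ ha
    rw [smul_lie]; exact Submodule.smul_mem _ t ha
  · intro t a b _ _ ha
    rw [lie_smul]; exact Submodule.smul_mem _ t ha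

/-! ### Lazard elimination -/

section Elimination

/-- The free associative algebra with all words as letters. -/
abbrev WordAlg : Type := FreeAlgebra ℝ LieWord

open Classical in
/-- Evaluation of words in which brackets with left factor outside `Q` are letters. -/
def elimEval (Q : Finset LieWord) : LieWord → WordAlg
  | gen n => FreeAlgebra.ι ℝ (gen n)
  | br x y => if x ∈ Q then elimEval Q x * elimEval Q y - elimEval Q y * elimEval Q x
      else FreeAlgebra.ι ℝ (br x y)

/-- The homomorphism `a ↦ a + δ(a) ε` for the derivation `δ` with `δ(y) = [p, y]`. -/
def elimDual (p : LieWord) : WordAlg →ₐ[ℝ] TrivSqZeroExt WordAlg WordAlg :=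
  FreeAlgebra.lift ℝ fun y =>
    TrivSqZeroExt.inl (FreeAlgebra.ι ℝ y) + TrivSqZeroExt.inr (FreeAlgebra.ι ℝ (br p y))

theorem fst_elimDual (p : LieWord) (a : WordAlg) : (elimDual p a).fst = a := by
  have : (TrivSqZeroExt.fstHom ℝ WordAlg WordAlg).comp (elimDual p) = AlgHom.id ℝ WordAlg := by
    ext y
    simp [elimDual]
  exact congrArg (fun f : WordAlg →ₐ[ℝ] WordAlg => f a) this

/-- The derivation of the free algebra with `y ↦ [p, y]` on letters. -/
def elimDer (p : LieWord) : WordAlg →ₗ[ℝ] WordAlg where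
  toFun a := (elimDual p a).snd
  map_add' a b := by simp
  map_smul' t a := by simp

theorem elimDer_ι (p y : LieWord) :
    elimDer p (FreeAlgebra.ι ℝ y) = FreeAlgebra.ι ℝ (br p y) := by
  simp [elimDer, elimDual]

theorem elimDer_mul (p : LieWord) (a b : WordAlg) :
    elimDer p (a * b) = a * elimDer p b + elimDer p a * b := by
  simp [elimDer, fst_elimDual]

open Classical in
/-- The representation of the free algebra in which `p` acts as a derivation and the other
letters by multiplication. -/
def elimRep (p : LieWord) : WordAlg →ₐ[ℝ] Module.End ℝ WordAlg :=
  FreeAlgebra.lift ℝ fun y => if y = p then elimDer p else LinearMap.mulLeft ℝ (FreeAlgebra.ι ℝ y)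

/-- `Q` is an upper set in the set of Hall words of order at most `N`. -/
structure IsUpperHall (N : ℕ) (Q : Finset LieWord) : Prop where
  isHall : ∀ h ∈ Q, IsHall h
  order_le : ∀ h ∈ Q, h.order ≤ N
  upper : ∀ u v, u ∈ Q → IsHall v → v.order ≤ N → Lt u v → v ∈ Q

open Classical in
-- One elimination step. The commutator of a derivation `δ` with left multiplication by `b` is left
-- multiplication by `δ b`. So when `p` acts as the derivation, a commutator of `p` with a letter
-- `v` becomes multiplication by the new letter `br p v`, which is the value of this word once `p`
-- has left `Q`.
theorem elimRep_elimEval {N : ℕ} {Q : Finset LieWord} (hQ : IsUpperHall N Q) {p : LieWord}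
    (hp : p ∈ Q) (hmin : ∀ h ∈ Q, h ≠ p → Lt p h) : ∀ h ∈ Q, h ≠ p →
    elimRep p (elimEval Q h) = LinearMap.mulLeft ℝ (elimEval (Q.erase p) h) := by
  intro h
  induction h with
  | gen n =>
    intro _ hne
    simp [elimEval, elimRep, hne]
  | br u v ihu ihv =>
    intro hQ' hne
    obtain ⟨hu, hv, huv, hcond⟩ := isHall_br_iff.1 (hQ.isHall _ hQ')
    have ho := hQ.order_le _ hQ'
    simp only [order] at ho
    by_cases huQ : u ∈ Q
    · have hvQ : v ∈ Q := hQ.upper u v huQ hv (by omega) huv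
      have hpv : Lt p v := by
        by_cases hup : u = p
        · exact hup ▸ huv
        · exact (hmin u huQ hup).trans huv
      have hvp : v ≠ p := fun h => lt_irrefl p (h ▸ hpv)
      have h₂ := ihv hvQ hvp
      by_cases hup : u = p
      · subst hup
        -- The Hall condition is used here: the left factor of `v` is not above `p`, hence lies
        -- outside `Q.erase p`, and `v` is a letter.
        have hEv : elimEval (Q.erase u) v = FreeAlgebra.ι ℝ v := by
          cases v with
          | gen n => rfl
          | br y z =>
            have : y ∉ Q.erase u := by
              intro hy
              rw [Finset.mem_erase] at hy
              exact hcond y z rfl (hmin y hy.2 hy.1)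
            simp [elimEval, this]
        -- The left factor of `p` has fewer commutators than `p`, so by minimality it is not in `Q`.
        have hEu : elimEval Q u = FreeAlgebra.ι ℝ u := by
          cases u with
          | gen n => rfl
          | br y z =>
            have : y ∉ Q := by
              intro hy
              have hne : y ≠ br y z := by
                intro h
                have := congrArg sizeOf h
                simp only [br.sizeOf_spec] at this; omega
              have h₁ := (hmin y hy hne).commutators_le
              simp only [commutators] at h₁; omega
            simp [elimEval, this]
        have : u ∉ Q.erase u := by simp
        simp only [elimEval, huQ, this, if_true, if_false, map_sub, map_mul, h₂, hEv, hEu]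
        ext a
        simp [elimRep, elimDer_mul, elimDer_ι]
      · have h₁ := ihu huQ hup
        have : u ∈ Q.erase p := by simp [huQ, hup]
        simp only [elimEval, huQ, this, if_true, map_sub, map_mul, h₁, h₂]
        ext a
        simp [sub_mul, mul_assoc]
    · have : u ∉ Q.erase p := by simp [huQ]
      simp [elimEval, huQ, this, elimRep, hne]

open Classical in
-- The least word `p` of `Q` is a letter while every other element is another letter or a
-- commutator; this isolates `c p`. The elimination step transfers the remaining relation to
-- `Q.erase p`.
theorem elimEval_independent {N : ℕ} (c : LieWord → ℝ) : ∀ (k : ℕ) (Q : Finset LieWord),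
    Q.card = k → IsUpperHall N Q → ∑ h ∈ Q, c h • elimEval Q h = 0 → ∀ h ∈ Q, c h = 0 := by
  intro k
  induction k with
  | zero =>
    intro Q hk _ _ h hh
    rw [Finset.card_eq_zero] at hk
    simp [hk] at hh
  | succ k ih =>
    intro Q hk hQ hsum
    have hmin : ∃ p ∈ Q, ∀ h ∈ Q, h ≠ p → Lt p h := by
      have hne : Q.Nonempty := by rw [← Finset.card_pos]; omega
      clear hsum hk hQ
      induction hne using Finset.Nonempty.cons_induction with
      | singleton a => exact ⟨a, by simp, by simp⟩
      | cons a s ha hs ih =>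
        obtain ⟨p, hp, hmin⟩ := ih
        rcases lt_trichotomy a p with h | h | h
        · refine ⟨a, by simp, fun b hb hb' => ?_⟩
          rcases Finset.mem_cons.1 hb with rfl | hb
          · exact absurd rfl hb'
          · by_cases hbp : b = p
            · exact hbp ▸ h
            · exact h.trans (hmin b hb hbp)
        · exact absurd (h ▸ hp) ha
        · refine ⟨p, by simp [hp], fun b hb hb' => ?_⟩
          rcases Finset.mem_cons.1 hb with rfl | hb
          · exact h
          · exact hmin b hb hb'
    obtain ⟨p, hp, hmin⟩ := hmin
    have hcp : c p = 0 := by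
      -- The target is commutative, so commutators vanish and only the letter `p` survives.
      let χ : WordAlg →ₐ[ℝ] Polynomial ℝ :=
        FreeAlgebra.lift ℝ fun y => if y = p then Polynomial.X else 0
      have hχ : ∀ h ∈ Q, χ (elimEval Q h) = if h = p then Polynomial.X else 0 := by
        intro h hh
        cases h with
        | gen n => simp [elimEval, χ]
        | br x y =>
          by_cases hx : x ∈ Q
          · have hne : br x y ≠ p := by
              rintro rfl
              have hne : x ≠ br x y := by
                intro h
                have := congrArg sizeOf h
                simp only [br.sizeOf_spec] at this; omega
              have h₁ := (hmin x hx hne).commutators_le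
              simp only [commutators] at h₁; omega
            simp [elimEval, hx, hne, mul_comm]
          · simp [elimEval, hx, χ]
      have := congrArg χ hsum
      rw [map_sum, map_zero, Finset.sum_eq_single_of_mem p hp] at this
      · rw [map_smul, hχ p hp, if_pos rfl, smul_eq_zero] at this
        exact this.resolve_right Polynomial.X_ne_zero
      · intro b hb hbp
        rw [map_smul, hχ b hb, if_neg hbp, smul_zero]
    have hQ' : IsUpperHall N (Q.erase p) := by
      refine ⟨fun h hh => hQ.isHall h (Finset.mem_of_mem_erase hh),
        fun h hh => hQ.order_le h (Finset.mem_of_mem_erase hh), fun u v hu hv ho huv => ?_⟩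
      rw [Finset.mem_erase] at hu ⊢
      refine ⟨fun h => ?_, hQ.upper u v hu.2 hv ho huv⟩
      exact (hmin u hu.2 hu.1).asymm (h ▸ huv)
    have hsum' : ∑ h ∈ Q.erase p, c h • elimEval (Q.erase p) h = 0 := by
      rw [← Finset.add_sum_erase _ _ hp, hcp, zero_smul, zero_add] at hsum
      -- Applied to `1`, left multiplications turn back into elements of the algebra.
      have := congrArg (fun f : Module.End ℝ WordAlg => f 1) (congrArg (elimRep p) hsum)
      simp only [map_sum, map_zero, LinearMap.zero_apply] at this
      rw [← this, LinearMap.sum_apply]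
      refine Finset.sum_congr rfl fun h hh => ?_
      rw [Finset.mem_erase] at hh
      rw [map_smul, elimRep_elimEval hQ hp hmin h hh.2 hh.1]
      simp
    intro h hh
    by_cases hhp : h = p
    · exact hhp ▸ hcp
    · exact ih (Q.erase p) (by rw [Finset.card_erase_of_mem hp]; omega) hQ' hsum' h
        (Finset.mem_erase.2 ⟨hhp, hh⟩)

end Elimination

/-! ### Independence in the free associative algebra and the Hall basis -/

section ToAssoc

attribute [local instance 100] LieRing.ofAssociativeRing

theorem toAssoc_of (n : ℕ+) : toAssoc (FreeLieAlgebra.of ℝ n) = FreeAlgebra.ι ℝ n :=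
  FreeLieAlgebra.lift_of_apply _ _

theorem toAssoc_lie (x y : FreeLie) :
    toAssoc ⁅x, y⁆ = toAssoc x * toAssoc y - toAssoc y * toAssoc x := by
  rw [LieHom.map_lie]; rfl

/-- Finitely many Hall elements lie in the set `Q` of all Hall words up to some order. Since `Q`
contains the factors of its brackets, no bracket in `Q` is treated as a letter, and `elimEval Q` is
the ordinary evaluation by commutators. -/
theorem linearIndependent_toAssoc_hall :
    LinearIndependent ℝ fun h : HallElement => toAssoc h.1.toLie := by
  classical
  let Λ : FreeAssoc →ₐ[ℝ] WordAlg := FreeAlgebra.lift ℝ fun n => FreeAlgebra.ι ℝ (gen n)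
  rw [linearIndependent_iff']
  intro s g hg
  let N := s.sup fun h => h.1.order
  let Q : Finset LieWord := ((finite_order_le N).subset
    (fun _ h => h.2 : {w : LieWord | IsHall w ∧ w.order ≤ N} ⊆ _)).toFinset
  have hQmem : ∀ w, w ∈ Q ↔ IsHall w ∧ w.order ≤ N := fun w => by simp [Q]
  have hQ : IsUpperHall N Q :=
    ⟨fun h hh => ((hQmem h).1 hh).1, fun h hh => ((hQmem h).1 hh).2,
      fun u v _ hv ho _ => (hQmem v).2 ⟨hv, ho⟩⟩
  have hev : ∀ w ∈ Q, Λ (toAssoc w.toLie) = elimEval Q w := by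
    intro w
    induction w with
    | gen n =>
      intro _
      simp [LieWord.toLie, toAssoc_of, Λ, elimEval]
    | br u v ihu ihv =>
      intro h
      obtain ⟨h, ho⟩ := (hQmem _).1 h
      obtain ⟨hu, hv, -⟩ := isHall_br_iff.1 h
      simp only [order] at ho
      have huQ : u ∈ Q := (hQmem u).2 ⟨hu, by omega⟩
      have hvQ : v ∈ Q := (hQmem v).2 ⟨hv, by omega⟩
      simp only [LieWord.toLie, toAssoc_lie, map_sub, map_mul, ihu huQ, ihv hvQ, elimEval,
        huQ, if_true]
  let c : LieWord → ℝ := fun w => if h : IsHall w then if ⟨w, h⟩ ∈ s then g ⟨w, h⟩ else 0 else 0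
  have hsQ : s.map (Function.Embedding.subtype _) ⊆ Q := by
    intro w hw
    obtain ⟨h, hh, rfl⟩ := Finset.mem_map.1 hw
    exact (hQmem _).2 ⟨h.2, Finset.le_sup (f := fun h : HallElement => h.1.order) hh⟩
  have hsum : ∑ h ∈ Q, c h • elimEval Q h = 0 := by
    rw [← Finset.sum_subset hsQ, Finset.sum_map, ← map_zero Λ, ← hg, map_sum]
    · refine Finset.sum_congr rfl fun h hh => ?_
      have hh' : h.1 ∈ Q := hsQ (Finset.mem_map.2 ⟨h, hh, rfl⟩)
      simp [c, h.2, hh, ← hev h.1 hh']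
    · intro w _ hw
      have : c w = 0 := by
        simp only [c]
        split_ifs with h₁ h₂
        · exact absurd (Finset.mem_map.2 ⟨_, h₂, rfl⟩) hw
        · rfl
        · rfl
      rw [this, zero_smul]
  intro h hh
  have := elimEval_independent c _ Q rfl hQ hsum h.1 (hsQ (Finset.mem_map.2 ⟨h, hh, rfl⟩))
  simpa [c, h.2, hh] using this

/-- The Hall basis of the free Lie algebra. -/
def hallBasis : Module.Basis HallElement ℝ FreeLie :=
  Module.Basis.mk (v := fun h : HallElement => h.1.toLie)
    (LinearIndependent.of_comp (toAssoc : FreeLie →ₗ[ℝ] FreeAssoc) linearIndependent_toAssoc_hall)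
    span_hall.ge

theorem hallBasis_apply (h : HallElement) : hallBasis h = h.1.toLie := by
  simp [hallBasis]

/-- No Poincaré–Birkhoff–Witt theorem is needed: the Hall basis has an independent image. -/
theorem toAssoc_injective : Function.Injective toAssoc := by
  have : LinearMap.ker (toAssoc : FreeLie →ₗ[ℝ] FreeAssoc) = ⊥ := by
    rw [LinearMap.ker_eq_bot']
    intro x hx
    have h := linearIndependent_toAssoc_hall
    rw [← hallBasis.linearCombination_repr x, Finsupp.linearCombination_apply,
      Finsupp.sum, map_sum] at hx
    have h' := (linearIndependent_iff'.1 h) (hallBasis.repr x).support (hallBasis.repr x) (by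
      rw [← hx]
      refine Finset.sum_congr rfl fun i _ => ?_
      rw [map_smul, hallBasis_apply]; rfl)
    apply hallBasis.repr.injective
    ext i
    by_cases hi : i ∈ (hallBasis.repr x).support
    · simpa using h' i hi
    · simpa using hi
  exact LinearMap.ker_eq_bot.1 this

end ToAssoc

/-! ### Enumeration of the Hall words of small order -/

namespace LieWord

/-- Boolean equality of words. -/
def eqB : LieWord → LieWord → Bool
  | gen i, gen j => Nat.beq i j
  | br x y, br v w => eqB x v && eqB y w
  | _, _ => false

theorem eqB_iff : ∀ {x y : LieWord}, eqB x y = true ↔ x = y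
  | gen i, gen j => by simp [eqB]
  | gen _, br _ _ => by simp [eqB]
  | br _ _, gen _ => by simp [eqB]
  | br x y, br v w => by simp [eqB, eqB_iff (x := x), eqB_iff (x := y)]

/-- Boolean form of the order on words. -/
def ltB : LieWord → LieWord → Bool
  | gen i, gen j => Nat.blt i j
  | gen _, br _ _ => true
  | br _ _, gen _ => false
  | br x y, br v w => Nat.blt (commutators (br x y)) (commutators (br v w)) ||
      (Nat.beq (commutators (br x y)) (commutators (br v w)) && (ltB x v || (eqB x v && ltB y w)))

theorem ltB_iff : ∀ {x y : LieWord}, ltB x y = true ↔ Lt x y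
  | gen i, gen j => by simp only [ltB, Lt, Nat.blt_eq]; exact PNat.coe_lt_coe i j
  | gen _, br _ _ => by simp [ltB, Lt]
  | br _ _, gen _ => by simp [ltB, Lt]
  | br x y, br v w => by
    simp only [ltB, Lt, Bool.or_eq_true, Bool.and_eq_true, Nat.blt_eq, Nat.beq_eq, eqB_iff,
      ltB_iff (x := x), ltB_iff (x := y)]

/-- The condition on two Hall words under which their bracket is a Hall word. -/
def hallPairB (x : LieWord) : LieWord → Bool
  | gen j => ltB x (gen j)
  | br y z => ltB x (br y z) && !ltB x y

theorem isHall_br_iff_hallPairB {x w : LieWord} :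
    IsHall (br x w) ↔ IsHall x ∧ IsHall w ∧ hallPairB x w = true := by
  rw [isHall_br_iff]
  cases w <;> simp [hallPairB, ltB_iff, ← Bool.not_eq_true]

/-- The largest index of a generator in a word. -/
def maxGen : LieWord → ℕ
  | gen n => n
  | br x y => max (maxGen x) (maxGen y)

theorem contains_bound_iff {N : ℕ} : ∀ {w : LieWord},
    (∀ n : ℕ+, w.Contains n → 2 * (n : ℕ) ≤ N) ↔ 2 * maxGen w ≤ N
  | gen k => by simp [Contains, maxGen]
  | br x y => by
    have h₁ := contains_bound_iff (N := N) (w := x)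
    have h₂ := contains_bound_iff (N := N) (w := y)
    simp only [Contains, maxGen, or_imp, forall_and, h₁, h₂]
    omega

/-- The Hall words of order at most `n` in `A₁, …, A₄`. -/
def hallUpTo : ℕ → List LieWord
  | 0 => []
  | n + 1 =>
    let l := hallUpTo n
    ([1, 2, 3, 4] : List ℕ+).filterMap (fun k : ℕ+ => if Nat.ble k (n + 1) then some (gen k) else none) ++
      l.flatMap fun x => l.filterMap fun y =>
        if Nat.ble (x.order + y.order) (n + 1) && hallPairB x y then some (br x y) else none

/-- Every word has order at least `1`, so the factors of a bracket of order at most `n + 1` have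
order at most `n` and are already in the list. -/
theorem mem_hallUpTo (n : ℕ) : ∀ {w : LieWord},
    w ∈ hallUpTo n ↔ IsHall w ∧ w.order ≤ n ∧ maxGen w ≤ 4 := by
  induction n with
  | zero =>
    intro w
    have := one_le_order w
    simp only [hallUpTo, List.not_mem_nil, false_iff]
    omega
  | succ n ih =>
    intro w
    simp only [hallUpTo, List.mem_append, List.mem_flatMap, List.mem_filterMap, ih]
    cases w with
    | gen k =>
      have hk : ∀ k : ℕ+, k ∈ ([1, 2, 3, 4] : List ℕ+) ↔ (k : ℕ) ≤ 4 := by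
        intro k
        simp only [List.mem_cons, List.not_mem_nil, or_false, ← PNat.coe_inj]
        have := k.pos
        simp only [PNat.val_ofNat]
        omega
      simp only [hk, Option.ite_none_right_eq_some, Option.some.injEq, gen.injEq, reduceCtorEq,
        and_false, exists_false, or_false, order, maxGen, Nat.ble_eq]
      constructor
      · rintro ⟨k, h₁, h₂, rfl⟩
        exact ⟨.gen k, h₂, h₁⟩
      · rintro ⟨-, h₁, h₂⟩
        exact ⟨k, h₂, h₁, rfl⟩
    | br u v =>
      simp only [Option.ite_none_right_eq_some, Option.some.injEq, reduceCtorEq,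
        and_false, exists_false, false_or, br.injEq, Bool.and_eq_true, Nat.ble_eq, order, maxGen,
        isHall_br_iff_hallPairB]
      constructor
      · rintro ⟨x, ⟨hx, -, hx'⟩, y, ⟨hy, -, hy'⟩, ⟨h₁, h₂⟩, rfl, rfl⟩
        exact ⟨⟨hx, hy, h₂⟩, h₁, max_le hx' hy'⟩
      · rintro ⟨⟨hx, hy, h⟩, ho, hm⟩
        have := one_le_order u
        have := one_le_order v
        exact ⟨u, ⟨hx, by omega, by omega⟩, v, ⟨hy, by omega, by omega⟩, ⟨ho, h⟩, rfl, rfl⟩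

/-- The condition of belonging to the remaining elements, for Hall words. -/
def remainingB (N : ℕ) (w : LieWord) : Bool :=
  Nat.beq (w.order % 2) 1 && Nat.ble w.order N && Nat.ble (2 * maxGen w) N

theorem remainingB_iff {N : ℕ} {w : LieWord} : remainingB N w = true ↔
    Odd w.order ∧ w.order ≤ N ∧ ∀ n : ℕ+, w.Contains n → 2 * (n : ℕ) ≤ N := by
  simp only [remainingB, Bool.and_eq_true, Nat.beq_eq, Nat.ble_eq, contains_bound_iff,
    Nat.odd_iff, and_assoc]

/-- Boolean membership in a list of words. -/
def memB (w : LieWord) (l : List LieWord) : Bool := l.any (eqB w)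

theorem memB_iff {w : LieWord} {l : List LieWord} : memB w l = true ↔ w ∈ l := by
  simp [memB, List.any_eq_true, eqB_iff]

set_option maxRecDepth 100000 in
-- Order `8` and generators up to `A₄`, `4 = 8 / 2`, cover every `N ≤ 8`. The Boolean tests reduce
-- the comparison to kernel evaluation.
theorem hallUpTo_subset_hallTable :
    (hallUpTo 8).all (fun w => !remainingB 8 w || memB w hallTable) = true := by
  decide +kernel

set_option maxRecDepth 100000 in
theorem hallTable_subset_hallUpTo :
    hallTable.all (fun w => remainingB 8 w && memB w (hallUpTo 8)) = true := by
  decide +kernel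

set_option maxRecDepth 100000 in
theorem hallTable_pairwise : hallTable.Pairwise (fun x y => eqB x y = false) := by
  decide +kernel

theorem hallTable_nodup : hallTable.Nodup := by
  refine hallTable_pairwise.imp fun {x y} h => ?_
  intro h'
  rw [← eqB_iff, h] at h'
  simp at h'

theorem image_remainingElements {N : ℕ} (hN : N ≤ 8) :
    Subtype.val '' remainingElements N = {w : LieWord | w ∈ hallTable ∧ w.order ≤ N ∧
      ∀ n : ℕ+, w.Contains n → 2 * (n : ℕ) ≤ N} := by
  ext w
  have h₁ := List.all_eq_true.1 hallUpTo_subset_hallTable w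
  have h₂ := List.all_eq_true.1 hallTable_subset_hallUpTo w
  simp only [Bool.or_eq_true, Bool.not_eq_true', Bool.and_eq_true, memB_iff, mem_hallUpTo,
    ← Bool.not_eq_true, remainingB_iff, contains_bound_iff] at h₁ h₂
  simp only [remainingElements, Set.mem_image, Set.mem_ofPred_eq, Subtype.exists, exists_and_left,
    exists_prop, exists_eq_right_right, contains_bound_iff]
  constructor
  · rintro ⟨⟨h, h', h''⟩, hw⟩
    refine ⟨(h₁ ⟨hw, by omega, by omega⟩).resolve_left (fun h₃ => h₃ ⟨h, by omega, by omega⟩), h', h''⟩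
  · rintro ⟨h, h', h''⟩
    exact ⟨⟨(h₂ h).1.1, h', h''⟩, (h₂ h).2.1⟩

theorem ncard_remainingElements {N : ℕ} (hN : N ≤ 8) : (remainingElements N).ncard =
    (hallTable.filter fun w => Nat.ble w.order N && Nat.ble (2 * maxGen w) N).length := by
  classical
  rw [← Set.ncard_image_of_injective _ Subtype.val_injective, image_remainingElements hN,
    ← List.toFinset_card_of_nodup (hallTable_nodup.filter _), ← Set.ncard_coe_finset]
  congr 1
  ext w
  simp [contains_bound_iff]

end LieWord

/-! ### Shifted Legendre polynomials -/

open Polynomial in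
theorem polyPrimitive_monomial (n : ℕ) (c : ℝ) :
    polyPrimitive (monomial n c) = monomial (n + 1) (c / (n + 1)) := by
  have h : polyPrimitive (monomial n 1) = monomial (n + 1) ((n + 1 : ℝ)⁻¹) := by
    have := (Polynomial.basisMonomials ℝ).constr_basis ℝ
      (fun n : ℕ => Polynomial.monomial (n + 1) ((n + 1 : ℝ)⁻¹)) n
    rwa [coe_basisMonomials] at this
  rw [show monomial n c = c • monomial n (1 : ℝ) by simp [smul_monomial], map_smul, h,
    smul_monomial, smul_eq_mul, div_eq_mul_inv]

/-! ### Primitives and integrals of polynomials -/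

section Primitive

open Polynomial

theorem derivative_polyPrimitive (p : ℝ[X]) : derivative (polyPrimitive p) = p := by
  induction p using Polynomial.induction_on' with
  | add p q hp hq => rw [map_add, map_add, hp, hq]
  | monomial n c =>
    rw [polyPrimitive_monomial, derivative_monomial]
    have : (n + 1 : ℝ) ≠ 0 := by positivity
    simp [this]

theorem eval_zero_polyPrimitive (p : ℝ[X]) : (polyPrimitive p).eval 0 = 0 := by
  induction p using Polynomial.induction_on' with
  | add p q hp hq => rw [map_add, eval_add, hp, hq, add_zero]
  | monomial n c => simp [polyPrimitive_monomial, eval_monomial]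

theorem natDegree_polyPrimitive_le (p : ℝ[X]) : (polyPrimitive p).natDegree ≤ p.natDegree + 1 := by
  rw [p.as_sum_range' (p.natDegree + 1) (by omega), map_sum]
  refine natDegree_sum_le_of_forall_le _ _ fun i hi => ?_
  rw [polyPrimitive_monomial]
  rw [Finset.mem_range] at hi
  rw [← as_sum_range' _ _ (by omega)]
  exact (natDegree_monomial_le _).trans (by omega)

theorem eq_of_derivative_eq {p q : ℝ[X]} (h : derivative p = derivative q) (x : ℝ)
    (h₀ : p.eval x = q.eval x) : p = q := by
  have h₁ : derivative (p - q) = 0 := by rw [derivative_sub, h, sub_self]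
  rw [← sub_eq_zero, eq_C_of_derivative_eq_zero h₁]
  have h₂ : (p - q).eval x = 0 := by rw [eval_sub, h₀, sub_self]
  rw [eq_C_of_derivative_eq_zero h₁, eval_C] at h₂
  rw [h₂, C_0]

theorem polyPrimitive_derivative (p : ℝ[X]) : polyPrimitive (derivative p) = p - C (p.eval 0) := by
  refine eq_of_derivative_eq ?_ 0 ?_
  · rw [derivative_polyPrimitive, derivative_sub, derivative_C, sub_zero]
  · rw [eval_zero_polyPrimitive]; simp

/-- The integral of a polynomial over `[0, 1]`. -/
def polyIntegral : ℝ[X] →ₗ[ℝ] ℝ := Polynomial.leval 1 ∘ₗ polyPrimitive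

theorem polyIntegral_derivative (p : ℝ[X]) : polyIntegral (derivative p) = p.eval 1 - p.eval 0 := by
  simp [polyIntegral, polyPrimitive_derivative, leval]

theorem polyIntegral_mul_derivative (p q : ℝ[X]) : polyIntegral (p * derivative q) =
    p.eval 1 * q.eval 1 - p.eval 0 * q.eval 0 - polyIntegral (derivative p * q) := by
  have := polyIntegral_derivative (p * q)
  rw [derivative_mul, map_add, eval_mul, eval_mul] at this
  linarith

theorem integral_eval_polyPrimitive (p : ℝ[X]) (t : ℝ) :
    ∫ x in (0 : ℝ)..t, p.eval x = (polyPrimitive p).eval t := by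
  rw [intervalIntegral.integral_eq_sub_of_hasDerivAt (f := fun x => (polyPrimitive p).eval x)]
  · rw [eval_zero_polyPrimitive, sub_zero]
  · intro x _
    have := (polyPrimitive p).hasDerivAt x
    rwa [derivative_polyPrimitive] at this
  · exact p.continuous.intervalIntegrable _ _

theorem polyIntegral_eq (p : ℝ[X]) : ∫ x in (0 : ℝ)..1, p.eval x = polyIntegral p :=
  integral_eval_polyPrimitive p 1

end Primitive

/-! ### Reflection, orthogonality and completeness of the shifted Legendre polynomials -/

section Legendre

open Polynomial

theorem legendreP_rec (n : ℕ) : ((n : ℝ[X]) + 2) * legendreP (n + 2) =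
    (2 * (n : ℝ[X]) + 3) * (2 * X - 1) * legendreP (n + 1) - ((n : ℝ[X]) + 1) * legendreP n := by
  have h : ((n : ℝ) + 2) ≠ 0 := by positivity
  have hC : (C 2 : ℝ[X]) = 2 := rfl
  have h₁ : ((n : ℝ[X]) + 2) * C ((2 * (n + 1 : ℝ) + 1) / (n + 2)) = 2 * (n : ℝ[X]) + 3 := by
    rw [show ((n : ℝ[X]) + 2) = C ((n : ℝ) + 2) by simp [hC], ← C_mul, mul_div_cancel₀ _ h]
    simp [hC]; ring
  have h₂ : ((n : ℝ[X]) + 2) * C ((n + 1 : ℝ) / (n + 2)) = (n : ℝ[X]) + 1 := by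
    rw [show ((n : ℝ[X]) + 2) = C ((n : ℝ) + 2) by simp [hC], ← C_mul, mul_div_cancel₀ _ h]
    simp
  rw [legendreP, mul_sub, ← mul_assoc, ← mul_assoc, ← mul_assoc, h₁, h₂]

theorem natCast_add_ne_zero (n : ℕ) {k : ℕ} (hk : k ≠ 0) : ((n : ℝ[X]) + k) ≠ 0 := by
  exact_mod_cast (by omega : n + k ≠ 0)

/-- `2x - 1` changes sign under `x ↦ 1 - x`, and the recurrence alternates parity. This is the
source of time symmetry in rule (R1). -/
theorem legendreP_comp_one_sub (n : ℕ) :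
    (legendreP n).comp (1 - X) = (-1) ^ n * legendreP n := by
  induction n using Nat.twoStepInduction with
  | zero => simp [legendreP]
  | one => simp [legendreP]; ring
  | more n h₀ h₁ =>
    refine mul_left_cancel₀ (natCast_add_ne_zero n (k := 2) (by norm_num)) ?_
    have := congrArg (fun p : ℝ[X] => p.comp (1 - X)) (legendreP_rec n)
    simp only [mul_comp, sub_comp, add_comp, natCast_comp, X_comp, one_comp, h₀, h₁,
      ofNat_comp, Nat.cast_ofNat] at this
    rw [Nat.cast_ofNat, this]
    linear_combination -((-1) ^ n : ℝ[X]) * legendreP_rec n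

theorem legendreP_eval_one (n : ℕ) : (legendreP n).eval 1 = 1 := by
  induction n using Nat.twoStepInduction with
  | zero => simp [legendreP]
  | one => simp [legendreP]; ring
  | more n h₀ h₁ =>
    have := congrArg (eval 1) (legendreP_rec n)
    simp only [eval_mul, eval_sub, eval_add, eval_natCast, eval_X, eval_one, h₀, h₁,
      eval_ofNat] at this
    have h : ((n : ℝ) + 2) ≠ 0 := by positivity
    apply mul_left_cancel₀ h
    rw [this]; ring

theorem legendreP_eval_zero (n : ℕ) : (legendreP n).eval 0 = (-1) ^ n := by
  have := congrArg (eval 1) (legendreP_comp_one_sub n)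
  simpa [eval_comp, legendreP_eval_one] using this

theorem natDegree_legendreP_le (n : ℕ) : (legendreP n).natDegree ≤ n := by
  have h2 : (2 * X - 1 : ℝ[X]).natDegree ≤ 1 := by compute_degree
  induction n using Nat.twoStepInduction with
  | zero => simp [legendreP]
  | one => simpa [legendreP] using h2
  | more n h₀ h₁ =>
    rw [legendreP]
    refine (natDegree_sub_le _ _).trans (max_le ?_ ?_)
    · refine natDegree_mul_le.trans ?_
      have := (natDegree_C_mul_le ((2 * (n + 1 : ℝ) + 1) / (n + 2)) (2 * X - 1 : ℝ[X]))
      omega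
    · exact (natDegree_C_mul_le _ _).trans (by omega)

theorem coeff_legendreP_pos (n : ℕ) : 0 < (legendreP n).coeff n := by
  have : ∀ n, 0 < (legendreP (n + 1)).coeff (n + 1) := by
    intro n
    induction n with
    | zero => simp [legendreP, coeff_one]
    | succ n ih =>
      have h₀ : (legendreP n).coeff (n + 2) = 0 :=
        coeff_eq_zero_of_natDegree_lt ((natDegree_legendreP_le n).trans_lt (by omega))
      have h₁ : (legendreP (n + 1)).coeff (n + 2) = 0 :=
        coeff_eq_zero_of_natDegree_lt ((natDegree_legendreP_le (n + 1)).trans_lt (by omega))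
      rw [legendreP, coeff_sub, coeff_C_mul, h₀, mul_zero, sub_zero, mul_assoc, coeff_C_mul,
        sub_mul, one_mul, coeff_sub, h₁, sub_zero, mul_assoc, mul_comm, coeff_ofNat_mul,
        coeff_X_mul]
      positivity
  cases n with
  | zero => simp [legendreP]
  | succ n => exact this n

/-- The identities are proved jointly because the induction step of each uses the other. -/
theorem legendreP_derivative (n : ℕ) :
    (2 * X - 1) * derivative (legendreP (n + 1)) =
      derivative (legendreP n) + 2 * ((n : ℝ[X]) + 1) * legendreP (n + 1) ∧
    derivative (legendreP (n + 1)) =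
      2 * ((n : ℝ[X]) + 1) * legendreP n + (2 * X - 1) * derivative (legendreP n) := by
  induction n with
  | zero =>
    refine ⟨?_, by simp [legendreP]⟩
    simp [legendreP]
    ring
  | succ n ih =>
    obtain ⟨hA, hB⟩ := ih
    have hn := natCast_add_ne_zero n (k := 2) (by norm_num)
    have hr := legendreP_rec n
    have hd := congrArg derivative hr
    simp only [derivative_mul, derivative_sub, derivative_add, derivative_natCast, derivative_X,
      derivative_one, derivative_ofNat, add_zero, zero_add, zero_mul, mul_one, mul_zero,
      sub_zero] at hd
    have hB' : derivative (legendreP (n + 2)) = 2 * ((n : ℝ[X]) + 2) * legendreP (n + 1) +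
        (2 * X - 1) * derivative (legendreP (n + 1)) := by
      refine mul_left_cancel₀ hn ?_
      push_cast
      linear_combination hd + (n + 1 : ℝ[X]) * hA
    refine ⟨?_, by push_cast; rw [hB']; ring⟩
    push_cast
    linear_combination (2 * X - 1 : ℝ[X]) * hB' + (2 * X - 1 : ℝ[X]) * hA - hB - 2 * hr

theorem legendreP_eq_derivative (n : ℕ) : (2 * (2 * (n : ℝ[X]) + 3)) * legendreP (n + 1) =
    derivative (legendreP (n + 2)) - derivative (legendreP n) := by
  have h₁ := (legendreP_derivative (n + 1)).2
  have h₂ := (legendreP_derivative n).1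
  push_cast at h₁
  linear_combination -h₁ - h₂

/-- Integration by parts: `Pₙ₊₁` is a multiple of `P'ₙ₊₂ - P'ₙ`, the boundary terms cancel because
`Pₙ₊₂` and `Pₙ` agree at `0` and `1`, and `q'` has lower degree. -/
theorem polyIntegral_mul_legendreP (k : ℕ) : ∀ (q : ℝ[X]) (n : ℕ), q.degree < k → k ≤ n →
    polyIntegral (q * legendreP n) = 0 := by
  induction k with
  | zero =>
    intro q n hq _
    have : q = 0 := by
      rw [← degree_eq_bot]
      exact Nat.WithBot.lt_zero_iff.1 (by simpa using hq)
    rw [this, zero_mul, map_zero]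
  | succ k ih =>
    intro q n hq hn
    obtain ⟨n, rfl⟩ : ∃ m, n = m + 1 := ⟨n - 1, by omega⟩
    have hd : (derivative q).degree < k := by
      by_cases h0 : q = 0
      · rw [h0, derivative_zero, degree_zero]; exact WithBot.bot_lt_coe _
      · by_cases h1 : derivative q = 0
        · rw [h1, degree_zero]; exact WithBot.bot_lt_coe _
        · have := degree_derivative_lt h0
          rw [degree_eq_natDegree h0] at hq this
          rw [degree_eq_natDegree h1] at this ⊢
          have h2 : q.natDegree < k + 1 := by exact_mod_cast hq
          have h3 : (derivative q).natDegree < q.natDegree := by exact_mod_cast this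
          exact_mod_cast (by omega : (derivative q).natDegree < k)
    have h : polyIntegral (q * ((2 * (2 * (n : ℝ[X]) + 3)) * legendreP (n + 1))) = 0 := by
      rw [legendreP_eq_derivative, mul_sub, map_sub, polyIntegral_mul_derivative,
        polyIntegral_mul_derivative, legendreP_eval_one, legendreP_eval_one, legendreP_eval_zero,
        legendreP_eval_zero, ih _ (n + 2) hd (by omega)]
      by_cases hkn : k ≤ n
      · rw [ih _ n hd hkn]; ring
      · omega
    rw [show q * ((2 * (2 * (n : ℝ[X]) + 3)) * legendreP (n + 1)) =
      (2 * (2 * n + 3) : ℝ) • (q * legendreP (n + 1)) by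
        rw [smul_eq_C_mul]; simp [show (C 2 : ℝ[X]) = 2 from rfl, show (C 3 : ℝ[X]) = 3 from rfl]; ring, map_smul, smul_eq_zero] at h
    refine h.resolve_left ?_
    positivity

theorem polyIntegral_mul_legendreP_of_natDegree_lt {q : ℝ[X]} {n : ℕ} (h : q.natDegree < n) :
    polyIntegral (q * legendreP n) = 0 :=
  polyIntegral_mul_legendreP n q n (lt_of_le_of_lt degree_le_natDegree (by exact_mod_cast h)) le_rfl

/-- With `J = ∫ Pₙ₊₁²`, the integral of `(2x - 1) Pₙ₊₁ P'ₙ₊₁` is `2(n+1) J` by the derivative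
identity and `2 - 2J - 2(n+1) J` by parts, so `J = 1 / (2n + 3)`. -/
theorem polyIntegral_legendreP_sq (n : ℕ) :
    polyIntegral (legendreP n * legendreP n) = (2 * n + 1 : ℝ)⁻¹ := by
  cases n with
  | zero =>
    simp only [legendreP, mul_one]
    have := polyIntegral_derivative X
    simp at this
    simpa using this
  | succ n =>
    have h₁ : polyIntegral ((2 * X - 1) * legendreP (n + 1) * derivative (legendreP (n + 1))) =
        2 * (n + 1) * polyIntegral (legendreP (n + 1) * legendreP (n + 1)) := by
      rw [show (2 * X - 1) * legendreP (n + 1) * derivative (legendreP (n + 1)) =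
        derivative (legendreP n) * legendreP (n + 1) +
          (2 * (n + 1) : ℝ) • (legendreP (n + 1) * legendreP (n + 1)) by
          rw [smul_eq_C_mul]
          simp only [C_mul, C_add, map_natCast, C_1, show (C 2 : ℝ[X]) = 2 from rfl]
          linear_combination legendreP (n + 1) * (legendreP_derivative n).1, map_add, map_smul,
        polyIntegral_mul_legendreP_of_natDegree_lt, zero_add, smul_eq_mul]
      exact (natDegree_derivative_le _).trans_lt (by have := natDegree_legendreP_le n; omega)
    rw [polyIntegral_mul_derivative] at h₁
    simp only [eval_mul, eval_sub, eval_X, eval_one, legendreP_eval_one, legendreP_eval_zero,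
      derivative_mul, derivative_sub, derivative_X, derivative_one, eval_ofNat, derivative_ofNat,
      zero_mul, zero_add, mul_one, sub_zero] at h₁
    have h₂ : polyIntegral ((2 * legendreP (n + 1) + (2 * X - 1) * derivative (legendreP (n + 1))) *
        legendreP (n + 1)) = 2 * polyIntegral (legendreP (n + 1) * legendreP (n + 1)) +
        2 * (n + 1) * polyIntegral (legendreP (n + 1) * legendreP (n + 1)) := by
      rw [show (2 * legendreP (n + 1) + (2 * X - 1) * derivative (legendreP (n + 1))) *
        legendreP (n + 1) = derivative (legendreP n) * legendreP (n + 1) +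
          (2 + 2 * (n + 1) : ℝ) • (legendreP (n + 1) * legendreP (n + 1)) by
          rw [smul_eq_C_mul]
          simp only [C_mul, C_add, map_natCast, C_1, show (C 2 : ℝ[X]) = 2 from rfl]
          linear_combination legendreP (n + 1) * (legendreP_derivative n).1, map_add, map_smul,
        polyIntegral_mul_legendreP_of_natDegree_lt, zero_add, smul_eq_mul]
      · ring
      · exact (natDegree_derivative_le _).trans_lt (by have := natDegree_legendreP_le n; omega)
    rw [h₂] at h₁
    have h₃ : ((-1 : ℝ) ^ (n + 1)) * (-1) ^ (n + 1) = 1 := by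
      rw [← mul_pow]; simp
    push_cast
    refine eq_inv_of_mul_eq_one_left ?_
    ring_nf at h₁ h₃ ⊢
    linarith

theorem polyIntegral_legendreP_mul (m n : ℕ) : polyIntegral (legendreP m * legendreP n) =
    if m = n then (2 * n + 1 : ℝ)⁻¹ else 0 := by
  split_ifs with h
  · rw [h, polyIntegral_legendreP_sq]
  · rcases lt_or_gt_of_ne h with h | h
    · exact polyIntegral_mul_legendreP_of_natDegree_lt ((natDegree_legendreP_le m).trans_lt h)
    · rw [mul_comm]
      exact polyIntegral_mul_legendreP_of_natDegree_lt ((natDegree_legendreP_le n).trans_lt h)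

theorem exists_eq_sum_legendreP (N : ℕ) : ∀ q : ℝ[X], q.degree < N →
    ∃ a : ℕ → ℝ, q = ∑ k ∈ Finset.range N, a k • legendreP k := by
  induction N with
  | zero =>
    intro q hq
    exact ⟨0, by simpa using degree_eq_bot.1 (Nat.WithBot.lt_zero_iff.1 (by simpa using hq))⟩
  | succ N ih =>
    intro q hq
    let c := q.coeff N / (legendreP N).coeff N
    obtain ⟨a, ha⟩ := ih (q - c • legendreP N) (by
      rw [degree_lt_iff_coeff_zero]
      intro m hm
      rcases hm.eq_or_lt with rfl | hm
      · have := (coeff_legendreP_pos N).ne'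
        simp [c, this]
      · rw [coeff_sub, coeff_smul, coeff_eq_zero_of_natDegree_lt
          ((natDegree_legendreP_le N).trans_lt hm), smul_zero, sub_zero]
        exact (degree_lt_iff_coeff_zero _ _).1 hq m hm)
    refine ⟨Function.update a N c, ?_⟩
    rw [Finset.sum_range_succ, Function.update_self, eq_add_of_sub_eq ha]
    congr 1
    refine Finset.sum_congr rfl fun k hk => ?_
    rw [Function.update_of_ne (Finset.mem_range.1 hk).ne]

/-- A polynomial of degree less than `N` is the sum of its Legendre expansion. -/
theorem sum_legendre_expansion {N : ℕ} {q : ℝ[X]} (hq : q.degree < N) :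
    ∑ k ∈ Finset.range N, ((2 * k + 1 : ℝ) * polyIntegral (q * legendreP k)) • legendreP k = q := by
  obtain ⟨a, ha⟩ := exists_eq_sum_legendreP N q hq
  conv_rhs => rw [ha]
  refine Finset.sum_congr rfl fun k hk => ?_
  congr 1
  rw [ha, Finset.sum_mul, map_sum, Finset.sum_eq_single_of_mem k hk]
  · rw [smul_mul_assoc, map_smul, polyIntegral_legendreP_sq, smul_eq_mul]
    have : (2 * k + 1 : ℝ) ≠ 0 := by positivity
    field_simp
  · intro j _ hj
    rw [smul_mul_assoc, map_smul, polyIntegral_legendreP_mul, if_neg hj, smul_zero]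

end Legendre

/-! ### Formal exponentials -/

section FormalExp

variable {B : Type*} [Ring B]

/-- Agreement of two power series in all coefficients below `K`. -/
def EqBelow (K : ℕ) (f g : PowerSeries B) : Prop :=
  ∀ d < K, PowerSeries.coeff d f = PowerSeries.coeff d g

namespace EqBelow

variable {K M : ℕ} {f g h f' g' : PowerSeries B}

theorem refl (f : PowerSeries B) : EqBelow K f f := fun _ _ => rfl

theorem symm (h : EqBelow K f g) : EqBelow K g f := fun d hd => (h d hd).symm

theorem trans (h₁ : EqBelow K f g) (h₂ : EqBelow K g h) : EqBelow K f h :=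
  fun d hd => (h₁ d hd).trans (h₂ d hd)

theorem mono (h : EqBelow K f g) (hM : M ≤ K) : EqBelow M f g := fun d hd => h d (hd.trans_le hM)

theorem add (h₁ : EqBelow K f g) (h₂ : EqBelow K f' g') : EqBelow K (f + f') (g + g') :=
  fun d hd => by rw [map_add, map_add, h₁ d hd, h₂ d hd]

theorem sub (h₁ : EqBelow K f g) (h₂ : EqBelow K f' g') : EqBelow K (f - f') (g - g') :=
  fun d hd => by rw [map_sub, map_sub, h₁ d hd, h₂ d hd]

theorem neg (h₁ : EqBelow K f g) : EqBelow K (-f) (-g) :=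
  fun d hd => by rw [map_neg, map_neg, h₁ d hd]

theorem mul (h₁ : EqBelow K f g) (h₂ : EqBelow K f' g') : EqBelow K (f * f') (g * g') := by
  intro d hd
  rw [PowerSeries.coeff_mul, PowerSeries.coeff_mul]
  refine Finset.sum_congr rfl fun p hp => ?_
  have := Finset.HasAntidiagonal.mem_antidiagonal.1 hp
  rw [h₁ _ (by omega), h₂ _ (by omega)]

theorem pow (h₁ : EqBelow K f g) (n : ℕ) : EqBelow K (f ^ n) (g ^ n) := by
  induction n with
  | zero => simpa using refl 1
  | succ n ih => rw [pow_succ, pow_succ]; exact ih.mul h₁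

theorem sum {ι : Type*} {s : Finset ι} {F G : ι → PowerSeries B}
    (h : ∀ i ∈ s, EqBelow K (F i) (G i)) : EqBelow K (∑ i ∈ s, F i) (∑ i ∈ s, G i) := by
  intro d hd
  rw [map_sum, map_sum]
  exact Finset.sum_congr rfl fun i hi => h i hi d hd

theorem mul_zero_add (h₁ : EqBelow K f 0) (h₂ : EqBelow M g 0) : EqBelow (K + M) (f * g) 0 := by
  intro d hd
  rw [PowerSeries.coeff_mul, map_zero]
  refine Finset.sum_eq_zero fun p hp => ?_
  have := Finset.HasAntidiagonal.mem_antidiagonal.1 hp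
  by_cases h : p.1 < K
  · rw [h₁ _ h, map_zero, zero_mul]
  · rw [h₂ p.2 (by omega), map_zero, mul_zero]

theorem pow_zero_of (h₁ : EqBelow 1 f 0) (n : ℕ) : EqBelow n (f ^ n) 0 := by
  induction n with
  | zero => intro d hd; omega
  | succ n ih => rw [pow_succ]; exact ih.mul_zero_add h₁

theorem mul_zero_left (h₁ : EqBelow K f 0) (g : PowerSeries B) : EqBelow K (f * g) 0 := by
  simpa using h₁.mul (refl g)

theorem mul_zero_right (h₁ : EqBelow K g 0) (f : PowerSeries B) : EqBelow K (f * g) 0 := by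
  simpa using (refl f).mul h₁

theorem sum_zero {ι : Type*} {s : Finset ι} {F : ι → PowerSeries B}
    (h : ∀ i ∈ s, EqBelow K (F i) 0) : EqBelow K (∑ i ∈ s, F i) 0 := by
  simpa using sum (G := fun _ => 0) h

theorem sub_zero_iff : EqBelow K (f - g) 0 ↔ EqBelow K f g := by
  simp [EqBelow, sub_eq_zero]

theorem eq (h : ∀ K, EqBelow K f g) : f = g := by
  ext d
  exact h (d + 1) d (by omega)

end EqBelow

/-- Without constant terms, each extra factor raises the order of the difference. Hence the top
coefficient of an exponential depends on the top coefficient of the exponent through the linear term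
only. -/
theorem EqBelow.pow_succ_of {a b : PowerSeries B} {K : ℕ} (ha : EqBelow 1 a 0) (hb : EqBelow 1 b 0)
    (h : EqBelow K a b) (n : ℕ) : EqBelow (K + 1) (a ^ (n + 2)) (b ^ (n + 2)) := by
  rw [← EqBelow.sub_zero_iff, show a ^ (n + 2) - b ^ (n + 2) =
    a * (a ^ (n + 1) - b ^ (n + 1)) + (a - b) * b ^ (n + 1) by
      rw [pow_succ' a (n + 1), pow_succ' b (n + 1)]; noncomm_ring]
  have h₁ := ha.mul_zero_add (EqBelow.sub_zero_iff.2 (h.pow (n + 1)))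
  have h₂ := (EqBelow.sub_zero_iff.2 h).mul_zero_add (hb.pow_zero_of (n + 1))
  simpa using (h₁.mono (by omega : K + 1 ≤ 1 + K)).add (h₂.mono (by omega : K + 1 ≤ K + (n + 1)))

/-- The iterated commutator `[a, [a, … [a, b] … ]]`. -/
def adIter (a : PowerSeries B) (b : PowerSeries B) : ℕ → PowerSeries B
  | 0 => b
  | k + 1 => a * adIter a b k - adIter a b k * a

theorem EqBelow.adIter_zero {a b : PowerSeries B} (ha : EqBelow 1 a 0) {K : ℕ}
    (hb : EqBelow K b 0) (k : ℕ) : EqBelow (K + k) (adIter a b k) 0 := by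
  induction k with
  | zero => exact hb
  | succ k ih =>
    have h₁ := ha.mul_zero_add ih
    have h₂ := ih.mul_zero_add ha
    simpa [adIter] using (h₁.mono (by omega : K + (k + 1) ≤ 1 + (K + k))).sub h₂

variable [Algebra ℝ B]

theorem EqBelow.smul {K : ℕ} {f g : PowerSeries B} (h₁ : EqBelow K f g) (r : ℝ) :
    EqBelow K (r • f) (r • g) := fun d hd => by
  rw [LinearMap.map_smul_of_tower, LinearMap.map_smul_of_tower, h₁ d hd]

/-- The exponential of a power series without constant term. -/
def powExp (a : PowerSeries B) : PowerSeries B :=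
  PowerSeries.mk fun d =>
    ∑ k ∈ Finset.range (d + 1), ((k.factorial : ℝ)⁻¹) • PowerSeries.coeff d (a ^ k)

/-- The partial sums of the exponential series. -/
def powExpSum (K : ℕ) (a : PowerSeries B) : PowerSeries B :=
  ∑ k ∈ Finset.range K, ((k.factorial : ℝ)⁻¹) • a ^ k

theorem powExp_eqBelow {a : PowerSeries B} (ha : EqBelow 1 a 0) {K M : ℕ} (hM : K ≤ M) :
    EqBelow K (powExp a) (powExpSum M a) := by
  intro d hd
  rw [powExp, PowerSeries.coeff_mk, powExpSum, map_sum]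
  rw [← Finset.sum_subset (Finset.range_mono (by omega : d + 1 ≤ M))]
  · exact Finset.sum_congr rfl fun k _ => (LinearMap.map_smul_of_tower _ _ _).symm
  · intro k _ hk
    rw [Finset.mem_range, not_lt] at hk
    rw [LinearMap.map_smul_of_tower, ha.pow_zero_of k d (by omega), map_zero, smul_zero]

theorem coeff_zero_powExp (a : PowerSeries B) : PowerSeries.coeff 0 (powExp a) = 1 := by
  simp [powExp]

/-- Only one element `a` occurs, so this is an identity of real polynomials: `exp X · exp (-X) = 1`
makes `P Q - 1` divisible by `X ^ K`, and `a ^ K` starts at order `K`. -/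
theorem powExpSum_mul_neg (K : ℕ) {a : PowerSeries B} (ha : EqBelow 1 a 0) :
    EqBelow K (powExpSum K a * powExpSum K (-a)) 1 := by
  let P : Polynomial ℝ := ∑ k ∈ Finset.range K, Polynomial.monomial k ((k.factorial : ℝ)⁻¹)
  let Q : Polynomial ℝ := ∑ k ∈ Finset.range K, Polynomial.monomial k ((-1) ^ k * (k.factorial : ℝ)⁻¹)
  have hP : Polynomial.aeval a P = powExpSum K a := by
    simp [P, powExpSum, Polynomial.aeval_monomial, Algebra.smul_def]
  have hQ : Polynomial.aeval a Q = powExpSum K (-a) := by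
    simp only [Q, powExpSum, map_sum, Polynomial.aeval_monomial, Algebra.smul_def]
    refine Finset.sum_congr rfl fun k _ => ?_
    rw [neg_pow a k, map_mul, map_pow, map_neg, map_one, ← mul_assoc]
    congr 1
    exact (((Commute.one_right _).neg_right).pow_right k).symm
  have hdvd : Polynomial.X ^ K ∣ P * Q - 1 := by
    rw [Polynomial.X_pow_dvd_iff]
    intro d hd
    have h₁ : ∀ i < K, P.coeff i = PowerSeries.coeff i (PowerSeries.exp ℝ) := by
      intro i hi
      simp [P, Polynomial.coeff_monomial, hi]
    have h₂ : ∀ i < K, Q.coeff i =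
        PowerSeries.coeff i (PowerSeries.evalNegHom (PowerSeries.exp ℝ)) := by
      intro i hi
      simp [Q, Polynomial.coeff_monomial, hi, PowerSeries.evalNegHom,
        PowerSeries.coeff_rescale]
    rw [Polynomial.coeff_sub, Polynomial.coeff_mul]
    have h := congrArg (PowerSeries.coeff d) (PowerSeries.exp_mul_exp_neg_eq_one (A := ℝ))
    rw [PowerSeries.coeff_mul] at h
    rw [sub_eq_zero, Polynomial.coeff_one, ← show _ = _ from PowerSeries.coeff_one (R := ℝ) d, ← h]
    refine Finset.sum_congr rfl fun p hp => ?_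
    have := Finset.HasAntidiagonal.mem_antidiagonal.1 hp
    rw [h₁ _ (by omega), h₂ _ (by omega)]
  obtain ⟨S, hS⟩ := hdvd
  rw [← EqBelow.sub_zero_iff, ← hP, ← hQ, ← map_mul, ← map_one (Polynomial.aeval (R := ℝ) a),
    ← map_sub, hS, map_mul, map_pow, Polynomial.aeval_X]
  exact (ha.pow_zero_of K).mul_zero_left _

theorem EqBelow.powExp {a b : PowerSeries B} {K : ℕ} (h : EqBelow K a b) :
    EqBelow K (powExp a) (powExp b) := by
  intro d hd
  rw [CFET.powExp, CFET.powExp, PowerSeries.coeff_mk, PowerSeries.coeff_mk]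
  exact Finset.sum_congr rfl fun k _ => by rw [h.pow k d hd]

theorem powExp_mul_neg {a : PowerSeries B} (ha : EqBelow 1 a 0) :
    powExp a * powExp (-a) = 1 := by
  refine EqBelow.eq fun K => ?_
  have ha' : EqBelow 1 (-a) 0 := by simpa using ha.neg
  exact ((powExp_eqBelow ha le_rfl).mul (powExp_eqBelow ha' le_rfl)).trans (powExpSum_mul_neg K ha)

/-- The coefficient `d` of an exponential is that of its exponent plus a part that depends on the
lower coefficients. -/
theorem coeff_powExp_sub {a b : PowerSeries B} (ha : EqBelow 1 a 0) (hb : EqBelow 1 b 0) {d : ℕ}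
    (h : EqBelow d a b) : PowerSeries.coeff d (powExp a) - PowerSeries.coeff d (powExp b) =
      PowerSeries.coeff d a - PowerSeries.coeff d b := by
  rw [powExp_eqBelow ha (by omega : d + 1 ≤ d + 2) d (by omega),
    powExp_eqBelow hb (by omega : d + 1 ≤ d + 2) d (by omega), powExpSum, powExpSum,
    Finset.sum_range_succ', Finset.sum_range_succ', Finset.sum_range_succ', Finset.sum_range_succ']
  simp only [map_add, map_sum, LinearMap.map_smul_of_tower]
  rw [Finset.sum_congr rfl fun k _ => congrArg _ (EqBelow.pow_succ_of ha hb h k d (by omega))]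
  simp

/-- The exponential is injective order by order: once the lower coefficients agree, the exponentials
differ exactly as their exponents do. -/
theorem eqBelow_of_powExp {a b : PowerSeries B} (ha : EqBelow 1 a 0) (hb : EqBelow 1 b 0) {K : ℕ}
    (h : EqBelow K (powExp a) (powExp b)) : EqBelow K a b := by
  intro d
  induction d using Nat.strong_induction_on with
  | _ d ih =>
    intro hd
    have := coeff_powExp_sub ha hb (d := d) fun e he => ih e he (he.trans hd)
    rw [h d hd, sub_self] at this
    exact (sub_eq_zero.1 this.symm)

/-- A derivation that acts on the coefficients of power series separately. -/
structure IsCoeffDerivation (D : PowerSeries B →ₗ[ℝ] PowerSeries B) : Prop where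
  leibniz : ∀ f g, D (f * g) = D f * g + f * D g
  eqBelow : ∀ K f, EqBelow K f 0 → EqBelow K (D f) 0

theorem IsCoeffDerivation.eqBelow' {D : PowerSeries B →ₗ[ℝ] PowerSeries B}
    (hD : IsCoeffDerivation D) {K : ℕ} {f g : PowerSeries B} (h : EqBelow K f g) :
    EqBelow K (D f) (D g) := by
  rw [← EqBelow.sub_zero_iff, ← map_sub]
  exact hD.eqBelow K _ (EqBelow.sub_zero_iff.2 h)

theorem IsCoeffDerivation.map_one {D : PowerSeries B →ₗ[ℝ] PowerSeries B}
    (hD : IsCoeffDerivation D) : D 1 = 0 := by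
  have := hD.leibniz 1 1
  simpa using this

/-- Moving `D a` and its iterated commutators to the left uses `a · adᵏ = adᵏ⁺¹ + adᵏ · a`; Pascal's
rule collects the terms. -/
theorem IsCoeffDerivation.map_pow {D : PowerSeries B →ₗ[ℝ] PowerSeries B}
    (hD : IsCoeffDerivation D) (a : PowerSeries B) (n : ℕ) :
    D (a ^ (n + 1)) = ∑ k ∈ Finset.range (n + 1),
      (n + 1).choose (k + 1) • (adIter a (D a) k * a ^ (n - k)) := by
  induction n with
  | zero => simp [adIter]
  | succ n ih =>
    rw [pow_succ', hD.leibniz, ih]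
    have h₁ : ∀ k ∈ Finset.range (n + 2), (n + 1 + 1).choose (k + 1) •
        (adIter a (D a) k * a ^ (n + 1 - k)) =
        (n + 1).choose (k + 1) • (adIter a (D a) k * a ^ (n + 1 - k)) +
        (n + 1).choose k • (adIter a (D a) k * a ^ (n + 1 - k)) := by
      intro k _
      rw [Nat.choose_succ_succ, add_smul, add_comm]
    rw [Finset.sum_congr rfl h₁, Finset.sum_add_distrib,
      Finset.sum_range_succ (fun k => (n + 1).choose (k + 1) •
        (adIter a (D a) k * a ^ (n + 1 - k))) (n + 1),
      Finset.sum_range_succ' (fun k => (n + 1).choose k •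
        (adIter a (D a) k * a ^ (n + 1 - k))) (n + 1), Nat.choose_succ_self, zero_smul,
      add_zero, Finset.mul_sum, Nat.choose_zero_right, one_smul, adIter, Nat.sub_zero, add_comm,
      ← add_assoc, ← Finset.sum_add_distrib]
    congr 1
    refine Finset.sum_congr rfl fun k hk => ?_
    rw [Finset.mem_range] at hk
    rw [Nat.add_sub_add_right, show n + 1 - k = n - k + 1 by omega, adIter, ← smul_add, mul_smul_comm,
      sub_mul, pow_succ']
    congr 1
    noncomm_ring

/-- The truncated derivative of the exponential map. -/
def dexpSum (K : ℕ) (a b : PowerSeries B) : PowerSeries B :=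
  ∑ k ∈ Finset.range K, (((k + 1).factorial : ℝ)⁻¹) • adIter a b k

theorem EqBelow.dexpSum_of_le {a b : PowerSeries B} (ha : EqBelow 1 a 0) {K M : ℕ} (h : K ≤ M) :
    EqBelow K (dexpSum K a b) (dexpSum M a b) := by
  intro d hd
  rw [dexpSum, dexpSum, map_sum, map_sum]
  refine Finset.sum_subset (Finset.range_mono h) fun k _ hk => ?_
  rw [Finset.mem_range, not_lt] at hk
  have h₀ : EqBelow 0 b 0 := fun d hd => absurd hd (by omega)
  rw [LinearMap.map_smul_of_tower, EqBelow.adIter_zero ha h₀ k d (by omega), map_zero, smul_zero]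

/-- `D (exp a) = dexpₐ (D a) exp a` for a derivation `D`. -/
theorem IsCoeffDerivation.map_powExp {D : PowerSeries B →ₗ[ℝ] PowerSeries B}
    (hD : IsCoeffDerivation D) {a : PowerSeries B} (ha : EqBelow 1 a 0) (K : ℕ) :
    EqBelow K (D (powExp a)) (dexpSum K a (D a) * powExp a) := by
  have h₁ : D (powExpSum (K + 1) a) = ∑ n ∈ Finset.range K, ∑ k ∈ Finset.range (n + 1),
      ((((k + 1).factorial : ℝ)⁻¹) • adIter a (D a) k) *
        ((((n - k).factorial : ℝ)⁻¹) • a ^ (n - k)) := by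
    rw [powExpSum, Finset.sum_range_succ', map_add, pow_zero, map_smul, hD.map_one, smul_zero,
      add_zero, map_sum]
    refine Finset.sum_congr rfl fun n _ => ?_
    rw [map_smul, hD.map_pow, Finset.smul_sum]
    refine Finset.sum_congr rfl fun k hk => ?_
    rw [Finset.mem_range] at hk
    rw [smul_mul_smul_comm, ← Nat.cast_smul_eq_nsmul ℝ, smul_smul,
      Nat.cast_choose ℝ (by omega : k + 1 ≤ n + 1), Nat.add_sub_add_right]
    congr 1
    have h₁ := Nat.factorial_ne_zero (n + 1)
    have h₂ := Nat.factorial_ne_zero (k + 1)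
    have h₃ := Nat.factorial_ne_zero (n - k)
    field_simp
  have h₂ : EqBelow K (dexpSum K a (D a) * powExpSum K a) (D (powExpSum (K + 1) a)) := by
    rw [h₁, dexpSum, powExpSum, Finset.sum_mul_sum]
    have h₀ : EqBelow 0 (D a) 0 := fun d hd => absurd hd (by omega)
    have h₃ : ∀ i j, K ≤ i + j → EqBelow K (((((i + 1).factorial : ℝ)⁻¹) • adIter a (D a) i) *
        (((j.factorial : ℝ)⁻¹) • a ^ j)) 0 := by
      intro i j hij
      rw [smul_mul_smul_comm]
      have := ((EqBelow.adIter_zero ha h₀ i).mul_zero_add (ha.pow_zero_of j)).mono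
        (by omega : K ≤ 0 + i + j)
      simpa using this.smul _
    -- Cauchy product with `i = k` and `j = n - k`; by `h₃` the pairs with `i + j ≥ K` do not matter
    -- below order `K`.
    have h₄ : ∑ n ∈ Finset.range K, ∑ k ∈ Finset.range (n + 1),
        ((((k + 1).factorial : ℝ)⁻¹) • adIter a (D a) k) *
        ((((n - k).factorial : ℝ)⁻¹) • a ^ (n - k)) =
        ∑ i ∈ Finset.range K, ∑ j ∈ Finset.range K, if i + j < K then
          ((((i + 1).factorial : ℝ)⁻¹) • adIter a (D a) i) * (((j.factorial : ℝ)⁻¹) • a ^ j)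
          else 0 := by
      rw [Finset.sum_sigma', Finset.sum_sigma', ← Finset.sum_filter]
      refine Finset.sum_bij' (fun x _ => ⟨x.2, x.1 - x.2⟩) (fun x _ => ⟨x.1 + x.2, x.1⟩)
        ?_ ?_ ?_ ?_ ?_
      · rintro ⟨n, k⟩ h
        simp only [Finset.mem_sigma, Finset.mem_range, Finset.mem_filter] at h ⊢
        omega
      · rintro ⟨n, k⟩ h
        simp only [Finset.mem_sigma, Finset.mem_range, Finset.mem_filter] at h ⊢
        omega
      · rintro ⟨n, k⟩ h
        simp only [Finset.mem_sigma, Finset.mem_range] at h ⊢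
        simp only [Sigma.mk.injEq, heq_eq_eq, and_true]
        omega
      · rintro ⟨n, k⟩ h
        simp
      · rintro ⟨n, k⟩ h
        rfl
    rw [h₄]
    refine EqBelow.sum fun i _ => EqBelow.sum fun j _ => ?_
    split_ifs with h
    · exact EqBelow.refl _
    · exact h₃ i j (not_lt.1 h)
  exact ((hD.eqBelow' (powExp_eqBelow ha (by omega : K ≤ K + 1))).trans h₂.symm).trans
    ((EqBelow.refl _).mul (powExp_eqBelow ha le_rfl).symm)

end FormalExp

/-! ### Coefficientwise maps of power series -/

section CoeffMaps

variable {B B' : Type*} [Ring B] [Algebra ℝ B] [Ring B'] [Algebra ℝ B']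

/-- The homomorphism `∑ b_d T^d ↦ ∑ σ(b_d) (c T)^d`. -/
def coeffScale (c : ℝ) (σ : B →ₐ[ℝ] B') : PowerSeries B →ₐ[ℝ] PowerSeries B' :=
  AlgHom.ofLinearMap
    { toFun := fun f => PowerSeries.mk fun d => c ^ d • σ (PowerSeries.coeff d f)
      map_add' := fun f g => by ext d; simp
      map_smul' := fun r f => by
        ext d
        simp only [LinearMap.map_smul_of_tower, PowerSeries.coeff_mk, map_smul, RingHom.id_apply]
        rw [smul_comm] }
    (by
      ext d
      simp only [LinearMap.coe_mk, AddHom.coe_mk, PowerSeries.coeff_mk, PowerSeries.coeff_one]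
      split_ifs with h
      · simp [h]
      · simp)
    (by
      intro f g
      ext d
      simp only [LinearMap.coe_mk, AddHom.coe_mk, PowerSeries.coeff_mk, PowerSeries.coeff_mul,
        map_sum, Finset.smul_sum, map_mul]
      refine Finset.sum_congr rfl fun p hp => ?_
      rw [smul_mul_smul_comm, ← pow_add, Finset.HasAntidiagonal.mem_antidiagonal.1 hp])

theorem coeff_coeffScale (c : ℝ) (σ : B →ₐ[ℝ] B') (f : PowerSeries B) (d : ℕ) :
    PowerSeries.coeff d (coeffScale c σ f) = c ^ d • σ (PowerSeries.coeff d f) := by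
  simp [coeffScale]

theorem coeffScale_monomial (c : ℝ) (σ : B →ₐ[ℝ] B') (n : ℕ) (b : B) :
    coeffScale c σ (PowerSeries.monomial n b) = PowerSeries.monomial n (c ^ n • σ b) := by
  ext d
  rw [coeff_coeffScale, PowerSeries.coeff_monomial, PowerSeries.coeff_monomial]
  split_ifs with h
  · rw [h]
  · simp

theorem EqBelow.coeffScale {K : ℕ} {f g : PowerSeries B} (h : EqBelow K f g) (c : ℝ)
    (σ : B →ₐ[ℝ] B') : EqBelow K (coeffScale c σ f) (coeffScale c σ g) := fun d hd => by
  rw [coeff_coeffScale, coeff_coeffScale, h d hd]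

theorem coeffScale_powExp (c : ℝ) (σ : B →ₐ[ℝ] B') (a : PowerSeries B) :
    coeffScale c σ (powExp a) = powExp (coeffScale c σ a) := by
  ext d
  rw [coeff_coeffScale, powExp, powExp, PowerSeries.coeff_mk, PowerSeries.coeff_mk, map_sum,
    Finset.smul_sum]
  refine Finset.sum_congr rfl fun k _ => ?_
  rw [← map_pow, coeff_coeffScale, map_smul, smul_comm]

/-- The map of power series that applies a linear map to the coefficients. -/
def coeffMap (φ : B →ₗ[ℝ] B') : PowerSeries B →ₗ[ℝ] PowerSeries B' where
  toFun f := PowerSeries.mk fun d => φ (PowerSeries.coeff d f)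
  map_add' f g := by ext d; simp
  map_smul' r f := by ext d; simp [LinearMap.map_smul_of_tower]

theorem coeff_coeffMap (φ : B →ₗ[ℝ] B') (f : PowerSeries B) (d : ℕ) :
    PowerSeries.coeff d (coeffMap φ f) = φ (PowerSeries.coeff d f) := by
  simp [coeffMap]

theorem coeffMap_monomial (φ : B →ₗ[ℝ] B') (n : ℕ) (b : B) :
    coeffMap φ (PowerSeries.monomial n b) = PowerSeries.monomial n (φ b) := by
  ext d
  rw [coeff_coeffMap, PowerSeries.coeff_monomial, PowerSeries.coeff_monomial]
  split_ifs <;> simp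

theorem EqBelow.coeffMap {K : ℕ} {f g : PowerSeries B} (h : EqBelow K f g) (φ : B →ₗ[ℝ] B') :
    EqBelow K (coeffMap φ f) (coeffMap φ g) := fun d hd => by
  rw [coeff_coeffMap, coeff_coeffMap, h d hd]

theorem isCoeffDerivation_coeffMap {φ : B →ₗ[ℝ] B} (h : ∀ x y, φ (x * y) = φ x * y + x * φ y) :
    IsCoeffDerivation (coeffMap φ) where
  leibniz f g := by
    ext d
    simp only [coeff_coeffMap, PowerSeries.coeff_mul, map_sum, map_add, h, Finset.sum_add_distrib]
  eqBelow K f hf := by simpa using hf.coeffMap φ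

/-- The derivation `T d/dT` of power series. -/
def eulerDer : PowerSeries B →ₗ[ℝ] PowerSeries B where
  toFun f := PowerSeries.mk fun d => (d : ℝ) • PowerSeries.coeff d f
  map_add' f g := by ext d; simp
  map_smul' r f := by
    ext d
    simp only [LinearMap.map_smul_of_tower, PowerSeries.coeff_mk, RingHom.id_apply]
    rw [smul_comm]

theorem coeff_eulerDer (f : PowerSeries B) (d : ℕ) :
    PowerSeries.coeff d (eulerDer f) = (d : ℝ) • PowerSeries.coeff d f := by
  simp [eulerDer]

theorem isCoeffDerivation_eulerDer : IsCoeffDerivation (eulerDer (B := B)) where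
  leibniz f g := by
    ext d
    simp only [coeff_eulerDer, PowerSeries.coeff_mul, map_add, Finset.smul_sum,
      ← Finset.sum_add_distrib]
    refine Finset.sum_congr rfl fun p hp => ?_
    rw [← Finset.HasAntidiagonal.mem_antidiagonal.1 hp, smul_mul_assoc, mul_smul_comm, ← add_smul,
      Nat.cast_add]
  eqBelow K f hf d hd := by rw [coeff_eulerDer, hf d hd]; simp

/-- The derivative `dexpₐ b = ∑ adₐᵏ b / (k + 1)!` of the exponential map. -/
def dexp (a b : PowerSeries B) : PowerSeries B :=
  PowerSeries.mk fun d => PowerSeries.coeff d (dexpSum (d + 1) a b)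

theorem dexp_eqBelow {a : PowerSeries B} (ha : EqBelow 1 a 0) (b : PowerSeries B) (K : ℕ) :
    EqBelow K (dexp a b) (dexpSum K a b) := by
  intro d hd
  rw [dexp, PowerSeries.coeff_mk]
  exact EqBelow.dexpSum_of_le ha (by omega : d + 1 ≤ K) d (by omega)

theorem eulerDer_powExp {a : PowerSeries B} (ha : EqBelow 1 a 0) :
    eulerDer (powExp a) = dexp a (eulerDer a) * powExp a :=
  EqBelow.eq fun K => (isCoeffDerivation_eulerDer.map_powExp ha K).trans
    ((dexp_eqBelow ha _ K).symm.mul (EqBelow.refl _))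

theorem powExp_zero : powExp (0 : PowerSeries B) = 1 := by
  have h : EqBelow 1 (0 : PowerSeries B) 0 := EqBelow.refl _
  -- Scaling `T` by `0` fixes the exponent `0` and kills all positive orders of its exponential.
  have := coeffScale_powExp 0 (AlgHom.id ℝ B) 0
  ext d
  rw [map_zero] at this
  rw [← this, coeff_coeffScale, PowerSeries.coeff_one]
  split_ifs with hd
  · rw [hd, coeff_zero_powExp]; simp
  · simp [hd]

theorem neg_powExp_mul {a : PowerSeries B} (ha : EqBelow 1 a 0) :
    powExp (-a) * powExp a = 1 := by
  have := powExp_mul_neg (a := -a) (by simpa using ha.neg)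
  rwa [neg_neg] at this

end CoeffMaps

/-! ### The Baker–Campbell–Hausdorff theorem -/

section BCH

variable {B : Type*} [Ring B] [Algebra ℝ B]

/-- Power series without constant term with coefficients in `M`. -/
def IsSeriesIn (M : Submodule ℝ B) (a : PowerSeries B) : Prop := ∀ d, PowerSeries.coeff d a ∈ M

variable {M : Submodule ℝ B} (hM : ∀ x ∈ M, ∀ y ∈ M, x * y - y * x ∈ M)

omit [Algebra ℝ B] in
theorem coeff_commutator (a b : PowerSeries B) (d : ℕ) : PowerSeries.coeff d (a * b - b * a) =
    ∑ p ∈ Finset.HasAntidiagonal.antidiagonal d,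
      (PowerSeries.coeff p.1 a * PowerSeries.coeff p.2 b -
        PowerSeries.coeff p.2 b * PowerSeries.coeff p.1 a) := by
  rw [map_sub, PowerSeries.coeff_mul, PowerSeries.coeff_mul, Finset.sum_sub_distrib]
  congr 1
  exact (Finset.Nat.sum_antidiagonal_swap (n := d)
    (f := fun p : ℕ × ℕ => PowerSeries.coeff p.1 b * PowerSeries.coeff p.2 a)).symm

include hM in
theorem IsSeriesIn.commutator {a b : PowerSeries B} (ha : IsSeriesIn M a) (hb : IsSeriesIn M b) :
    IsSeriesIn M (a * b - b * a) := by
  intro d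
  rw [coeff_commutator]
  exact Submodule.sum_mem _ fun p _ => hM _ (ha _) _ (hb _)

include hM in
theorem IsSeriesIn.dexp {a b : PowerSeries B} (ha : IsSeriesIn M a) (hb : IsSeriesIn M b) :
    IsSeriesIn M (dexp a b) := by
  have h : ∀ k, IsSeriesIn M (adIter a b k) := by
    intro k
    induction k with
    | zero => exact hb
    | succ k ih => exact ha.commutator hM ih
  intro d
  rw [CFET.dexp, PowerSeries.coeff_mk, dexpSum, map_sum]
  refine Submodule.sum_mem _ fun k _ => ?_
  rw [LinearMap.map_smul_of_tower]
  exact Submodule.smul_mem _ _ (h k d)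

theorem IsSeriesIn.eulerDer {a : PowerSeries B} (ha : IsSeriesIn M a) :
    IsSeriesIn M (eulerDer a) := by
  intro d
  rw [coeff_eulerDer]
  exact Submodule.smul_mem _ _ (ha d)

include hM in
-- For a constant `β`, the series `c = g β g⁻¹` satisfies `T dc/dT = [a, c]`. As `a` has no constant
-- term, `d` times the coefficient of order `d` is a sum of commutators with lower coefficients, so
-- it lies in `M`. A general `b` is treated by peeling off its constant term, the variable being
-- central.
theorem IsSeriesIn.conj {g g' a : PowerSeries B} (h : g * g' = 1) (h' : g' * g = 1)
    (hg₀ : PowerSeries.coeff 0 g = 1)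
    (hg : CFET.eulerDer g = a * g) (ha : IsSeriesIn M a) (ha₀ : EqBelow 1 a 0) (d : ℕ) :
    ∀ b : PowerSeries B, IsSeriesIn M b → PowerSeries.coeff d (g * b * g') ∈ M := by
  have hD := isCoeffDerivation_eulerDer (B := B)
  have hg' : CFET.eulerDer g' = -(g' * a) := by
    have h₁ := hD.leibniz g g'
    rw [h, hD.map_one, hg, mul_assoc, h, mul_one] at h₁
    have h₂ : g' * (a + g * CFET.eulerDer g') = 0 := by rw [← h₁, mul_zero]
    rw [mul_add, ← mul_assoc, h', one_mul] at h₂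
    exact eq_neg_of_add_eq_zero_right h₂
  have hg₀' : PowerSeries.coeff 0 g' = 1 := by
    have := congrArg (PowerSeries.coeff 0) h
    simpa [PowerSeries.coeff_mul, -PowerSeries.coeff_zero_eq_constantCoeff, hg₀] using this
  have hconst : ∀ β ∈ M, IsSeriesIn M (g * PowerSeries.C β * g') := by
    intro β hβ
    set c := g * PowerSeries.C β * g' with hc
    have hCβ : CFET.eulerDer (PowerSeries.C β) = 0 := by
      ext d
      rw [coeff_eulerDer, PowerSeries.coeff_C]
      split_ifs with hd <;> simp [hd]
    have hE : CFET.eulerDer c = a * c - c * a := by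
      rw [hc, hD.leibniz, hD.leibniz, hCβ, hg, hg', mul_zero, add_zero]
      noncomm_ring
    intro d
    induction d using Nat.strong_induction_on with
    | _ d ih =>
      rcases Nat.eq_zero_or_pos d with rfl | hd
      · simpa [hc, PowerSeries.coeff_mul, -PowerSeries.coeff_zero_eq_constantCoeff, hg₀, hg₀',
          PowerSeries.coeff_zero_C] using hβ
      · have h₁ := congrArg (PowerSeries.coeff d) hE
        rw [coeff_eulerDer, coeff_commutator] at h₁
        have h₂ : (d : ℝ) • PowerSeries.coeff d c ∈ M := by
          rw [h₁]
          refine Submodule.sum_mem _ fun p hp => ?_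
          have hp := Finset.HasAntidiagonal.mem_antidiagonal.1 hp
          by_cases h0 : p.1 = 0
          · rw [h0, ha₀ 0 one_pos]; simp
          · exact hM _ (ha _) _ (ih _ (by omega))
        have h₃ : (d : ℝ) ≠ 0 := by positivity
        exact (Submodule.smul_mem_iff _ h₃).1 h₂
  induction d with
  | zero =>
    intro b hb
    have := hconst _ (hb 0) 0
    simpa [PowerSeries.coeff_mul, -PowerSeries.coeff_zero_eq_constantCoeff, hg₀, hg₀',
          PowerSeries.coeff_zero_C] using this
  | succ d ih =>
    intro b hb
    have hdec : b = PowerSeries.C (PowerSeries.coeff 0 b) +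
        (PowerSeries.mk fun p => PowerSeries.coeff (p + 1) b) * PowerSeries.X := by
        rw [add_comm, PowerSeries.coeff_zero_eq_constantCoeff_apply]
        exact PowerSeries.eq_shift_mul_X_add_const b
    rw [hdec, mul_add, add_mul, map_add]
    refine Submodule.add_mem _ (hconst _ (hb 0) _) ?_
    rw [← mul_assoc, mul_assoc, ← (PowerSeries.commute_X g').eq, ← mul_assoc,
      PowerSeries.coeff_succ_mul_X]
    exact ih _ fun p => by rw [PowerSeries.coeff_mk]; exact hb _

omit [Algebra ℝ B] in
theorem eqBelow_one_iff {a : PowerSeries B} : EqBelow 1 a 0 ↔ PowerSeries.coeff 0 a = 0 := by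
  constructor
  · intro h; simpa using h 0 one_pos
  · intro h d hd
    obtain rfl : d = 0 := by omega
    simpa using h

theorem dexp_eulerDer_zero {a : PowerSeries B} (ha : EqBelow 1 a 0) :
    EqBelow 1 (CFET.dexp a (eulerDer a)) 0 := by
  refine (dexp_eqBelow ha _ 1).trans ?_
  have : dexpSum 1 a (eulerDer a) = eulerDer a := by simp [dexpSum, adIter]
  rw [this]
  exact isCoeffDerivation_eulerDer.eqBelow 1 a ha

include hM in
/-- The product of two exponentials of Lie series is an exponential of a Lie series. -/
theorem exists_powExp_eq_mul {x y : PowerSeries B} (hx : IsSeriesIn M x) (hx₀ : EqBelow 1 x 0)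
    (hy : IsSeriesIn M y) (hy₀ : EqBelow 1 y 0) :
    ∃ w, IsSeriesIn M w ∧ EqBelow 1 w 0 ∧ powExp w = powExp x * powExp y := by
  set g := powExp x * powExp y with hg
  -- The logarithmic derivative `(T dg/dT) g⁻¹`, which is a Lie series because conjugation by `exp
  -- x` preserves Lie series.
  let a := CFET.dexp x (eulerDer x) +
    powExp x * CFET.dexp y (eulerDer y) * powExp (-x)
  have ha : IsSeriesIn M a := by
    intro d
    rw [map_add]
    exact Submodule.add_mem _ (hx.dexp hM hx.eulerDer d)
      (IsSeriesIn.conj hM (powExp_mul_neg hx₀) (neg_powExp_mul hx₀) (coeff_zero_powExp x)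
        (eulerDer_powExp hx₀) (hx.dexp hM hx.eulerDer) (dexp_eulerDer_zero hx₀) d _
        (hy.dexp hM hy.eulerDer))
  have ha₀ : EqBelow 1 a 0 := by
    have := (dexp_eulerDer_zero hx₀).add
      (((dexp_eulerDer_zero hy₀).mul_zero_right (powExp x)).mul_zero_left (powExp (-x)))
    simpa using this
  have hEg : eulerDer g = a * g := by
    rw [hg, isCoeffDerivation_eulerDer.leibniz, eulerDer_powExp hx₀, eulerDer_powExp hy₀, add_mul]
    congr 1
    · rw [mul_assoc]
    · rw [mul_assoc, mul_assoc, ← mul_assoc (powExp (-x)), neg_powExp_mul hx₀, one_mul]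
  have hg₀ : PowerSeries.coeff 0 g = 1 := by
    simp [hg, PowerSeries.coeff_mul, -PowerSeries.coeff_zero_eq_constantCoeff, coeff_zero_powExp]
  have approx : ∀ K, ∃ w, IsSeriesIn M w ∧ EqBelow 1 w 0 ∧ EqBelow K (powExp w) g := by
    intro K
    induction K with
    | zero => exact ⟨0, fun d => by simp, EqBelow.refl _, fun d hd => by omega⟩
    | succ K ih =>
      obtain ⟨w, hw, hw₀, hwg⟩ := ih
      rcases Nat.eq_zero_or_pos K with rfl | hK
      · refine ⟨w, hw, hw₀, fun d hd => ?_⟩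
        obtain rfl : d = 0 := by omega
        rw [coeff_zero_powExp, hg₀]
      · set b := CFET.dexp w (eulerDer w) with hb
        have hEw := eulerDer_powExp hw₀
        rw [← hb] at hEw
        have hab : EqBelow K a b := by
          have h₁ : EqBelow K (a * powExp w) (b * powExp w) := by
            rw [← hEw]
            refine ((EqBelow.refl a).mul hwg).trans ?_
            rw [← hEg]
            exact isCoeffDerivation_eulerDer.eqBelow' hwg.symm
          have h₂ := h₁.mul (EqBelow.refl (powExp (-w)))
          rwa [mul_assoc, powExp_mul_neg hw₀, mul_one, mul_assoc, powExp_mul_neg hw₀,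
            mul_one] at h₂
        -- If `exp w` agrees with `g` below order `K`, then `b` agrees with `a` there and everything
        -- cancels but the top terms. So the error `e` of `exp w` in order `K` is a Lie element, and
        -- adding `e T^K` to `w` corrects it.
        have hcoeff : (K : ℝ) • (PowerSeries.coeff K g - PowerSeries.coeff K (powExp w)) =
            PowerSeries.coeff K a - PowerSeries.coeff K b := by
          rw [smul_sub, ← coeff_eulerDer, ← coeff_eulerDer, hEg, hEw, PowerSeries.coeff_mul,
            PowerSeries.coeff_mul, ← Finset.sum_sub_distrib,
            Finset.sum_eq_single_of_mem (K, 0)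
              (Finset.HasAntidiagonal.mem_antidiagonal.2 (by simp))]
          · rw [hg₀, coeff_zero_powExp, mul_one, mul_one]
          · rintro ⟨i, j⟩ hp hne
            have hp := Finset.HasAntidiagonal.mem_antidiagonal.1 hp
            simp only at hp ⊢
            have hi : i < K := by
              rcases Nat.lt_or_ge i K with h | h
              · exact h
              · exact absurd (by simp only [Prod.mk.injEq]; omega) hne
            rw [hab i hi]
            by_cases hi0 : i = 0
            · have := dexp_eulerDer_zero hw₀ 0 one_pos
              rw [← hb] at this
              rw [hi0, this]; simp
            · rw [hwg j (by omega), sub_self]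
        set e := PowerSeries.coeff K g - PowerSeries.coeff K (powExp w) with he
        have heM : e ∈ M := by
          have h₃ : (K : ℝ) ≠ 0 := by positivity
          rw [← Submodule.smul_mem_iff _ h₃, hcoeff]
          exact Submodule.sub_mem _ (ha K) (hw.dexp hM hw.eulerDer K)
        have hmon : ∀ d, PowerSeries.coeff d (w + PowerSeries.monomial K e) =
            PowerSeries.coeff d w + if d = K then e else 0 := fun d => by
          rw [map_add, PowerSeries.coeff_monomial]
        have hlow : EqBelow K (w + PowerSeries.monomial K e) w := fun d hd => by
          rw [hmon, if_neg hd.ne, add_zero]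
        have hw₀' : EqBelow 1 (w + PowerSeries.monomial K e) 0 := (hlow.mono hK).trans hw₀
        refine ⟨w + PowerSeries.monomial K e, fun d => ?_, hw₀', fun d hd => ?_⟩
        · rw [hmon]
          refine Submodule.add_mem _ (hw d) ?_
          split_ifs
          · exact heM
          · exact Submodule.zero_mem _
        · rcases Nat.lt_succ_iff_lt_or_eq.1 hd with hd | rfl
          · rw [hlow.powExp d hd, hwg d hd]
          · have := coeff_powExp_sub hw₀' hw₀ hlow
            rw [hmon, if_pos rfl, add_sub_cancel_left, he] at this
            exact sub_left_injective this
  choose w hw hw₀ hwg using approx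
  have hww : ∀ K L, K ≤ L → EqBelow K (w K) (w L) := fun K L h =>
    eqBelow_of_powExp (hw₀ K) (hw₀ L) ((hwg K).trans ((hwg L).mono h).symm)
  -- By injectivity of the exponential the approximations are compatible; order `d` is final from
  -- stage `d + 1` on.
  let W : PowerSeries B := PowerSeries.mk fun d => PowerSeries.coeff d (w (d + 1))
  have hW : ∀ K, EqBelow K W (w K) := fun K d hd => by
    simp only [W, PowerSeries.coeff_mk]
    exact hww (d + 1) K hd d (by omega)
  exact ⟨W, fun d => by simp only [W, PowerSeries.coeff_mk]; exact hw _ d,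
    (hW 1).trans (hw₀ 1), EqBelow.eq fun K => (hW K).powExp.trans (hwg K)⟩

include hM in
theorem exists_powExp_eq_prod (l : List (PowerSeries B))
    (hl : ∀ x ∈ l, IsSeriesIn M x ∧ EqBelow 1 x 0) :
    ∃ w, IsSeriesIn M w ∧ EqBelow 1 w 0 ∧ powExp w = (l.map powExp).prod := by
  induction l with
  | nil => exact ⟨0, fun d => by simp, EqBelow.refl _, by simp [powExp_zero]⟩
  | cons x l ih =>
    obtain ⟨w, hw, hw₀, h⟩ := ih fun y hy => hl y (List.mem_cons_of_mem _ hy)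
    obtain ⟨hx, hx₀⟩ := hl x List.mem_cons_self
    obtain ⟨v, hv, hv₀, h'⟩ := exists_powExp_eq_mul hM hx hx₀ hw hw₀
    exact ⟨v, hv, hv₀, by rw [h', h, List.map_cons, List.prod_cons]⟩

end BCH

/-! ### The Magnus recursion -/

section MagnusRecursion

variable {L : Type*} [AddCommGroup L] [Bracket L L] [Module ℝ L]

omit [Module ℝ L] in
theorem nestedSum_congr {W W' D D' : ℕ → L} {n : ℕ} (hW : ∀ j < n, W j = W' j) :
    ∀ {m : ℕ} (_ : ∀ k < n, D k = D' k), ∀ k < n, nestedSum W D m k = nestedSum W' D' m k := by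
  intro m hD
  induction m with
  | zero => exact fun k hk => hD k hk
  | succ m ih =>
    intro k hk
    refine Finset.sum_congr rfl fun j hj => ?_
    rw [Finset.mem_Ico] at hj
    rw [hW j (by omega), ih (k - j) (by omega)]

omit [Module ℝ L] in
theorem nestedSum_succ_congr {W W' D D' : ℕ → L} {n : ℕ} (hW : ∀ j < n, W j = W' j)
    (hD : ∀ k < n, D k = D' k) (m : ℕ) : nestedSum W D (m + 1) n = nestedSum W' D' (m + 1) n := by
  refine Finset.sum_congr rfl fun j hj => ?_
  rw [Finset.mem_Ico] at hj
  rw [hW j (by omega), nestedSum_congr hW hD (n - j) (by omega)]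

theorem magnusDot_eq (I : L → L) (a : L) {n : ℕ} (hn : 2 ≤ n) : magnusDot I a n =
    - ∑ m ∈ Finset.Icc 1 (n - 1), (((m + 1).factorial : ℝ)⁻¹) •
      nestedSum (fun j => magnusTerm I a j) (fun k => magnusDot I a k) m n := by
  obtain ⟨n, rfl⟩ : ∃ k, n = k + 2 := ⟨n - 2, by omega⟩
  rw [magnusDot]
  congr 1
  refine Finset.sum_congr rfl fun m hm => ?_
  rw [Finset.mem_Icc] at hm
  obtain ⟨m, rfl⟩ : ∃ k, m = k + 1 := ⟨m - 1, by omega⟩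
  congr 1
  refine nestedSum_succ_congr (fun j hj => ?_) (fun k hk => ?_) m
  · rw [dif_pos hj, magnusTerm]
  · rw [dif_pos hk]

omit [Module ℝ L] in
-- With `m + 1` brackets there are `m + 2` positive indices, whose sum exceeds `m + 1`.
theorem nestedSum_eq_zero (h : ∀ x : L, ⁅x, (0 : L)⁆ = 0) (W D : ℕ → L) : ∀ (m : ℕ) {n : ℕ},
    n ≤ m + 1 → nestedSum W D (m + 1) n = 0 := by
  intro m
  induction m with
  | zero =>
    intro n hn
    rw [nestedSum, Finset.Ico_eq_empty (by omega), Finset.sum_empty]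
  | succ m ih =>
    intro n hn
    rw [nestedSum]
    refine Finset.sum_eq_zero fun j hj => ?_
    rw [Finset.mem_Ico] at hj
    rw [ih (by omega), h]

variable {L' : Type*} [AddCommGroup L'] [Bracket L' L'] [Module ℝ L']

omit [Bracket L L] [Module ℝ L] [Bracket L' L'] [Module ℝ L'] in
theorem sum_rel {R : L → L' → Prop} (hzero : R 0 0)
    (hadd : ∀ x x' y y', R x x' → R y y' → R (x + y) (x' + y')) {s : Finset ℕ} {F : ℕ → L}
    {F' : ℕ → L'} (h : ∀ i ∈ s, R (F i) (F' i)) : R (∑ i ∈ s, F i) (∑ i ∈ s, F' i) := by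
  induction s using Finset.cons_induction with
  | empty => simpa using hzero
  | cons i s hi ih =>
    rw [Finset.sum_cons, Finset.sum_cons]
    exact hadd _ _ _ _ (h i (Finset.mem_cons_self i s))
      (ih fun j hj => h j (Finset.mem_cons_of_mem hj))

omit [Module ℝ L] [Module ℝ L'] in
-- With at least one bracket, a nest of total `n` involves only indices below `n`; this gives the
-- conclusion at `n` itself that the strong induction on the recursion needs.
theorem nestedSum_rel {R S : ℕ → L → L' → Prop} (hzero : ∀ n, R n 0 0)
    (hadd : ∀ n x x' y y', R n x x' → R n y y' → R n (x + y) (x' + y'))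
    (hlie : ∀ i j x x' y y', S i x x' → R j y y' → R (i + j) ⁅x, y⁆ ⁅x', y'⁆)
    {W D : ℕ → L} {W' D' : ℕ → L'} {n : ℕ} (hW : ∀ j < n, S j (W j) (W' j))
    (hD : ∀ j < n, R j (D j) (D' j)) (m : ℕ) :
    (∀ k < n, R k (nestedSum W D m k) (nestedSum W' D' m k)) ∧
      R n (nestedSum W D (m + 1) n) (nestedSum W' D' (m + 1) n) := by
  have step : ∀ m, (∀ k < n, R k (nestedSum W D m k) (nestedSum W' D' m k)) → ∀ k ≤ n,
      R k (nestedSum W D (m + 1) k) (nestedSum W' D' (m + 1) k) := by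
    intro m h k hk
    refine sum_rel (hzero k) (hadd k) fun j hj => ?_
    rw [Finset.mem_Ico] at hj
    have := hlie _ _ _ _ _ _ (hW j (by omega)) (h (k - j) (by omega))
    rwa [Nat.add_sub_cancel' hj.2.le] at this
  have h : ∀ k < n, R k (nestedSum W D m k) (nestedSum W' D' m k) := by
    induction m with
    | zero => exact hD
    | succ m ih => exact fun k hk => step m ih k hk.le
  exact ⟨h, step m h n le_rfl⟩

/-- Two Magnus recursions stay related under graded relations `R` between the terms `Ω̇ₙ` and `S`
between the terms `Ωₙ` that are compatible with all operations of the recursion. -/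
theorem magnusDot_rel_of_rel (R S : ℕ → L → L' → Prop) {I : L → L} {I' : L' → L'} {a : L} {a' : L'}
    (hzero : ∀ n, R n 0 0)
    (hadd : ∀ n x x' y y', R n x x' → R n y y' → R n (x + y) (x' + y'))
    (hsmul : ∀ n (r : ℝ) x x', R n x x' → R n (r • x) (r • x'))
    (hlie : ∀ i j x x' y y', S i x x' → R j y y' → R (i + j) ⁅x, y⁆ ⁅x', y'⁆)
    (hI : ∀ n x x', R n x x' → S n (I x) (I' x')) (ha : R 1 a a') (n : ℕ) :
    R n (magnusDot I a n) (magnusDot I' a' n) := by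
  induction n using Nat.strong_induction_on with
  | _ n ih =>
    rcases Nat.lt_or_ge n 2 with hn | hn
    · interval_cases n
      · rw [magnusDot, magnusDot]; exact hzero 0
      · rw [magnusDot, magnusDot]; exact ha
    · rw [magnusDot_eq I a hn, magnusDot_eq I' a' hn, ← neg_one_smul ℝ, ← neg_one_smul ℝ (∑ _ ∈ _, _)]
      refine hsmul _ _ _ _ (sum_rel (hzero n) (hadd n) fun m hm => hsmul _ _ _ _ ?_)
      rw [Finset.mem_Icc] at hm
      obtain ⟨m, rfl⟩ : ∃ k, m = k + 1 := ⟨m - 1, by omega⟩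
      exact (nestedSum_rel hzero hadd hlie (fun j hj => hI _ _ _ (ih j hj)) ih m).2

theorem magnusDot_rel (R : ℕ → L → L' → Prop) {I : L → L} {I' : L' → L'} {a : L} {a' : L'}
    (hzero : ∀ n, R n 0 0)
    (hadd : ∀ n x x' y y', R n x x' → R n y y' → R n (x + y) (x' + y'))
    (hsmul : ∀ n (r : ℝ) x x', R n x x' → R n (r • x) (r • x'))
    (hlie : ∀ i j x x' y y', R i x x' → R j y y' → R (i + j) ⁅x, y⁆ ⁅x', y'⁆)
    (hI : ∀ n x x', R n x x' → R n (I x) (I' x')) (ha : R 1 a a') (n : ℕ) :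
    R n (magnusDot I a n) (magnusDot I' a' n) :=
  magnusDot_rel_of_rel R R hzero hadd hsmul hlie hI ha n

end MagnusRecursion

/-! ### The Magnus exponential as a solution of the differential equation -/

section MagnusODE

variable {B : Type*} [Ring B] [Algebra ℝ B]

/-- The relation constrains its first argument only; the second recursion is a dummy. -/
theorem magnusDot_eqBelow {I : PowerSeries B → PowerSeries B} {a : PowerSeries B}
    (hI : ∀ n x, EqBelow n x 0 → EqBelow n (I x) 0) (ha : EqBelow 1 a 0) (n : ℕ) :
    EqBelow n (magnusDot I a n) 0 := by
  refine magnusDot_rel (fun n x (_ : PowerSeries B) => EqBelow n x 0) (I' := fun x => x) (a' := 0)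
    ?_ ?_ ?_ ?_ (fun n x _ h => hI n x h) ha n
  · exact fun n => EqBelow.refl _
  · intro n x _ y _ hx hy; simpa using hx.add hy
  · intro n r x _ hx; simpa using hx.smul r
  · intro i j x _ y _ hx hy
    rw [Ring.lie_def]
    have := (hx.mul_zero_add hy).sub ((hy.mul_zero_add hx).mono (add_comm i j).le)
    simpa using this

/-- The exponential of the Magnus expansion solves the linear differential equation. -/
theorem magnus_ode {I D : PowerSeries B →ₗ[ℝ] PowerSeries B} (hD : IsCoeffDerivation D)
    (hDI : ∀ x, D (I x) = x) (hI : ∀ n x, EqBelow n x 0 → EqBelow n (I x) 0) {a : PowerSeries B}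
    (ha : EqBelow 1 a 0) (N : ℕ) :
    EqBelow 1 (∑ n ∈ Finset.Icc 1 N, magnusTerm I a n) 0 ∧
    EqBelow (N + 1) (D (powExp (∑ n ∈ Finset.Icc 1 N, magnusTerm I a n)))
      (a * powExp (∑ n ∈ Finset.Icc 1 N, magnusTerm I a n)) := by
  set Ω := ∑ n ∈ Finset.Icc 1 N, magnusTerm I a n with hΩ
  have hlow := magnusDot_eqBelow (I := I) hI ha
  have hΩ₀ : EqBelow 1 Ω 0 := EqBelow.sum_zero fun n hn =>
    (hI _ _ (hlow n)).mono (Finset.mem_Icc.1 hn).1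
  refine ⟨hΩ₀, (hD.map_powExp hΩ₀ (N + 1)).trans (EqBelow.mul ?_ (EqBelow.refl _))⟩
  set W : ℕ → PowerSeries B := fun j => magnusTerm I a j
  set E : ℕ → PowerSeries B := fun j => magnusDot I a j
  have hDΩ : D Ω = ∑ n ∈ Finset.Icc 1 N, E n := by
    rw [hΩ, map_sum]
    exact Finset.sum_congr rfl fun n _ => hDI _
  have hnlow : ∀ m n, EqBelow n (nestedSum W E m n) 0 := by
    intro m n
    refine (nestedSum_rel (R := fun n x (_ : PowerSeries B) => EqBelow n x 0)
      (S := fun n x (_ : PowerSeries B) => EqBelow n x 0) (W' := 0) (D' := 0)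
      (n := n + 1) ?_ ?_ ?_ (fun j _ => hI _ _ (hlow j)) (fun j _ => hlow j) m).1 n (by omega)
    · exact fun n => EqBelow.refl _
    · intro n x _ y _ hx hy; simpa using hx.add hy
    · intro i j x _ y _ hx hy
      rw [Ring.lie_def]
      have := (hx.mul_zero_add hy).sub ((hy.mul_zero_add hx).mono (add_comm i j).le)
      simpa using this
  -- Expanding `Ω` into its terms gives all nests of depth `m`; those of total above `N` start
  -- beyond order `N` and are dropped.
  have hiter : ∀ m, EqBelow (N + 1) (adIter Ω (D Ω) m)
      (∑ n ∈ Finset.Icc 1 N, nestedSum W E m n) := by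
    intro m
    induction m with
    | zero => rw [adIter, hDΩ]; exact EqBelow.refl _
    | succ m ih =>
      rw [adIter]
      refine (((EqBelow.refl Ω).mul ih).sub (ih.mul (EqBelow.refl Ω))).trans ?_
      have h₁ : Ω * (∑ n ∈ Finset.Icc 1 N, nestedSum W E m n) -
          (∑ n ∈ Finset.Icc 1 N, nestedSum W E m n) * Ω =
          ∑ j ∈ Finset.Icc 1 N, ∑ k ∈ Finset.Icc 1 N, ⁅W j, nestedSum W E m k⁆ := by
        rw [hΩ, Finset.sum_mul_sum, Finset.sum_mul_sum, Finset.sum_comm (s := Finset.Icc 1 N)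
          (f := fun i j => nestedSum W E m i * _), ← Finset.sum_sub_distrib]
        refine Finset.sum_congr rfl fun j _ => ?_
        rw [← Finset.sum_sub_distrib]
        rfl
      have h₂ : ∑ n ∈ Finset.Icc 1 N, nestedSum W E (m + 1) n =
          ∑ j ∈ Finset.Icc 1 N, ∑ k ∈ Finset.Icc 1 N,
            if j + k ≤ N then ⁅W j, nestedSum W E m k⁆ else 0 := by
        simp only [nestedSum]
        rw [Finset.sum_sigma', Finset.sum_sigma', ← Finset.sum_filter]
        refine Finset.sum_bij' (fun x _ => ⟨x.2, x.1 - x.2⟩) (fun x _ => ⟨x.1 + x.2, x.1⟩)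
          ?_ ?_ ?_ ?_ ?_
        · rintro ⟨n, k⟩ h
          simp only [Finset.mem_sigma, Finset.mem_Icc, Finset.mem_Ico, Finset.mem_filter] at h ⊢
          omega
        · rintro ⟨n, k⟩ h
          simp only [Finset.mem_sigma, Finset.mem_Icc, Finset.mem_Ico, Finset.mem_filter] at h ⊢
          omega
        · rintro ⟨n, k⟩ h
          simp only [Finset.mem_sigma, Finset.mem_Icc, Finset.mem_Ico] at h ⊢
          simp only [Sigma.mk.injEq, heq_eq_eq, and_true]
          omega
        · rintro ⟨n, k⟩ h
          simp
        · rintro ⟨n, k⟩ h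
          rfl
      rw [h₁, h₂]
      refine EqBelow.sum fun j hj => EqBelow.sum fun k hk => ?_
      split_ifs with h
      · exact EqBelow.refl _
      · rw [Ring.lie_def]
        have h₃ : EqBelow j (W j) 0 := hI _ _ (hlow j)
        have h₄ := hnlow m k
        have := ((h₃.mul_zero_add h₄).mono (by omega : N + 1 ≤ j + k)).sub
          ((h₄.mul_zero_add h₃).mono (by omega : N + 1 ≤ k + j))
        simpa using this
  have h₁ : EqBelow (N + 1) (dexpSum (N + 1) Ω (D Ω)) (∑ m ∈ Finset.range (N + 1),
      (((m + 1).factorial : ℝ)⁻¹) • ∑ n ∈ Finset.Icc 1 N, nestedSum W E m n) :=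
    EqBelow.sum fun m _ => (hiter m).smul _
  refine h₁.trans ?_
  -- The Magnus recursion is this identity: for fixed `n`, the term `m = 0` is `Ω̇ₙ` and cancels the
  -- others, except that `a` remains for `n = 1`.
  have h₂ : ∑ m ∈ Finset.range (N + 1),
      (((m + 1).factorial : ℝ)⁻¹) • ∑ n ∈ Finset.Icc 1 N, nestedSum W E m n =
      ∑ n ∈ Finset.Icc 1 N, if n = 1 then a else 0 := by
    simp only [Finset.smul_sum]
    rw [Finset.sum_comm]
    refine Finset.sum_congr rfl fun n hn => ?_
    rw [Finset.mem_Icc] at hn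
    have hz : ∀ m, n ≤ m → 1 ≤ m → nestedSum W E m n = 0 := by
      intro m hm hm'
      obtain ⟨m, rfl⟩ : ∃ k, m = k + 1 := ⟨m - 1, by omega⟩
      exact nestedSum_eq_zero (by simp [Ring.lie_def]) W E m hm
    have hE : E n = (if n = 1 then a else 0) -
        ∑ m ∈ Finset.Icc 1 (n - 1), (((m + 1).factorial : ℝ)⁻¹) • nestedSum W E m n := by
      split_ifs with h1
      · subst h1
        simp [E, magnusDot]
      · rw [zero_sub]
        exact magnusDot_eq I a (by omega)
    rw [Finset.range_eq_Ico, Finset.sum_eq_sum_Ico_succ_bot (by omega), nestedSum, hE,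
      ← Finset.sum_subset (s₁ := Finset.Icc 1 (n - 1)) (s₂ := Finset.Ico (0 + 1) (N + 1))]
    · simp
    · intro m hm
      rw [Finset.mem_Icc] at hm
      rw [Finset.mem_Ico]
      omega
    · intro m hm hm'
      rw [Finset.mem_Icc] at hm'
      rw [Finset.mem_Ico] at hm
      rw [hz m (by omega) (by omega), smul_zero]
  rw [h₂]
  rcases Nat.eq_zero_or_pos N with rfl | hN
  · simpa using ha.symm
  · rw [Finset.sum_ite_eq' , if_pos (Finset.mem_Icc.2 ⟨le_rfl, hN⟩)]
    exact EqBelow.refl _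

end MagnusODE

section LieRange

attribute [local instance 100] LieRing.ofAssociativeRing

/-! ### Grading of the free Lie algebra by order -/

section Grading

/-- The image of the free Lie algebra in the free associative algebra. -/
def lieRange : Submodule ℝ FreeAssoc := LinearMap.range (toAssoc : FreeLie →ₗ[ℝ] FreeAssoc)

theorem toAssoc_mem_lieRange (x : FreeLie) : toAssoc x ∈ lieRange := ⟨x, rfl⟩

theorem lieRange_commutator : ∀ x ∈ lieRange, ∀ y ∈ lieRange, x * y - y * x ∈ lieRange := by
  rintro _ ⟨x, rfl⟩ _ ⟨y, rfl⟩
  exact ⟨⁅x, y⁆, toAssoc_lie x y⟩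

/-- The homomorphism of the free Lie algebra to power series with `Aₙ ↦ Aₙ Tⁿ`. -/
def gradedAssoc : FreeLie →ₗ⁅ℝ⁆ PowerSeries FreeAssoc :=
  FreeLieAlgebra.lift ℝ fun n => PowerSeries.monomial (n : ℕ) (FreeAlgebra.ι ℝ n)

theorem gradedAssoc_lie (x y : FreeLie) : gradedAssoc ⁅x, y⁆ =
    gradedAssoc x * gradedAssoc y - gradedAssoc y * gradedAssoc x := by
  rw [LieHom.map_lie]; rfl

theorem gradedAssoc_of (n : ℕ+) : gradedAssoc (FreeLieAlgebra.of ℝ n) =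
    PowerSeries.monomial (n : ℕ) (FreeAlgebra.ι ℝ n) := FreeLieAlgebra.lift_of_apply _ _

theorem monomial_mul_monomial {B : Type*} [Ring B] (m n : ℕ) (x y : B) :
    PowerSeries.monomial m x * PowerSeries.monomial n y = PowerSeries.monomial (m + n) (x * y) := by
  ext d
  rw [PowerSeries.coeff_mul, PowerSeries.coeff_monomial]
  split_ifs with h
  · rw [Finset.sum_eq_single_of_mem (m, n) (Finset.HasAntidiagonal.mem_antidiagonal.2 h.symm)]
    · simp
    · rintro ⟨i, j⟩ hp hne
      have hp := Finset.HasAntidiagonal.mem_antidiagonal.1 hp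
      simp only [PowerSeries.coeff_monomial]
      split_ifs with h₁ h₂
      · exact absurd (by rw [h₁, h₂]) hne
      all_goals simp
  · refine Finset.sum_eq_zero ?_
    rintro ⟨i, j⟩ hp
    have hp := Finset.HasAntidiagonal.mem_antidiagonal.1 hp
    simp only [PowerSeries.coeff_monomial]
    split_ifs with h₁ h₂
    · exact absurd (by rw [← hp, h₁, h₂]) h
    all_goals simp

theorem gradedAssoc_word (w : LieWord) :
    gradedAssoc w.toLie = PowerSeries.monomial w.order (toAssoc w.toLie) := by
  induction w with
  | gen n => rw [LieWord.toLie, gradedAssoc_of, toAssoc_of]; rfl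
  | br x y hx hy =>
    rw [LieWord.toLie, gradedAssoc_lie, hx, hy, monomial_mul_monomial, monomial_mul_monomial,
      toAssoc_lie, map_sub, LieWord.order, add_comm y.order]

theorem hall_sum (x : FreeLie) :
    ∑ h ∈ (hallBasis.repr x).support, hallBasis.repr x h • h.1.toLie = x := by
  conv_rhs => rw [← hallBasis.linearCombination_repr x, Finsupp.linearCombination_apply,
    Finsupp.sum]
  exact Finset.sum_congr rfl fun h _ => by rw [hallBasis_apply]

theorem coeff_gradedAssoc (x : FreeLie) (d : ℕ) : PowerSeries.coeff d (gradedAssoc x) =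
    ∑ h ∈ (hallBasis.repr x).support with h.1.order = d,
      hallBasis.repr x h • toAssoc h.1.toLie := by
  conv_lhs => rw [← hall_sum x]
  rw [map_sum, map_sum, Finset.sum_filter]
  refine Finset.sum_congr rfl fun h _ => ?_
  rw [map_smul, LinearMap.map_smul_of_tower, gradedAssoc_word, PowerSeries.coeff_monomial]
  by_cases hd : h.1.order = d
  · rw [if_pos hd, if_pos hd.symm]
  · rw [if_neg hd, if_neg (Ne.symm hd), smul_zero]

/-- The Hall elements of order `d` stay independent in the associative algebra, so one coefficient
in `T` determines all Hall coordinates of that order. -/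
theorem repr_eq_zero_of_coeff {x : FreeLie} {d : ℕ} (hx : PowerSeries.coeff d (gradedAssoc x) = 0)
    {h : HallElement} (hd : h.1.order = d) : hallBasis.repr x h = 0 := by
  rw [coeff_gradedAssoc] at hx
  by_contra hne
  exact hne (linearIndependent_iff'.1 linearIndependent_toAssoc_hall _ _ hx h (by simp [hne, hd]))

theorem repr_eq_of_coeff {x y : FreeLie} {d : ℕ}
    (hxy : PowerSeries.coeff d (gradedAssoc x) = PowerSeries.coeff d (gradedAssoc y))
    {h : HallElement} (hd : h.1.order = d) : hallBasis.repr x h = hallBasis.repr y h := by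
  have : hallBasis.repr (x - y) h = 0 :=
    repr_eq_zero_of_coeff (by rw [map_sub, map_sub, hxy, sub_self]) hd
  rw [map_sub, Finsupp.sub_apply] at this
  exact sub_eq_zero.1 this

theorem gradedAssoc_eqBelow_one (x : FreeLie) : EqBelow 1 (gradedAssoc x) 0 := by
  rw [eqBelow_one_iff, coeff_gradedAssoc]
  refine Finset.sum_eq_zero fun h hh => ?_
  have := h.1.one_le_order
  have := (Finset.mem_filter.1 hh).2
  omega

/-- The endomorphism `Aₙ ↦ c n Aₙ` of the free associative algebra. -/
def assocScale (c : ℕ+ → ℝ) : FreeAssoc →ₐ[ℝ] FreeAssoc :=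
  FreeAlgebra.lift ℝ fun n => c n • FreeAlgebra.ι ℝ n

/-- The endomorphism `Aₙ ↦ c n Aₙ` of the free Lie algebra. -/
def lieScale (c : ℕ+ → ℝ) : FreeLie →ₗ⁅ℝ⁆ FreeLie :=
  FreeLieAlgebra.lift ℝ fun n => c n • FreeLieAlgebra.of ℝ n

theorem assocScale_ι (c : ℕ+ → ℝ) (n : ℕ+) :
    assocScale c (FreeAlgebra.ι ℝ n) = c n • FreeAlgebra.ι ℝ n := by simp [assocScale]

theorem lieScale_of (c : ℕ+ → ℝ) (n : ℕ+) :
    lieScale c (FreeLieAlgebra.of ℝ n) = c n • FreeLieAlgebra.of ℝ n :=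
  FreeLieAlgebra.lift_of_apply _ _

theorem assocScale_toAssoc (c : ℕ+ → ℝ) (x : FreeLie) :
    assocScale c (toAssoc x) = toAssoc (lieScale c x) := by
  have : ((assocScale c : FreeAssoc →ₗ⁅ℝ⁆ FreeAssoc)).comp toAssoc = toAssoc.comp (lieScale c) := by
    ext n
    simp [toAssoc_of, assocScale_ι, lieScale_of]
  exact congrArg (fun f : FreeLie →ₗ⁅ℝ⁆ FreeAssoc => f x) this

theorem coeffScale_gradedAssoc (c : ℕ+ → ℝ) (x : FreeLie) :
    coeffScale 1 (assocScale c) (gradedAssoc x) = gradedAssoc (lieScale c x) := by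
  have : ((coeffScale 1 (assocScale c) : PowerSeries FreeAssoc →ₐ[ℝ] PowerSeries FreeAssoc) :
      PowerSeries FreeAssoc →ₗ⁅ℝ⁆ PowerSeries FreeAssoc).comp gradedAssoc =
      gradedAssoc.comp (lieScale c) := by
    ext n : 1
    simp only [LieHom.comp_apply, gradedAssoc_of, lieScale_of, map_smul]
    rw [AlgHom.coe_toLieHom, coeffScale_monomial, assocScale_ι, one_pow, one_smul]
    exact LinearMap.map_smul_of_tower _ _ _
  exact congrArg (fun f : FreeLie →ₗ⁅ℝ⁆ PowerSeries FreeAssoc => f x) this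

theorem lieScale_word (c : ℕ+ → ℝ) (hc : ∀ n, c n = 2 ^ (n : ℕ)) (w : LieWord) :
    lieScale c w.toLie = (2 : ℝ) ^ w.order • w.toLie := by
  induction w with
  | gen n => rw [LieWord.toLie, lieScale_of, hc]; rfl
  | br x y hx hy =>
    rw [LieWord.toLie, LieHom.map_lie, hx, hy, smul_lie, lie_smul, smul_smul, LieWord.order, pow_add]

theorem lieScale_word_of_contains (c : ℕ+ → ℝ) {n : ℕ+} (hc : c n = 0) {w : LieWord}
    (hw : w.Contains n) : lieScale c w.toLie = 0 := by
  induction w with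
  | gen k =>
    obtain rfl : n = k := hw
    rw [LieWord.toLie, lieScale_of, hc, zero_smul]
  | br x y hx hy =>
    rw [LieWord.toLie, LieHom.map_lie]
    rcases hw with h | h
    · rw [hx h, zero_lie]
    · rw [hy h, lie_zero]

theorem lieScale_word_of_not (c : ℕ+ → ℝ) {w : LieWord} (hw : ∀ n, w.Contains n → c n = 1) :
    lieScale c w.toLie = w.toLie := by
  induction w with
  | gen k => rw [LieWord.toLie, lieScale_of, hw k rfl, one_smul]
  | br x y hx hy =>
    rw [LieWord.toLie, LieHom.map_lie, hx fun n h => hw n (Or.inl h),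
      hy fun n h => hw n (Or.inr h)]

/-- A scaling by zeros and ones maps each Hall element to itself or to `0`, according to whether all
its generators are kept. -/
theorem repr_lieScale_of_contains (c : ℕ+ → ℝ) (hc : ∀ n, c n = 0 ∨ c n = 1) (x : FreeLie)
    {h : HallElement} {n : ℕ+} (hn : c n = 0) (hh : h.1.Contains n) :
    hallBasis.repr (lieScale c x) h = 0 := by
  rw [← hall_sum x, map_sum, map_sum, Finsupp.finsetSum_apply]
  refine Finset.sum_eq_zero fun g _ => ?_
  rw [map_smul, map_smul, Finsupp.smul_apply]
  by_cases hg : ∀ k, g.1.Contains k → c k = 1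
  · rw [lieScale_word_of_not c hg, ← hallBasis_apply, Module.Basis.repr_self,
      Finsupp.single_eq_of_ne, smul_zero]
    rintro rfl
    exact zero_ne_one (hn.symm.trans (hg n hh))
  · push Not at hg
    obtain ⟨k, hk, hk'⟩ := hg
    rw [lieScale_word_of_contains c ((hc k).resolve_right hk') hk]
    simp

/-- Hall elements are eigenvectors of this scaling, and distinct orders have distinct eigenvalues;
the scaling thereby detects the order. -/
theorem repr_lieScale_two (x : FreeLie) (h : HallElement) :
    hallBasis.repr (lieScale (fun n => 2 ^ (n : ℕ)) x) h =
      (2 : ℝ) ^ h.1.order * hallBasis.repr x h := by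
  have : hallBasis.coord h ∘ₗ (lieScale (fun n => 2 ^ (n : ℕ)) : FreeLie →ₗ[ℝ] FreeLie) =
      (2 : ℝ) ^ h.1.order • hallBasis.coord h := by
    refine hallBasis.ext fun g => ?_
    have h₁ : lieScale (fun n => 2 ^ (n : ℕ)) (hallBasis g) =
        (2 : ℝ) ^ g.1.order • hallBasis g := by
      rw [hallBasis_apply, lieScale_word _ fun _ => rfl]
    rw [LinearMap.comp_apply, LieHom.coe_toLinearMap, h₁]
    simp only [map_smul, Module.Basis.coord_apply, Module.Basis.repr_self, LinearMap.smul_apply,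
      smul_eq_mul]
    by_cases hg : g = h
    · rw [hg]
    · rw [Finsupp.single_eq_of_ne (Ne.symm hg), mul_zero, mul_zero]
  exact congrArg (fun f : FreeLie →ₗ[ℝ] ℝ => f x) this

end Grading

/-! ### The exponent of a product of exponentials -/

section Exponent

variable {s : ℕ} (N : ℕ) (f : Fin s → ℕ+ → ℝ)

/-- The sequence `W` as a power series. -/
def lieSeries (W : ℕ → FreeLie) : PowerSeries FreeAssoc := PowerSeries.mk fun d => toAssoc (W d)

theorem coeff_lieSeries (W : ℕ → FreeLie) (d : ℕ) :
    PowerSeries.coeff d (lieSeries W) = toAssoc (W d) := by simp [lieSeries]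

theorem lieSeries_injective {V W : ℕ → FreeLie} (h : lieSeries V = lieSeries W) : V = W := by
  ext1 d
  apply toAssoc_injective
  rw [← coeff_lieSeries, h, coeff_lieSeries]

theorem coeff_formalExponent (i : Fin s) (d : ℕ) :
    PowerSeries.coeff d (formalExponent N f i) =
      ∑ k ∈ Finset.range N, if d = k + 1 then f i k.succPNat • FreeAlgebra.ι ℝ k.succPNat else 0 := by
  rw [formalExponent, map_sum]
  exact Finset.sum_congr rfl fun k _ => PowerSeries.coeff_monomial _ _ _

theorem formalExponent_isSeriesIn (i : Fin s) : IsSeriesIn lieRange (formalExponent N f i) := by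
  intro d
  rw [coeff_formalExponent]
  refine Submodule.sum_mem _ fun k _ => ?_
  split_ifs
  · refine Submodule.smul_mem _ _ ?_
    rw [← toAssoc_of]
    exact toAssoc_mem_lieRange _
  · exact Submodule.zero_mem _

theorem formalExponent_eqBelow_one (i : Fin s) : EqBelow 1 (formalExponent N f i) 0 := by
  rw [eqBelow_one_iff, coeff_formalExponent]
  exact Finset.sum_eq_zero fun k _ => if_neg (by omega)

theorem prod_formalExp : (List.ofFn fun i : Fin s => formalExp (formalExponent N f i)).prod =
    ((List.ofFn fun i : Fin s => formalExponent N f i).map powExp).prod := by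
  rw [List.map_ofFn]; rfl

theorem isCfetExponent_iff (W : ℕ → FreeLie) : IsCfetExponent N f W ↔
    EqBelow 1 (lieSeries W) 0 ∧ powExp (lieSeries W) =
      ((List.ofFn fun i : Fin s => formalExponent N f i).map powExp).prod := by
  rw [IsCfetExponent, prod_formalExp, eqBelow_one_iff, coeff_lieSeries]
  refine and_congr ?_ Iff.rfl
  rw [← toAssoc_injective.eq_iff, map_zero]

/-- Existence is the Baker–Campbell–Hausdorff theorem; uniqueness is injectivity of the exponential
and of `toAssoc`. -/
theorem existsUnique_isCfetExponent : ∃! W : ℕ → FreeLie, IsCfetExponent N f W := by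
  obtain ⟨w, hw, hw₀, h⟩ := exists_powExp_eq_prod lieRange_commutator
    (List.ofFn fun i : Fin s => formalExponent N f i) (by
      intro x hx
      obtain ⟨i, rfl⟩ := (List.mem_ofFn' _ _).1 hx
      exact ⟨formalExponent_isSeriesIn N f i, formalExponent_eqBelow_one N f i⟩)
  choose W hW using hw
  have hwW : lieSeries W = w := by
    ext d
    rw [coeff_lieSeries]; exact hW d
  refine ⟨W, (isCfetExponent_iff N f W).2 ⟨hwW ▸ hw₀, hwW ▸ h⟩, fun V hV => ?_⟩
  obtain ⟨hV₀, hV⟩ := (isCfetExponent_iff N f V).1 hV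
  refine lieSeries_injective (EqBelow.eq fun K => ?_)
  refine eqBelow_of_powExp hV₀ (hwW ▸ hw₀) ?_
  rw [hV, hwW, h]
  exact EqBelow.refl _

theorem eq_of_powExp_eq {a b : PowerSeries FreeAssoc} (ha : EqBelow 1 a 0) (hb : EqBelow 1 b 0)
    (h : powExp a = powExp b) : a = b :=
  EqBelow.eq fun _ => eqBelow_of_powExp ha hb (h ▸ EqBelow.refl _)

variable {N f} {W : ℕ → FreeLie} (hW : IsCfetExponent N f W)

include hW in
/-- A homomorphism that fixes the exponents of the factors fixes the exponent of the product. -/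
theorem coeffScale_lieSeries {c : ℝ} {σ : FreeAssoc →ₐ[ℝ] FreeAssoc}
    (h : ∀ i, coeffScale c σ (formalExponent N f i) = formalExponent N f i) :
    coeffScale c σ (lieSeries W) = lieSeries W := by
  obtain ⟨hW₀, hW⟩ := (isCfetExponent_iff N f W).1 hW
  have h₀ : EqBelow 1 (coeffScale c σ (lieSeries W)) 0 := by simpa using hW₀.coeffScale c σ
  refine eq_of_powExp_eq h₀ hW₀ ?_
  rw [← coeffScale_powExp, hW, map_list_prod, List.map_map]
  congr 1
  refine List.map_congr_left fun x hx => ?_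
  obtain ⟨i, rfl⟩ := (List.mem_ofFn' _ _).1 hx
  rw [Function.comp_apply, coeffScale_powExp, h]

/-- Invariance under `T ↦ T / 2`, `Aₙ ↦ 2ⁿ Aₙ`. -/
def IsHomogeneous (g : PowerSeries FreeAssoc) : Prop :=
  coeffScale 2⁻¹ (assocScale fun n => 2 ^ (n : ℕ)) g = g

theorem IsHomogeneous.coeff {g : PowerSeries FreeAssoc} (hg : IsHomogeneous g) (d : ℕ) :
    assocScale (fun n => 2 ^ (n : ℕ)) (PowerSeries.coeff d g) =
      (2 : ℝ) ^ d • PowerSeries.coeff d g := by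
  conv_rhs => rw [← hg, coeff_coeffScale, smul_smul, ← mul_pow]
  simp

theorem isHomogeneous_monomial (n : ℕ+) (r : ℝ) :
    IsHomogeneous (PowerSeries.monomial (n : ℕ) (r • FreeAlgebra.ι ℝ n)) := by
  rw [IsHomogeneous, coeffScale_monomial, map_smul (assocScale _), assocScale_ι, smul_comm r, smul_smul, ← mul_pow]
  simp

theorem isHomogeneous_formalExponent (i : Fin s) : IsHomogeneous (formalExponent N f i) := by
  rw [formalExponent, IsHomogeneous, map_sum]
  exact Finset.sum_congr rfl fun k _ => isHomogeneous_monomial k.succPNat (f i k.succPNat)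

include hW in
theorem isHomogeneous_lieSeries : IsHomogeneous (lieSeries W) :=
  coeffScale_lieSeries hW isHomogeneous_formalExponent

include hW in
-- By homogeneity `W d` has eigenvalue `2 ^ d` under `Aₙ ↦ 2ⁿ Aₙ`, so it has no component along
-- eigenvectors for other powers of `2`.
theorem repr_exponent (d : ℕ) {h : HallElement} (hd : h.1.order ≠ d) :
    hallBasis.repr (W d) h = 0 := by
  have h₁ := (isHomogeneous_lieSeries hW).coeff d
  rw [coeff_lieSeries, assocScale_toAssoc, ← map_smul] at h₁
  have h₂ := congrArg (fun x => hallBasis.repr x h) (toAssoc_injective h₁)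
  simp only [repr_lieScale_two, map_smul, Finsupp.smul_apply, smul_eq_mul] at h₂
  by_contra hne
  have h₃ := mul_right_cancel₀ hne h₂
  exact hd (Nat.pow_right_injective le_rfl (by exact_mod_cast h₃))

include hW in
theorem gradedAssoc_exponent (d : ℕ) :
    gradedAssoc (W d) = PowerSeries.monomial d (toAssoc (W d)) := by
  conv_lhs => rw [← hall_sum (W d)]
  conv_rhs => rw [← hall_sum (W d)]
  rw [map_sum, map_sum, map_sum]
  refine Finset.sum_congr rfl fun h hh => ?_
  have : h.1.order = d := by
    by_contra hne
    exact (Finsupp.mem_support_iff.1 hh) (repr_exponent hW d hne)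
  rw [map_smul, map_smul, gradedAssoc_word, this]
  exact (LinearMap.map_smul_of_tower _ _ _).symm

include hW in
theorem gradedAssoc_sum_exponent :
    EqBelow (N + 1) (gradedAssoc (∑ d ∈ Finset.range (N + 1), W d)) (lieSeries W) := by
  intro d hd
  rw [map_sum, map_sum, coeff_lieSeries, Finset.sum_eq_single_of_mem d (Finset.mem_range.2 hd)]
  · rw [gradedAssoc_exponent hW, PowerSeries.coeff_monomial, if_pos rfl]
  · intro e _ he
    rw [gradedAssoc_exponent hW, PowerSeries.coeff_monomial, if_neg he.symm]

end Exponent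
end LieRange

/-! ### The differential equation of the Magnus expansion in the free Lie algebra -/

section Flow

open scoped TensorProduct
open Polynomial

/-- Polynomials in the scaled time with coefficients in the free associative algebra. -/
abbrev PolyAssoc : Type := ℝ[X] ⊗[ℝ] FreeAssoc

/-- The derivative with respect to time. -/
def timeDer : PolyAssoc →ₗ[ℝ] PolyAssoc := LinearMap.rTensor FreeAssoc derivative

/-- The primitive with respect to time. -/
def timeInt : PolyAssoc →ₗ[ℝ] PolyAssoc := LinearMap.rTensor FreeAssoc polyPrimitive

/-- The value at time `c`. -/
def timeEval (c : ℝ) : PolyAssoc →ₐ[ℝ] FreeAssoc :=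
  Algebra.TensorProduct.lift ((Algebra.ofId ℝ FreeAssoc).comp (aeval c)) (AlgHom.id ℝ FreeAssoc)
    fun r y => show algebraMap ℝ FreeAssoc (aeval c r) * y = y * algebraMap ℝ FreeAssoc (aeval c r)
      from Algebra.commutes _ y

/-- Time reversal `x ↦ 1 - x`. -/
def timeRev : PolyAssoc →ₐ[ℝ] PolyAssoc :=
  Algebra.TensorProduct.map (aeval (1 - X)) (AlgHom.id ℝ FreeAssoc)

theorem timeEval_tmul (c : ℝ) (p : ℝ[X]) (x : FreeAssoc) :
    timeEval c (p ⊗ₜ x) = p.eval c • x := by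
  have h : timeEval c (p ⊗ₜ x) = algebraMap ℝ FreeAssoc (aeval c p) * x :=
    Algebra.TensorProduct.lift_tmul _ _ _ _ _
  rw [h, ← Algebra.smul_def, coe_aeval_eq_eval]

theorem timeDer_tmul (p : ℝ[X]) (x : FreeAssoc) : timeDer (p ⊗ₜ x) = derivative p ⊗ₜ x := by
  simp [timeDer]

theorem timeInt_tmul (p : ℝ[X]) (x : FreeAssoc) : timeInt (p ⊗ₜ x) = polyPrimitive p ⊗ₜ x := by
  simp [timeInt]

theorem timeRev_tmul (p : ℝ[X]) (x : FreeAssoc) : timeRev (p ⊗ₜ x) = p.comp (1 - X) ⊗ₜ x := by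
  rw [timeRev, Algebra.TensorProduct.map_tmul]
  rfl

theorem timeDer_mul (y z : PolyAssoc) : timeDer (y * z) = timeDer y * z + y * timeDer z := by
  induction y using TensorProduct.induction_on with
  | zero => simp
  | add y₁ y₂ h₁ h₂ => rw [add_mul, map_add, h₁, h₂, map_add]; noncomm_ring
  | tmul p x =>
    induction z using TensorProduct.induction_on with
    | zero => simp
    | add z₁ z₂ h₁ h₂ => rw [mul_add, map_add, h₁, h₂, map_add]; noncomm_ring
    | tmul q y =>
      simp only [timeDer_tmul, Algebra.TensorProduct.tmul_mul_tmul, derivative_mul,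
        TensorProduct.add_tmul]

theorem timeDer_timeInt (y : PolyAssoc) : timeDer (timeInt y) = y := by
  induction y using TensorProduct.induction_on with
  | zero => simp
  | add y₁ y₂ h₁ h₂ => rw [map_add, map_add, h₁, h₂]
  | tmul p x => rw [timeInt_tmul, timeDer_tmul, derivative_polyPrimitive]

theorem timeInt_timeDer (y : PolyAssoc) :
    timeInt (timeDer y) = y - (1 : ℝ[X]) ⊗ₜ timeEval 0 y := by
  induction y using TensorProduct.induction_on with
  | zero => simp
  | add y₁ y₂ h₁ h₂ => rw [map_add, map_add, h₁, h₂, map_add, TensorProduct.tmul_add]; abel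
  | tmul p x =>
    rw [timeDer_tmul, timeInt_tmul, polyPrimitive_derivative, timeEval_tmul,
      TensorProduct.sub_tmul, ← TensorProduct.smul_tmul, smul_eq_C_mul, mul_one]

theorem timeEval_zero_timeInt (y : PolyAssoc) : timeEval 0 (timeInt y) = 0 := by
  induction y using TensorProduct.induction_on with
  | zero => simp
  | add y₁ y₂ h₁ h₂ => rw [map_add, map_add, h₁, h₂, add_zero]
  | tmul p x => rw [timeInt_tmul, timeEval_tmul, eval_zero_polyPrimitive, zero_smul]

theorem timeDer_timeRev (y : PolyAssoc) : timeDer (timeRev y) = - timeRev (timeDer y) := by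
  induction y using TensorProduct.induction_on with
  | zero => simp
  | add y₁ y₂ h₁ h₂ => rw [map_add, map_add, h₁, h₂, map_add, map_add]; abel
  | tmul p x =>
    rw [timeRev_tmul, timeDer_tmul, timeDer_tmul, timeRev_tmul, derivative_comp,
      ← TensorProduct.neg_tmul]
    simp

theorem timeEval_timeRev (c : ℝ) (y : PolyAssoc) :
    timeEval c (timeRev y) = timeEval (1 - c) y := by
  induction y using TensorProduct.induction_on with
  | zero => simp
  | add y₁ y₂ h₁ h₂ => rw [map_add, map_add, h₁, h₂, map_add]
  | tmul p x => rw [timeRev_tmul, timeEval_tmul, timeEval_tmul, eval_comp]; simp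

theorem mk_mul_mk (p q : ℝ[X]) (f g : PowerSeries FreeAssoc) :
    coeffMap (TensorProduct.mk ℝ ℝ[X] FreeAssoc p) f *
      coeffMap (TensorProduct.mk ℝ ℝ[X] FreeAssoc q) g =
      coeffMap (TensorProduct.mk ℝ ℝ[X] FreeAssoc (p * q)) (f * g) := by
  ext d
  simp only [PowerSeries.coeff_mul, coeff_coeffMap, map_sum, TensorProduct.mk_apply,
    Algebra.TensorProduct.tmul_mul_tmul]

/-- The homomorphism of `PolyLie` to power series with `Aₙ ↦ Aₙ Tⁿ`. -/
def polyGraded : PolyLie →ₗ[ℝ] PowerSeries PolyAssoc :=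
  TensorProduct.lift (LinearMap.mk₂ ℝ
    (fun p l => coeffMap (TensorProduct.mk ℝ ℝ[X] FreeAssoc p) (gradedAssoc l))
    (fun p q l => by ext d; simp [coeff_coeffMap])
    (fun r p l => by
      ext d
      simp [coeff_coeffMap, LinearMap.map_smul_of_tower, TensorProduct.smul_tmul'])
    (fun p l m => by rw [map_add, map_add])
    (fun r p l => by rw [map_smul, map_smul]))

theorem polyGraded_tmul (p : ℝ[X]) (l : FreeLie) : polyGraded (p ⊗ₜ l) =
    coeffMap (TensorProduct.mk ℝ ℝ[X] FreeAssoc p) (gradedAssoc l) := rfl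

theorem polyGraded_lie (y z : PolyLie) : polyGraded ⁅y, z⁆ = ⁅polyGraded y, polyGraded z⁆ := by
  simp only [Ring.lie_def]
  induction y using TensorProduct.induction_on with
  | zero =>
    have : ⁅(0 : PolyLie), z⁆ = 0 := zero_lie z
    rw [this, map_zero, zero_mul, mul_zero, sub_zero]
  | add y₁ y₂ h₁ h₂ =>
    have : ⁅y₁ + y₂, z⁆ = ⁅y₁, z⁆ + ⁅y₂, z⁆ := add_lie y₁ y₂ z
    rw [this, map_add, h₁, h₂, map_add]
    noncomm_ring
  | tmul p x =>
    induction z using TensorProduct.induction_on with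
    | zero =>
      have : ⁅p ⊗ₜ[ℝ] x, (0 : PolyLie)⁆ = 0 := lie_zero (p ⊗ₜ[ℝ] x : PolyLie)
      rw [this, map_zero, zero_mul, mul_zero, sub_zero]
    | add z₁ z₂ h₁ h₂ =>
      have : ⁅p ⊗ₜ[ℝ] x, z₁ + z₂⁆ = ⁅p ⊗ₜ[ℝ] x, z₁⁆ + ⁅p ⊗ₜ[ℝ] x, z₂⁆ :=
        lie_add (p ⊗ₜ[ℝ] x : PolyLie) z₁ z₂
      rw [this, map_add, h₁, h₂, map_add]
      noncomm_ring
    | tmul q y =>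
      rw [LieAlgebra.ExtendScalars.bracket_tmul, polyGraded_tmul, polyGraded_tmul, polyGraded_tmul,
        mk_mul_mk, mk_mul_mk, gradedAssoc_lie, map_sub, mul_comm q p]

theorem polyGraded_int (z : PolyLie) :
    polyGraded (LinearMap.rTensor FreeLie polyPrimitive z) = coeffMap timeInt (polyGraded z) := by
  induction z using TensorProduct.induction_on with
  | zero => simp
  | add y₁ y₂ h₁ h₂ => simp only [map_add, h₁, h₂]
  | tmul p x =>
    rw [LinearMap.rTensor_tmul, polyGraded_tmul, polyGraded_tmul]
    ext d
    rw [coeff_coeffMap, coeff_coeffMap, coeff_coeffMap, TensorProduct.mk_apply,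
      TensorProduct.mk_apply, timeInt_tmul]

theorem timeEval_polyGraded (z : PolyLie) :
    coeffScale 1 (timeEval 1) (polyGraded z) = gradedAssoc (evalOne z) := by
  induction z using TensorProduct.induction_on with
  | zero => simp [evalOne]
  | add y₁ y₂ h₁ h₂ => simp only [map_add, h₁, h₂, evalOne]
  | tmul p x =>
    have : evalOne (p ⊗ₜ x) = p.eval 1 • x := by simp [evalOne, leval]
    rw [this, map_smul, polyGraded_tmul]
    ext d
    rw [coeff_coeffScale, coeff_coeffMap, TensorProduct.mk_apply, timeEval_tmul, one_pow, one_smul,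
      LinearMap.map_smul_of_tower]

/-- The coefficient `∑ Pₙ₋₁(x) Aₙ Tⁿ` of the differential equation. -/
def flowCoeff (N : ℕ) : PowerSeries PolyAssoc :=
  ∑ k ∈ Finset.range N,
    PowerSeries.monomial (k + 1) (legendreP k ⊗ₜ[ℝ] FreeAlgebra.ι ℝ k.succPNat)

theorem polyGraded_formalA (N : ℕ) : polyGraded (formalA N) = flowCoeff N := by
  rw [formalA, map_sum]
  refine Finset.sum_congr rfl fun k _ => ?_
  rw [polyGraded_tmul, gradedAssoc_of, coeffMap_monomial]
  rfl

theorem flowCoeff_eqBelow_one (N : ℕ) : EqBelow 1 (flowCoeff N) 0 :=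
  EqBelow.sum_zero fun k _ => by
    rw [eqBelow_one_iff, PowerSeries.coeff_monomial, if_neg (by omega)]

/-- The exponential of the Magnus expansion is the value at time `1` of a solution of the
differential equation. -/
theorem exists_flow (N : ℕ) : ∃ Y : PowerSeries PolyAssoc,
    EqBelow (N + 1) (coeffMap timeDer Y) (flowCoeff N * Y) ∧ coeffScale 1 (timeEval 0) Y = 1 ∧
      coeffScale 1 (timeEval 1) Y = powExp (gradedAssoc (magnusLie N)) := by
  -- `polyGraded` respects brackets and integration, so it transports the recursion in the free Lie
  -- algebra to the one for power series.
  have hrel : ∀ n, polyGraded (magnusDot (fun z => LinearMap.rTensor FreeLie polyPrimitive z)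
      (formalA N) n) = magnusDot (coeffMap timeInt) (flowCoeff N) n :=
    magnusDot_rel (fun _ y z => polyGraded y = z)
      (fun _ => map_zero _) (fun _ x x' y y' hx hy => by rw [map_add, hx, hy])
      (fun _ r x x' hx => by rw [map_smul, hx])
      (fun i j x x' y y' hx hy => by rw [polyGraded_lie, hx, hy])
      (fun n x x' hx => by rw [polyGraded_int, hx]) (polyGraded_formalA N)
  have hDI : ∀ x, coeffMap timeDer (coeffMap timeInt x) = x := fun x => by
    ext d
    rw [coeff_coeffMap, coeff_coeffMap, timeDer_timeInt]
  obtain ⟨-, h⟩ := magnus_ode (isCoeffDerivation_coeffMap timeDer_mul) hDI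
    (fun n x hx => by simpa using hx.coeffMap timeInt) (flowCoeff_eqBelow_one N) N
  refine ⟨_, h, ?_, ?_⟩
  · rw [coeffScale_powExp, map_sum, Finset.sum_eq_zero, powExp_zero]
    intro n _
    ext d
    rw [magnusTerm, coeff_coeffScale, coeff_coeffMap, timeEval_zero_timeInt]
    simp
  · rw [coeffScale_powExp, magnusLie, map_sum, map_sum]
    congr 1
    refine Finset.sum_congr rfl fun n _ => ?_
    rw [← timeEval_polyGraded, magnusTerm, magnusTerm, polyGraded_int, hrel]

/-- `Pₖ` contributes `(-1)ᵏ` and its variable `Tᵏ⁺¹` contributes `(-1)ᵏ⁺¹`. -/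
theorem flowCoeff_rev (N : ℕ) : coeffScale (-1) timeRev (flowCoeff N) = - flowCoeff N := by
  rw [flowCoeff, map_sum, ← Finset.sum_neg_distrib]
  refine Finset.sum_congr rfl fun k _ => ?_
  rw [coeffScale_monomial, timeRev_tmul, legendreP_comp_one_sub, ← map_neg,
    ← TensorProduct.neg_tmul, TensorProduct.smul_tmul']
  congr 2
  rw [smul_eq_C_mul, C_pow, C_neg, C_1, ← mul_assoc, ← pow_add,
    Odd.neg_one_pow (by exact ⟨k, by ring⟩), neg_one_mul]

/-- Uniqueness of the flow: the coefficient has no constant term in `T`, so the time derivative in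
order `d` involves lower orders of `V` only. These vanish inductively, which leaves a constant equal
to its initial value `0`. -/
theorem eq_zero_of_flow {N : ℕ} {V : PowerSeries PolyAssoc}
    (h : EqBelow (N + 1) (coeffMap timeDer V) (flowCoeff N * V))
    (h₀ : EqBelow (N + 1) (coeffScale 1 (timeEval 0) V) 0) : EqBelow (N + 1) V 0 := by
  intro d
  induction d using Nat.strong_induction_on with
  | _ d ih =>
    intro hd
    have h₁ := h d hd
    have h₂ : EqBelow (d + 1) (flowCoeff N * V) 0 := by
      have h₃ : EqBelow d V 0 := fun e he => ih e he (he.trans hd)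
      exact ((flowCoeff_eqBelow_one N).mul_zero_add h₃).mono (by omega)
    rw [h₂ d (by omega), coeff_coeffMap, map_zero] at h₁
    have h₃ := h₀ d hd
    rw [coeff_coeffScale, one_pow, one_smul, map_zero] at h₃
    have h₄ := timeInt_timeDer (PowerSeries.coeff d V)
    rw [h₁, h₃, map_zero, TensorProduct.tmul_zero, sub_zero] at h₄
    rw [← h₄, map_zero]

/-- Time symmetry of the Magnus expansion: its parts of even order vanish. -/
theorem magnusLie_even {N d : ℕ} (hd : d ≤ N) (he : Even d) :
    PowerSeries.coeff d (gradedAssoc (magnusLie N)) = 0 := by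
  obtain ⟨Y, hY, hY₀, hY₁⟩ := exists_flow N
  set Ω := gradedAssoc (magnusLie N) with hΩ
  have hΩ₀ : EqBelow 1 Ω 0 := gradedAssoc_eqBelow_one _
  let τ : PowerSeries FreeAssoc →ₐ[ℝ] PowerSeries FreeAssoc := coeffScale (-1) (AlgHom.id ℝ _)
  let inc : PowerSeries FreeAssoc →ₐ[ℝ] PowerSeries PolyAssoc :=
    coeffScale 1 Algebra.TensorProduct.includeRight
  -- `Z(x, T) = Y(1 - x, -T)` solves the same equation, hence `Z = Y · Z(0)` with `Z(0) = exp
  -- Ω(-T)`. At `x = 1` this reads `1 = exp Ω(T) exp Ω(-T)`.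
  set Z := coeffScale (-1) timeRev Y with hZ
  have hZ' : EqBelow (N + 1) (coeffMap timeDer Z) (flowCoeff N * Z) := by
    have h₁ : coeffMap timeDer Z = - coeffScale (-1) timeRev (coeffMap timeDer Y) := by
      ext d
      rw [hZ, coeff_coeffMap, coeff_coeffScale, map_smul, timeDer_timeRev, map_neg, coeff_coeffScale,
        coeff_coeffMap, smul_neg]
    rw [h₁]
    refine (hY.coeffScale (-1) timeRev).neg.trans ?_
    have h₂ : coeffScale (-1) timeRev (flowCoeff N * Y) = -(flowCoeff N * Z) := by
      rw [map_mul, flowCoeff_rev]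
      exact neg_mul (flowCoeff N) Z
    rw [h₂, neg_neg]
    exact EqBelow.refl _
  have hinc : ∀ c g, coeffScale 1 (timeEval c) (inc g) = g := by
    intro c g
    ext d
    rw [coeff_coeffScale, coeff_coeffScale, one_pow, one_smul, one_smul,
      Algebra.TensorProduct.includeRight_apply, timeEval_tmul]
    simp
  have hrev : ∀ c, coeffScale 1 (timeEval c) Z = τ (coeffScale 1 (timeEval (1 - c)) Y) := by
    intro c
    ext d
    rw [hZ, coeff_coeffScale, coeff_coeffScale, coeff_coeffScale, coeff_coeffScale, map_smul,
      timeEval_timeRev]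
    simp
  have hV := eq_zero_of_flow (N := N) (V := Z - Y * inc (τ (powExp Ω))) (by
    rw [map_sub, (isCoeffDerivation_coeffMap timeDer_mul).leibniz, mul_sub, ← mul_assoc]
    have h₁ : coeffMap timeDer (inc (τ (powExp Ω))) = 0 := by
      ext d
      rw [coeff_coeffMap, coeff_coeffScale, map_smul, Algebra.TensorProduct.includeRight_apply,
        timeDer_tmul]
      simp
    rw [h₁, mul_zero, add_zero]
    exact hZ'.sub (hY.mul (EqBelow.refl _))) (by
    rw [map_sub, map_mul, hinc, hrev, hY₀, sub_zero, hY₁, one_mul, sub_self]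
    exact EqBelow.refl _)
  have h₁ := hV.coeffScale 1 (timeEval 1)
  rw [map_sub, map_mul, hinc, hrev, sub_self, hY₀, hY₁, map_one, map_zero,
    EqBelow.sub_zero_iff] at h₁
  have h₂ : EqBelow (N + 1) (powExp (-Ω)) (powExp (τ Ω)) := by
    have := (EqBelow.refl (powExp (-Ω))).mul h₁
    rwa [mul_one, ← mul_assoc, neg_powExp_mul hΩ₀, one_mul, coeffScale_powExp] at this
  have h₃ := eqBelow_of_powExp (by simpa using hΩ₀.neg) (by simpa using hΩ₀.coeffScale (-1) (AlgHom.id ℝ _)) h₂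
    d (by omega)
  rw [coeff_coeffScale, he.neg_one_pow, one_smul, map_neg, AlgHom.id_apply] at h₃
  exact self_eq_neg.1 h₃.symm

end Flow

/-! ### Linear functionals of the flow -/

section Functionals

open scoped TensorProduct
open Polynomial

/-- Application of a linear functional on the free associative algebra to coefficients. -/
def pairing (l : FreeAssoc →ₗ[ℝ] ℝ) : PolyAssoc →ₗ[ℝ] ℝ[X] :=
  (TensorProduct.rid ℝ ℝ[X]).toLinearMap ∘ₗ LinearMap.lTensor ℝ[X] l

theorem pairing_tmul (l : FreeAssoc →ₗ[ℝ] ℝ) (p : ℝ[X]) (x : FreeAssoc) :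
    pairing l (p ⊗ₜ x) = l x • p := by
  simp [pairing]

theorem pairing_zero (z : PolyAssoc) : pairing 0 z = 0 := by simp [pairing]

theorem pairing_smul (c : ℝ) (l : FreeAssoc →ₗ[ℝ] ℝ) (z : PolyAssoc) :
    pairing (c • l) z = c • pairing l z := by simp [pairing, LinearMap.lTensor_smul]

theorem derivative_pairing (l : FreeAssoc →ₗ[ℝ] ℝ) (z : PolyAssoc) :
    derivative (pairing l z) = pairing l (timeDer z) := by
  induction z using TensorProduct.induction_on with
  | zero => simp
  | add y z hy hz => simp only [map_add, hy, hz]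
  | tmul p x => rw [pairing_tmul, timeDer_tmul, pairing_tmul, derivative_smul]

theorem eval_pairing (c : ℝ) (l : FreeAssoc →ₗ[ℝ] ℝ) (z : PolyAssoc) :
    (pairing l z).eval c = l (timeEval c z) := by
  induction z using TensorProduct.induction_on with
  | zero => simp
  | add y z hy hz => simp only [map_add, eval_add, hy, hz]
  | tmul p x => rw [pairing_tmul, timeEval_tmul, map_smul, eval_smul, smul_eq_mul, smul_eq_mul,
      mul_comm]

theorem pairing_tmul_mul (l : FreeAssoc →ₗ[ℝ] ℝ) (p : ℝ[X]) (a : FreeAssoc) (z : PolyAssoc) :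
    pairing l ((p ⊗ₜ a) * z) = p * pairing (l ∘ₗ LinearMap.mulLeft ℝ a) z := by
  induction z using TensorProduct.induction_on with
  | zero => simp
  | add y z hy hz => rw [mul_add, map_add, hy, hz, map_add, mul_add]
  | tmul q x =>
    rw [Algebra.TensorProduct.tmul_mul_tmul, pairing_tmul, pairing_tmul, mul_smul_comm]
    rfl

theorem coeff_monomial_mul' {B : Type*} [Ring B] (n : ℕ) (b : B) (f : PowerSeries B) (d : ℕ) :
    PowerSeries.coeff d (PowerSeries.monomial n b * f) =
      if n ≤ d then b * PowerSeries.coeff (d - n) f else 0 := by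
  rw [PowerSeries.coeff_mul]
  split_ifs with h
  · rw [Finset.sum_eq_single_of_mem (n, d - n)
      (Finset.HasAntidiagonal.mem_antidiagonal.2 (by simp only; omega))]
    · simp
    · rintro ⟨i, j⟩ hp hne
      have hp := Finset.HasAntidiagonal.mem_antidiagonal.1 hp
      simp only at hp
      rw [PowerSeries.coeff_monomial, if_neg, zero_mul]
      intro hi
      exact hne (Prod.ext hi (by simp only; omega))
  · refine Finset.sum_eq_zero ?_
    rintro ⟨i, j⟩ hp
    have hp := Finset.HasAntidiagonal.mem_antidiagonal.1 hp
    simp only at hp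
    rw [PowerSeries.coeff_monomial, if_neg (by simp only; omega), zero_mul]

/-- `Y` solves the differential equation with initial value `1`, up to order `N`. -/
structure IsFlow (N : ℕ) (Y : PowerSeries PolyAssoc) : Prop where
  der : EqBelow (N + 1) (coeffMap timeDer Y) (flowCoeff N * Y)
  init : coeffScale 1 (timeEval 0) Y = 1

/-- The polynomial of time given by a functional of the part of order `d` of a power series. -/
def flowFun (Y : PowerSeries PolyAssoc) (d : ℕ) (l : FreeAssoc →ₗ[ℝ] ℝ) : ℝ[X] :=
  pairing l (PowerSeries.coeff d Y)

variable {N : ℕ} {Y : PowerSeries PolyAssoc} (hY : IsFlow N Y)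

/-- The functional `x ↦ l (Aₖ₊₁ x)`. -/
def shiftFun (l : FreeAssoc →ₗ[ℝ] ℝ) (k : ℕ) : FreeAssoc →ₗ[ℝ] ℝ :=
  l ∘ₗ LinearMap.mulLeft ℝ (FreeAlgebra.ι ℝ k.succPNat)

include hY in
theorem IsFlow.derivative {d : ℕ} (hd : d ≤ N) (l : FreeAssoc →ₗ[ℝ] ℝ) :
    derivative (flowFun Y d l) =
      ∑ k ∈ Finset.range d, legendreP k * flowFun Y (d - (k + 1)) (shiftFun l k) := by
  have h := hY.der d (by omega)
  rw [coeff_coeffMap] at h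
  rw [flowFun, derivative_pairing, h, flowCoeff, Finset.sum_mul, map_sum, map_sum,
    ← Finset.sum_subset (Finset.range_mono hd)]
  · refine Finset.sum_congr rfl fun k hk => ?_
    rw [Finset.mem_range] at hk
    rw [coeff_monomial_mul', if_pos (by omega), pairing_tmul_mul]
    rfl
  · intro k _ hk
    rw [Finset.mem_range] at hk
    rw [coeff_monomial_mul', if_neg (by omega), map_zero]

include hY in
theorem IsFlow.eval_zero (d : ℕ) (l : FreeAssoc →ₗ[ℝ] ℝ) :
    (flowFun Y d l).eval 0 = if d = 0 then l 1 else 0 := by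
  have h := congrArg (PowerSeries.coeff d) hY.init
  rw [coeff_coeffScale, one_pow, one_smul, PowerSeries.coeff_one] at h
  rw [flowFun, eval_pairing, h]
  split_ifs <;> simp

theorem eval_one_flowFun (Y : PowerSeries PolyAssoc) (d : ℕ) (l : FreeAssoc →ₗ[ℝ] ℝ) :
    (flowFun Y d l).eval 1 = l (PowerSeries.coeff d (coeffScale 1 (timeEval 1) Y)) := by
  rw [flowFun, eval_pairing, coeff_coeffScale, one_pow, one_smul]

include hY in
-- A letter `Aₙ` contributes `Pₙ₋₁`, of degree at most `n - 1`, and one integration, which together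
-- add at most `n` to the degree.
theorem IsFlow.natDegree_le (d : ℕ) : ∀ (_ : d ≤ N) (l : FreeAssoc →ₗ[ℝ] ℝ),
    (flowFun Y d l).natDegree ≤ d := by
  induction d using Nat.strong_induction_on with
  | _ d ih =>
    intro hd l
    have h := hY.derivative hd l
    have h₀ := polyPrimitive_derivative (flowFun Y d l)
    rw [eq_sub_iff_add_eq, h] at h₀
    rw [← h₀]
    refine (natDegree_add_le _ _).trans (max_le ?_ (by simp))
    rcases Nat.eq_zero_or_pos d with rfl | hpos
    · simp
    · refine (natDegree_polyPrimitive_le _).trans ?_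
      have : (∑ k ∈ Finset.range d, legendreP k * flowFun Y (d - (k + 1)) (shiftFun l k)).natDegree
          ≤ d - 1 := by
        refine natDegree_sum_le_of_forall_le _ _ fun k hk => natDegree_mul_le.trans ?_
        rw [Finset.mem_range] at hk
        have h₁ := natDegree_legendreP_le k
        have h₂ := ih (d - (k + 1)) (by omega) (by omega) (shiftFun l k)
        omega
      omega

/-- The scaling that removes the generators `Aₙ` with `n > N / 2`. -/
def lowGen (N : ℕ) (n : ℕ+) : ℝ := if N < 2 * (n : ℕ) then 0 else 1

theorem shiftFun_comp (c : ℕ+ → ℝ) (l : FreeAssoc →ₗ[ℝ] ℝ) (k : ℕ) :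
    shiftFun (l ∘ₗ (assocScale c).toLinearMap) k =
      c k.succPNat • (shiftFun l k ∘ₗ (assocScale c).toLinearMap) := by
  ext x
  simp [shiftFun, assocScale_ι]

include hY in
-- The core of rule (R2). The derivative splits by the first letter `Aₖ₊₁`. If this letter is
-- removed by `lowGen`, then `Pₖ` is orthogonal to its cofactor for reasons of degree. Otherwise an
-- integration by parts moves `q Pₖ` onto a new weight and leaves the same statement in order `e`.
-- The weight `q` is needed to close this induction.
theorem IsFlow.polyIntegral_eq_zero (hN : Even N) (d : ℕ) : ∀ (q : ℝ[X]) (l : FreeAssoc →ₗ[ℝ] ℝ),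
    q.natDegree + d ≤ N → polyIntegral (q * Polynomial.derivative (flowFun Y d l -
      flowFun Y d (l ∘ₗ (assocScale (lowGen N)).toLinearMap))) = 0 := by
  induction d using Nat.strong_induction_on with
  | _ d ih =>
    intro q l hq
    rw [Polynomial.derivative_sub, hY.derivative (by omega), hY.derivative (by omega),
      ← Finset.sum_sub_distrib, Finset.mul_sum, map_sum]
    refine Finset.sum_eq_zero fun k hk => ?_
    rw [Finset.mem_range] at hk
    set e := d - (k + 1) with he
    rw [shiftFun_comp]
    set m := shiftFun l k
    have hsmul : ∀ (c : ℝ) (l' : FreeAssoc →ₗ[ℝ] ℝ), flowFun Y e (c • l') = c • flowFun Y e l' :=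
      fun c l' => pairing_smul c l' _
    rw [hsmul, lowGen, Nat.succPNat_coe]
    split_ifs with hbig
    · rw [zero_smul, mul_zero, sub_zero, mul_comm (legendreP k), ← mul_assoc]
      refine polyIntegral_mul_legendreP_of_natDegree_lt ?_
      have h₁ := hY.natDegree_le e (by omega) m
      have h₂ := natDegree_mul_le (p := q) (q := flowFun Y e m)
      -- The cofactor has degree at most `N - (k + 1)`. From `N < 2(k + 1)` and evenness follows `N
      -- ≤ 2k`, which makes this less than `k`; for odd `N` the bound could fail by one.
      obtain ⟨M, rfl⟩ := hN
      omega
    · rw [one_smul, ← mul_sub, ← mul_assoc]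
      set v := flowFun Y e m - flowFun Y e (m ∘ₗ (assocScale (lowGen N)).toLinearMap)
      -- `Q` vanishes at `1` and `v` at `0`, so there are no boundary terms. The degree grows by at
      -- most `k + 1`, just as much as the order drops from `d` to `e`.
      let Q := polyPrimitive (q * legendreP k) - C (polyIntegral (q * legendreP k))
      have hQ : Polynomial.derivative Q = q * legendreP k := by
        simp [Q, derivative_polyPrimitive]
      have hQ₁ : Q.eval 1 = 0 := by
        simp [Q, polyIntegral, leval]
      have hv₀ : v.eval 0 = 0 := by
        simp only [v, eval_sub, hY.eval_zero]
        split_ifs <;> simp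
      have hdeg : Q.natDegree + e ≤ N := by
        have h₁ := natDegree_sub_le (polyPrimitive (q * legendreP k))
          (C (polyIntegral (q * legendreP k)))
        rw [natDegree_C] at h₁
        have h₂ := natDegree_polyPrimitive_le (q * legendreP k)
        have h₃ := natDegree_mul_le (p := q) (q := legendreP k)
        have h₄ := natDegree_legendreP_le k
        have h₅ : Q.natDegree ≤ max (polyPrimitive (q * legendreP k)).natDegree 0 := h₁
        omega
      have h₁ := polyIntegral_mul_derivative Q v
      rw [ih e (by omega) Q m hdeg, hQ, hQ₁, hv₀] at h₁
      linarith

/-- The parts of order at most `N` of the Magnus expansion contain no `Aₙ` with `n > N / 2`. -/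
theorem coeff_magnusLie_lowGen {N d : ℕ} (hN : Even N) (hd : d ≤ N) :
    PowerSeries.coeff d (gradedAssoc (magnusLie N)) =
      PowerSeries.coeff d (gradedAssoc (lieScale (lowGen N) (magnusLie N))) := by
  obtain ⟨Y, h, h₀, h₁⟩ := exists_flow N
  have hY : IsFlow N Y := ⟨h, h₀⟩
  have hU : EqBelow (N + 1) (powExp (gradedAssoc (magnusLie N)))
      (coeffScale 1 (assocScale (lowGen N)) (powExp (gradedAssoc (magnusLie N)))) := by
    intro d hd
    rw [← sub_eq_zero, ← Module.forall_dual_apply_eq_zero_iff ℝ]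
    intro l
    -- The weight `1` gives the difference between the values at times `1` and `0`.
    have h₂ := hY.polyIntegral_eq_zero hN d 1 l (by simp; omega)
    rw [one_mul, polyIntegral_derivative, eval_sub, eval_sub, hY.eval_zero, hY.eval_zero,
      eval_one_flowFun, eval_one_flowFun, h₁] at h₂
    rw [coeff_coeffScale, one_pow, one_smul, map_sub]
    have h₃ : ∀ c : ℝ, (if d = 0 then (l ∘ₗ (assocScale (lowGen N)).toLinearMap) 1 else (0 : ℝ)) =
        if d = 0 then l 1 else 0 := by simp
    rw [h₃ 0, sub_self, sub_zero] at h₂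
    exact h₂
  rw [coeffScale_powExp, coeffScale_gradedAssoc] at hU
  exact eqBelow_of_powExp (gradedAssoc_eqBelow_one _) (gradedAssoc_eqBelow_one _) hU d (by omega)

end Functionals

/-! ### The rules for the coefficients -/

section Rules

variable {s N : ℕ} {f : Fin s → ℕ+ → ℝ} {W : ℕ → FreeLie} (hW : IsCfetExponent N f W)

include hW in
theorem repr_sum_exponent {h : HallElement} (ho : h.1.order ≤ N) :
    hallBasis.repr (∑ d ∈ Finset.range (N + 1), W d) h = hallBasis.repr (W h.1.order) h := by
  rw [map_sum, Finsupp.finsetSum_apply, Finset.sum_eq_single_of_mem h.1.order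
    (Finset.mem_range.2 (by omega))]
  intro d _ hd
  exact repr_exponent hW d hd.symm

theorem prod_powExp_neg_reverse_mul {B : Type*} [Ring B] [Algebra ℝ B] (l : List (PowerSeries B))
    (hl : ∀ a ∈ l, EqBelow 1 a 0) :
    (l.reverse.map fun a => powExp (-a)).prod * (l.map powExp).prod = 1 := by
  induction l with
  | nil => simp
  | cons a l ih =>
    rw [List.reverse_cons, List.map_append, List.prod_append, List.map_singleton,
      List.prod_singleton, List.map_cons, List.prod_cons, mul_assoc, ← mul_assoc (powExp (-a)),
      neg_powExp_mul (hl a List.mem_cons_self), one_mul,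
      ih fun b hb => hl b (List.mem_cons_of_mem _ hb)]

include hW in
-- The substitution `T ↦ -T` sends `Ωᵢ` to `-Ω_{s-i+1}`, hence the product to its inverse;
-- injectivity of the exponential gives `W(-T) = -W(T)`.
theorem exponent_even (hf : TimeSymmetric N f) {d : ℕ} (hd : Even d) : W d = 0 := by
  obtain ⟨hW₀, hg⟩ := (isCfetExponent_iff N f W).1 hW
  set τ : PowerSeries FreeAssoc →ₐ[ℝ] PowerSeries FreeAssoc := coeffScale (-1) (AlgHom.id ℝ _)
  have hτ : ∀ i, τ (formalExponent N f i) = -formalExponent N f i.rev := by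
    intro i
    rw [formalExponent, formalExponent, map_sum, ← Finset.sum_neg_distrib]
    refine Finset.sum_congr rfl fun k hk => ?_
    rw [Finset.mem_range] at hk
    rw [coeffScale_monomial, hf i k.succPNat (by rw [Nat.succPNat_coe]; omega), ← map_neg,
      AlgHom.id_apply, smul_smul, ← neg_smul, Nat.succPNat_coe, pow_succ _ (k.succ)]
    congr 2
    rw [Nat.succ_eq_add_one, pow_succ]
    ring
  have hlist : (List.ofFn fun i : Fin s => formalExponent N f i).map (fun a => powExp (τ a)) =
      (List.ofFn fun i : Fin s => formalExponent N f i).reverse.map (fun a => powExp (-a)) := by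
    rw [List.map_reverse, List.map_ofFn, List.map_ofFn]
    refine List.ext_getElem (by simp) fun i h₁ h₂ => ?_
    simp only [List.getElem_ofFn, List.getElem_reverse, Function.comp_apply, hτ, List.length_ofFn]
    congr 3
    ext
    simp [Fin.rev]
    omega
  have hτg : powExp (τ (lieSeries W)) * powExp (lieSeries W) = 1 := by
    rw [← coeffScale_powExp, hg, map_list_prod, List.map_map]
    have : (τ : PowerSeries FreeAssoc → PowerSeries FreeAssoc) ∘ powExp =
        fun a => powExp (τ a) := by
      ext1 a
      exact coeffScale_powExp _ _ a
    rw [this, hlist]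
    refine prod_powExp_neg_reverse_mul _ fun a ha => ?_
    obtain ⟨i, rfl⟩ := (List.mem_ofFn' _ _).1 ha
    exact formalExponent_eqBelow_one N f i
  have h₁ : powExp (τ (lieSeries W)) = powExp (-lieSeries W) := by
    have := congrArg (fun x => x * powExp (-lieSeries W)) hτg
    simpa only [mul_assoc, powExp_mul_neg hW₀, mul_one, one_mul] using this
  have h₂ := eq_of_powExp_eq (by simpa using hW₀.coeffScale (-1) (AlgHom.id ℝ _))
    (by simpa using hW₀.neg) h₁
  have h₃ := congrArg (PowerSeries.coeff d) h₂
  rw [coeff_coeffScale, hd.neg_one_pow, one_smul, AlgHom.id_apply, map_neg, coeff_lieSeries] at h₃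
  exact toAssoc_injective ((self_eq_neg.1 h₃).trans (map_zero _).symm)

include hW in
theorem orderCondition_of_timeSymmetric (hf : TimeSymmetric N f) {h : HallElement}
    (ho : h.1.order ≤ N) (he : Even h.1.order) : OrderCondition hallBasis N W h := by
  rw [OrderCondition, repr_sum_exponent hW ho, exponent_even hW hf he,
    repr_eq_zero_of_coeff (magnusLie_even ho he) rfl]
  simp

include hW in
-- Removing the generators beyond `N / 2` leaves both exponents unchanged up to order `N`, so both
-- coordinates at `h` are `0`.
theorem orderCondition_of_halfSupported (hN : Even N) (hf : HalfSupported N f) {h : HallElement}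
    (ho : h.1.order ≤ N) {n : ℕ+} (hn : N < 2 * (n : ℕ)) (hc : h.1.Contains n) :
    OrderCondition hallBasis N W h := by
  have hlow : ∀ k, lowGen N k = 0 ∨ lowGen N k = 1 := by
    intro k; unfold lowGen; split_ifs <;> simp
  have hn' : lowGen N n = 0 := if_pos hn
  have hfix : ∀ i, coeffScale 1 (assocScale (lowGen N)) (formalExponent N f i) =
      formalExponent N f i := by
    intro i
    rw [formalExponent, map_sum]
    refine Finset.sum_congr rfl fun k hk => ?_
    rw [Finset.mem_range] at hk
    rw [coeffScale_monomial, one_pow, one_smul, map_smul, assocScale_ι, lowGen]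
    split_ifs with hk'
    · rw [hf i k.succPNat (by rw [Nat.succPNat_coe]; omega) hk', zero_smul, zero_smul]
    · rw [one_smul]
  have h₁ := congrArg (PowerSeries.coeff h.1.order) (coeffScale_lieSeries hW hfix)
  rw [coeff_coeffScale, one_pow, one_smul, coeff_lieSeries, assocScale_toAssoc] at h₁
  rw [OrderCondition, repr_sum_exponent hW ho, ← toAssoc_injective h₁,
    repr_eq_of_coeff (coeff_magnusLie_lowGen hN ho) rfl,
    repr_lieScale_of_contains _ hlow _ hn' hc, repr_lieScale_of_contains _ hlow _ hn' hc]

end Rules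

/-! ### The order conditions of `Aₙ` and `[A₁, A₂]` -/

section LowOrder

/-- Strictly upper triangular `3 × 3` matrices. -/
def upperMatrix (a b c : ℝ) : Matrix (Fin 3) (Fin 3) ℝ := !![0, a, c; 0, 0, b; 0, 0, 0]

theorem upperMatrix_mul (a b c a' b' c' : ℝ) :
    upperMatrix a b c * upperMatrix a' b' c' = upperMatrix 0 0 (a * b') := by
  ext i j
  fin_cases i <;> fin_cases j <;> simp [upperMatrix, Matrix.mul_apply, Fin.sum_univ_three]

theorem upperMatrix_sub (a b c a' b' c' : ℝ) :
    upperMatrix a b c - upperMatrix a' b' c' = upperMatrix (a - a') (b - b') (c - c') := by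
  ext i j
  fin_cases i <;> fin_cases j <;> simp [upperMatrix]

theorem upperMatrix_add (a b c a' b' c' : ℝ) :
    upperMatrix a b c + upperMatrix a' b' c' = upperMatrix (a + a') (b + b') (c + c') := by
  simp [upperMatrix]

theorem upperMatrix_smul (r a b c : ℝ) :
    r • upperMatrix a b c = upperMatrix (r * a) (r * b) (r * c) := by
  simp [upperMatrix]

theorem upperMatrix_zero : upperMatrix 0 0 0 = 0 := by
  ext i j; fin_cases i <;> fin_cases j <;> rfl

variable (p q : ℕ+)

/-- The representation with `A_p ↦ E₁₂`, `A_q ↦ E₂₃` and `Aₙ ↦ 0` otherwise. -/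
def matrixRep : FreeAssoc →ₐ[ℝ] Matrix (Fin 3) (Fin 3) ℝ :=
  FreeAlgebra.lift ℝ fun n => upperMatrix (if n = p then 1 else 0) (if n = q then 1 else 0) 0

theorem matrixRep_ι (n : ℕ+) : matrixRep p q (FreeAlgebra.ι ℝ n) =
    upperMatrix (if n = p then 1 else 0) (if n = q then 1 else 0) 0 := by simp [matrixRep]

theorem exists_matrixRep_word (w : LieWord) :
    ∃ a b c, matrixRep p q (toAssoc w.toLie) = upperMatrix a b c := by
  induction w with
  | gen n => exact ⟨_, _, _, by rw [LieWord.toLie, toAssoc_of, matrixRep_ι]⟩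
  | br x y hx hy =>
    obtain ⟨a, b, c, h⟩ := hx
    obtain ⟨a', b', c', h'⟩ := hy
    exact ⟨_, _, _, by rw [LieWord.toLie, toAssoc_lie, map_sub, map_mul, map_mul, h, h',
      upperMatrix_mul, upperMatrix_mul, upperMatrix_sub]⟩

/-- Strictly upper triangular `3 × 3` matrices are nilpotent of class two, so no Hall element with
two or more commutators is visible. -/
theorem matrixRep_nest (x y z : LieWord) :
    matrixRep p q (toAssoc (LieWord.br x (.br y z)).toLie) = 0 := by
  obtain ⟨a, b, c, hx⟩ := exists_matrixRep_word p q x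
  obtain ⟨a', b', c', hy⟩ := exists_matrixRep_word p q y
  obtain ⟨a₂, b₂, c₂, hz⟩ := exists_matrixRep_word p q z
  simp only [LieWord.toLie, toAssoc_lie, map_sub, map_mul, hx, hy, hz, upperMatrix_mul,
    upperMatrix_sub]
  simp [upperMatrix_zero]

/-- The exponents of the image of a Lie series under `matrixRep`. -/
def upperSeries (a b c : ℝ) : PowerSeries (Matrix (Fin 3) (Fin 3) ℝ) :=
  PowerSeries.monomial (p : ℕ) (upperMatrix a 0 0) +
    PowerSeries.monomial (q : ℕ) (upperMatrix 0 b 0) +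
    PowerSeries.monomial (p + q : ℕ) (upperMatrix 0 0 c)

theorem upperSeries_add (a b c a' b' c' : ℝ) : upperSeries p q a b c + upperSeries p q a' b' c' =
    upperSeries p q (a + a') (b + b') (c + c') := by
  have h (n : ℕ) (x y z x' y' z' : ℝ) : PowerSeries.monomial n (upperMatrix x y z) +
      PowerSeries.monomial n (upperMatrix x' y' z') =
      PowerSeries.monomial n (upperMatrix (x + x') (y + y') (z + z')) := by
    rw [← map_add, upperMatrix_add]
  have h₁ := h p a 0 0 a' 0 0
  have h₂ := h q 0 b 0 0 b' 0
  have h₃ := h (p + q) 0 0 c 0 0 c'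
  rw [add_zero] at h₁ h₂ h₃
  rw [upperSeries, upperSeries, upperSeries, ← h₁, ← h₂, ← h₃]
  abel

theorem upperSeries_smul (r a b c : ℝ) : r • upperSeries p q a b c =
    upperSeries p q (r * a) (r * b) (r * c) := by
  have h (n : ℕ) (x y z : ℝ) : r • PowerSeries.monomial n (upperMatrix x y z) =
      PowerSeries.monomial n (upperMatrix (r * x) (r * y) (r * z)) := by
    rw [← upperMatrix_smul]
    exact (LinearMap.map_smul_of_tower _ _ _).symm
  rw [upperSeries, upperSeries, smul_add, smul_add, h, h, h]
  simp only [mul_zero]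

theorem upperSeries_zero : upperSeries p q 0 0 0 = 0 := by simp [upperSeries, upperMatrix_zero]

theorem upperSeries_mul (a b c a' b' c' : ℝ) : upperSeries p q a b c * upperSeries p q a' b' c' =
    upperSeries p q 0 0 (a * b') := by
  simp only [upperSeries, add_mul, mul_add, monomial_mul_monomial, upperMatrix_mul]
  simp [upperMatrix_zero]

theorem upperSeries_eqBelow_one (a b c : ℝ) : EqBelow 1 (upperSeries p q a b c) 0 := by
  have h₁ := p.pos
  have h₂ := q.pos
  rw [eqBelow_one_iff, upperSeries, map_add, map_add, PowerSeries.coeff_monomial,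
    PowerSeries.coeff_monomial, PowerSeries.coeff_monomial, if_neg (by omega), if_neg (by omega),
    if_neg (by omega)]
  simp

/-- The cube of the exponent vanishes, and half its square contributes only to the corner entry. -/
theorem powExp_upperSeries (a b c : ℝ) : powExp (upperSeries p q a b c) =
    1 + upperSeries p q a b (c + a * b / 2) := by
  refine EqBelow.eq fun K => ?_
  have h₂ : upperSeries p q a b c ^ 2 = upperSeries p q 0 0 (a * b) := by
    rw [pow_two, upperSeries_mul]
  have h₃ : ∀ k, upperSeries p q a b c ^ (k + 3) = 0 := by
    intro k
    rw [pow_add, pow_succ _ 2, h₂, upperSeries_mul, zero_mul, upperSeries_zero, mul_zero]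
  refine (powExp_eqBelow (upperSeries_eqBelow_one p q a b c) (by omega : K ≤ K + 3)).trans ?_
  rw [powExpSum, Finset.sum_range_succ', Finset.sum_range_succ', Finset.sum_range_succ',
    Finset.sum_eq_zero fun k _ => by rw [show k + 1 + 1 + 1 = k + 3 from rfl, h₃, smul_zero]]
  simp only [zero_add, pow_one, pow_zero, Nat.factorial, h₂, Nat.reduceAdd, Nat.cast_one, inv_one,
    one_smul, mul_one, upperSeries_smul]
  rw [upperSeries_add, add_comm]
  norm_num
  rw [add_comm c, div_eq_inv_mul, div_eq_inv_mul, mul_one]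
  exact EqBelow.refl _

theorem powExp_upperSeries_mul (a b c a' b' c' : ℝ) :
    powExp (upperSeries p q a b c) * powExp (upperSeries p q a' b' c') =
      powExp (upperSeries p q (a + a') (b + b') (c + c' + (a * b' - a' * b) / 2)) := by
  simp only [powExp_upperSeries, mul_add, add_mul, one_mul, mul_one, upperSeries_mul]
  rw [add_assoc, add_assoc, upperSeries_add, upperSeries_add]
  congr 2 <;> ring

theorem upperSeries_of_powExp {a b c : ℝ} {x : PowerSeries (Matrix (Fin 3) (Fin 3) ℝ)}
    (hx : EqBelow 1 x 0) (h : powExp x = powExp (upperSeries p q a b c)) :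
    x = upperSeries p q a b c :=
  EqBelow.eq fun _ => eqBelow_of_powExp hx (upperSeries_eqBelow_one p q a b c) (h ▸ EqBelow.refl _)

theorem prod_powExp_upperSeries {s : ℕ} (a b : Fin s → ℝ) :
    ((List.ofFn fun i => upperSeries p q (a i) (b i) 0).map powExp).prod =
      powExp (upperSeries p q (∑ i, a i) (∑ i, b i)
        ((∑ i, ∑ j ∈ Finset.Ioi i, (a i * b j - a j * b i)) / 2)) := by
  induction s with
  | zero => simp [upperSeries_zero, powExp_zero]
  | succ s ih =>
    rw [List.ofFn_succ, List.map_cons, List.prod_cons, ih, powExp_upperSeries_mul,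
      Fin.sum_univ_succ, Fin.sum_univ_succ, Fin.sum_univ_succ]
    simp only [Fin.sum_Ioi_zero, Fin.sum_Ioi_succ]
    congr 2
    rw [Finset.sum_sub_distrib, Finset.mul_sum, Finset.sum_mul]
    ring

variable {p q}

/-- The Hall element `[A_p, A_q]`. -/
def hallPair (hpq : p < q) : HallElement := ⟨.br (.gen p) (.gen q), .pair p q hpq⟩

open Classical in
theorem matrixRep_hall_br (hpq : p < q) (x y : LieWord) (h : (LieWord.br x y).IsHall) :
    matrixRep p q (toAssoc (LieWord.br x y).toLie) =
      upperMatrix 0 0 (if LieWord.br x y = .br (.gen p) (.gen q) then 1 else 0) := by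
  cases h with
  | pair i j hij =>
    simp only [LieWord.toLie, toAssoc_lie, toAssoc_of, map_sub, map_mul, matrixRep_ι,
      upperMatrix_mul, upperMatrix_sub, LieWord.br.injEq, LieWord.gen.injEq, sub_self]
    congr 1
    have : ¬(j = p ∧ i = q) := by
      rintro ⟨rfl, rfl⟩
      exact lt_asymm hij hpq
    rw [ite_and, mul_ite, mul_ite, mul_one, mul_zero, mul_one, mul_zero]
    split_ifs <;> simp_all
  | nest x y z =>
    rw [matrixRep_nest, if_neg (by simp), upperMatrix_zero]

open Classical in
theorem matrixRep_hall (hpq : p < q) (x : FreeLie) :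
    coeffScale 1 (matrixRep p q) (gradedAssoc x) = upperSeries p q (hallBasis.repr x (hallGen p))
      (hallBasis.repr x (hallGen q)) (hallBasis.repr x (hallPair hpq)) := by
  have hword : ∀ h : HallElement, coeffScale 1 (matrixRep p q) (gradedAssoc h.1.toLie) =
      upperSeries p q (if hallGen p = h then 1 else 0) (if hallGen q = h then 1 else 0)
        (if hallPair hpq = h then 1 else 0) := by
    rintro ⟨w, hw⟩
    rw [gradedAssoc_word, coeffScale_monomial, one_pow, one_smul, hallGen, hallGen, hallPair]
    simp only [Subtype.mk.injEq]
    cases w with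
    | gen n =>
      rw [LieWord.toLie, toAssoc_of, matrixRep_ι, LieWord.order]
      simp only [LieWord.gen.injEq, reduceCtorEq, if_false]
      by_cases hp : n = p
      · subst hp
        rw [if_pos rfl, if_neg hpq.ne, if_neg hpq.ne']
        simp [upperSeries, upperMatrix_zero]
      · by_cases hq : n = q
        · subst hq
          rw [if_neg hp, if_pos rfl, if_neg (Ne.symm hp)]
          simp [upperSeries, upperMatrix_zero]
        · rw [if_neg hp, if_neg hq, if_neg (Ne.symm hp), if_neg (Ne.symm hq), upperMatrix_zero,
            upperSeries_zero, map_zero]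
    | br x y =>
      rw [matrixRep_hall_br hpq x y hw]
      simp only [reduceCtorEq, if_false]
      by_cases h : LieWord.br x y = .br (.gen p) (.gen q)
      · rw [h]
        simp [upperSeries, upperMatrix_zero, LieWord.order]
      · rw [if_neg h, if_neg (Ne.symm h), upperMatrix_zero, upperSeries_zero, map_zero]
  induction hallBasis.mem_span x using Submodule.span_induction with
  | mem x hx =>
    obtain ⟨h, rfl⟩ := hx
    rw [Module.Basis.repr_self, hallBasis_apply, hword]
    simp only [Finsupp.single_apply, eq_comm]
  | zero => simp [upperSeries_zero]
  | add x y _ _ hx hy =>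
    rw [map_add, map_add, hx, hy, upperSeries_add, map_add]
    rfl
  | smul r x _ hx =>
    rw [map_smul, map_smul, hx, upperSeries_smul, map_smul]
    rfl

theorem coeff_upperSeries_fst (hpq : p < q) (a b c : ℝ) :
    PowerSeries.coeff p (upperSeries p q a b c) 0 1 = a := by
  have := q.pos
  have h : (p : ℕ) < q := hpq
  rw [upperSeries, map_add, map_add, PowerSeries.coeff_monomial, PowerSeries.coeff_monomial,
    PowerSeries.coeff_monomial, if_pos rfl, if_neg h.ne, if_neg (by omega)]
  simp [upperMatrix]

theorem coeff_upperSeries_pair (a b c : ℝ) :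
    PowerSeries.coeff (p + q : ℕ) (upperSeries p q a b c) 0 2 = c := by
  have h₁ := p.pos
  have h₂ := q.pos
  rw [upperSeries, map_add, map_add, PowerSeries.coeff_monomial, PowerSeries.coeff_monomial,
    PowerSeries.coeff_monomial, if_neg (by omega), if_neg (by omega), if_pos rfl]
  simp [upperMatrix]

section Product

variable {s N : ℕ} {f : Fin s → ℕ+ → ℝ} {W : ℕ → FreeLie} (hW : IsCfetExponent N f W)

theorem matrixRep_formalExponent (hpq : p < q) (i : Fin s) :
    coeffScale 1 (matrixRep p q) (formalExponent N f i) =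
      upperSeries p q (if (p : ℕ) ≤ N then f i p else 0) (if (q : ℕ) ≤ N then f i q else 0) 0 := by
  have h (k : ℕ) : PowerSeries.monomial (k + 1) (matrixRep p q (f i k.succPNat •
      FreeAlgebra.ι ℝ k.succPNat)) = (if k = p.natPred then PowerSeries.monomial (p : ℕ)
        (upperMatrix (f i p) 0 0) else 0) +
        if k = q.natPred then PowerSeries.monomial (q : ℕ) (upperMatrix 0 (f i q) 0) else 0 := by
    have hk : ∀ r : ℕ+, k.succPNat = r ↔ k = r.natPred := fun r =>
      ⟨fun h => by rw [← h, Nat.natPred_succPNat], fun h => by rw [h, PNat.succPNat_natPred]⟩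
    rw [map_smul, matrixRep_ι, upperMatrix_smul]
    simp only [hk]
    have hne : p.natPred ≠ q.natPred := fun h => hpq.ne (PNat.natPred_injective h)
    by_cases hp : k = p.natPred
    · rw [if_pos hp, if_neg (by rwa [hp]), if_pos hp, if_neg (by rwa [hp])]
      simp [hp]
    · by_cases hq : k = q.natPred
      · rw [if_neg hp, if_pos hq, if_neg hp, if_pos hq]
        simp [hq]
      · rw [if_neg hp, if_neg hq, if_neg hp, if_neg hq]
        simp [upperMatrix_zero]
  rw [formalExponent, map_sum]
  simp only [coeffScale_monomial, one_pow, one_smul, h]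
  rw [Finset.sum_add_distrib, Finset.sum_ite_eq', Finset.sum_ite_eq', upperSeries]
  have hr : ∀ r : ℕ+, r.natPred ∈ Finset.range N ↔ (r : ℕ) ≤ N := fun r => by
    rw [Finset.mem_range, PNat.natPred]
    have := r.pos
    omega
  simp only [hr]
  split_ifs <;> simp [upperMatrix_zero]

include hW in
theorem matrixRep_exponent (hpq : p < q) :
    EqBelow (N + 1) (coeffScale 1 (matrixRep p q) (gradedAssoc (∑ d ∈ Finset.range (N + 1), W d)))
      (upperSeries p q (∑ i, if (p : ℕ) ≤ N then f i p else 0)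
        (∑ i, if (q : ℕ) ≤ N then f i q else 0)
        ((∑ i, ∑ j ∈ Finset.Ioi i, ((if (p : ℕ) ≤ N then f i p else 0) *
          (if (q : ℕ) ≤ N then f j q else 0) - (if (p : ℕ) ≤ N then f j p else 0) *
          (if (q : ℕ) ≤ N then f i q else 0))) / 2)) := by
  obtain ⟨hW₀, h⟩ := (isCfetExponent_iff N f W).1 hW
  refine ((gradedAssoc_sum_exponent hW).coeffScale _ _).trans ?_
  have h₂ := upperSeries_of_powExp p q (by simpa using hW₀.coeffScale 1 (matrixRep p q))
    (Eq.trans ?_ (prod_powExp_upperSeries p q (fun i => if (p : ℕ) ≤ N then f i p else 0)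
      (fun i => if (q : ℕ) ≤ N then f i q else 0)))
  · rw [h₂]
    exact EqBelow.refl _
  · rw [← coeffScale_powExp, h, map_list_prod, List.map_map, List.map_ofFn, List.map_ofFn]
    congr 2
    ext1 i
    simp only [Function.comp_apply]
    rw [coeffScale_powExp, matrixRep_formalExponent hpq]

include hW in
theorem repr_exponent_gen {n : ℕ+} (hn : (n : ℕ) ≤ N) :
    hallBasis.repr (∑ d ∈ Finset.range (N + 1), W d) (hallGen n) = ∑ i, f i n := by
  -- The representation needs a second generator; `Aₙ₊₁` is an arbitrary companion.
  have hlt : n < n + 1 := PNat.lt_add_right n 1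
  have h := congrFun (congrFun (matrixRep_exponent hW hlt n (by omega)) 0) 1
  rw [matrixRep_hall hlt, coeff_upperSeries_fst hlt, coeff_upperSeries_fst hlt] at h
  simpa only [if_pos hn] using h

include hW in
theorem repr_exponent_pair (hpq : p < q) (hN : (p + q : ℕ) ≤ N) :
    hallBasis.repr (∑ d ∈ Finset.range (N + 1), W d) (hallPair hpq) =
      (∑ i, ∑ j ∈ Finset.Ioi i, (f i p * f j q - f j p * f i q)) / 2 := by
  have h := congrFun (congrFun (matrixRep_exponent hW hpq (p + q) (by omega)) 0) 2
  rw [matrixRep_hall hpq, coeff_upperSeries_pair, coeff_upperSeries_pair] at h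
  simpa only [if_pos (by omega : (p : ℕ) ≤ N), if_pos (by omega : (q : ℕ) ≤ N)] using h

end Product

/-! ### Matrix entries of the flow as iterated integrals -/

section Flow

variable {N : ℕ} {Y : PowerSeries PolyAssoc} (hY : IsFlow N Y)

/-- A matrix entry of the representation. -/
def matrixEntry (p q : ℕ+) (i j : Fin 3) : FreeAssoc →ₗ[ℝ] ℝ :=
  (Matrix.entryLinearMap ℝ ℝ i j) ∘ₗ (matrixRep p q).toLinearMap

theorem matrixEntry_apply (i j : Fin 3) (x : FreeAssoc) :
    matrixEntry p q i j x = matrixRep p q x i j := rfl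

theorem shiftFun_matrixEntry (i j : Fin 3) (k : ℕ) : shiftFun (matrixEntry p q i j) k =
    ![(if k.succPNat = p then 1 else 0 : ℝ) • matrixEntry p q 1 j,
      (if k.succPNat = q then 1 else 0 : ℝ) • matrixEntry p q 2 j, 0] i := by
  ext x
  simp only [shiftFun, LinearMap.comp_apply, LinearMap.mulLeft_apply, matrixEntry_apply, map_mul,
    matrixRep_ι]
  fin_cases i <;> simp [upperMatrix, Matrix.mul_apply, Fin.sum_univ_three] <;> split_ifs <;>
    simp [matrixEntry_apply]

include hY in
theorem IsFlow.eq_primitive {d : ℕ} (hd : d ≤ N) (l : FreeAssoc →ₗ[ℝ] ℝ) :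
    flowFun Y d l = Polynomial.C (if d = 0 then l 1 else 0) +
      polyPrimitive (∑ k ∈ Finset.range d, legendreP k * flowFun Y (d - (k + 1)) (shiftFun l k)) := by
  rw [← hY.derivative hd, polyPrimitive_derivative, hY.eval_zero]
  ring

include hY in
-- Only the letter `A_r` links this entry to another one, so a single summand of the derivative
-- remains.
theorem IsFlow.matrixEntry_step {r : ℕ+} {d : ℕ} (hd : r + d ≤ N) {i j : Fin 3}
    {l : FreeAssoc →ₗ[ℝ] ℝ} (hl : ∀ k : ℕ, shiftFun (matrixEntry p q i j) k =
      (if k.succPNat = r then 1 else 0 : ℝ) • l) :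
    flowFun Y (r + d) (matrixEntry p q i j) =
      polyPrimitive (legendreP r.natPred * flowFun Y d l) := by
  have hr := r.natPred_add_one
  rw [hY.eq_primitive hd, if_neg (by have := r.pos; omega), map_zero, zero_add,
    Finset.sum_eq_single_of_mem r.natPred (Finset.mem_range.2 (by omega))]
  · rw [hl, if_pos (PNat.succPNat_natPred r), one_smul, hr, Nat.add_sub_cancel_left]
  · intro k _ hk
    rw [hl, if_neg (fun h => hk (by rw [← h, Nat.natPred_succPNat])), zero_smul, flowFun,
      pairing_zero, mul_zero]

include hY in
theorem IsFlow.matrixEntry_zero (i : Fin 3) : flowFun Y 0 (matrixEntry p q i i) = 1 := by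
  rw [hY.eq_primitive (Nat.zero_le _)]
  simp [matrixEntry_apply]

include hY in
theorem IsFlow.matrixEntry_fst (hN : (p : ℕ) ≤ N) :
    flowFun Y p (matrixEntry p q 0 1) = polyPrimitive (legendreP p.natPred) := by
  have h := hY.matrixEntry_step (p := p) (q := q) (d := 0) hN (fun k => shiftFun_matrixEntry 0 1 k)
  rwa [hY.matrixEntry_zero, mul_one] at h

include hY in
theorem IsFlow.matrixEntry_pair (hN : (p + q : ℕ) ≤ N) : flowFun Y (p + q) (matrixEntry p q 0 2) =
    polyPrimitive (legendreP p.natPred * polyPrimitive (legendreP q.natPred)) := by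
  have h := hY.matrixEntry_step (p := p) (q := q) (d := 0) (by omega)
    (fun k => shiftFun_matrixEntry 1 2 k)
  rw [hY.matrixEntry_zero, mul_one, add_zero] at h
  rw [hY.matrixEntry_step hN (fun k => shiftFun_matrixEntry 0 2 k), h]

end Flow

section Magnus

variable {N : ℕ}

theorem coeff_powExp_matrixRep (hpq : p < q) (x : FreeLie) (d : ℕ) (i j : Fin 3) :
    matrixEntry p q i j (PowerSeries.coeff d (powExp (gradedAssoc x))) = (PowerSeries.coeff d
      (1 + upperSeries p q (hallBasis.repr x (hallGen p)) (hallBasis.repr x (hallGen q))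
      (hallBasis.repr x (hallPair hpq) +
        hallBasis.repr x (hallGen p) * hallBasis.repr x (hallGen q) / 2)) :
          Matrix (Fin 3) (Fin 3) ℝ) i j := by
  rw [← powExp_upperSeries, ← matrixRep_hall hpq, ← coeffScale_powExp, coeff_coeffScale, one_pow,
    one_smul, matrixEntry_apply]

theorem polyIntegral_legendreP (k : ℕ) : polyIntegral (legendreP k) = if k = 0 then 1 else 0 := by
  split_ifs with h
  · subst h
    have := polyIntegral_legendreP_sq 0
    simpa [legendreP] using this
  · have := polyIntegral_mul_legendreP_of_natDegree_lt (n := k) (q := 1) (by simp; omega)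
    simpa using this

theorem repr_magnusLie_gen {n : ℕ+} (hn : (n : ℕ) ≤ N) :
    hallBasis.repr (magnusLie N) (hallGen n) = if n = 1 then 1 else 0 := by
  obtain ⟨Y, h, h₀, h₁⟩ := exists_flow N
  have hY : IsFlow N Y := ⟨h, h₀⟩
  have hlt : n < n + 1 := PNat.lt_add_right n 1
  have h₂ := eval_one_flowFun Y n (matrixEntry n (n + 1) 0 1)
  rw [h₁, coeff_powExp_matrixRep hlt, hY.matrixEntry_fst hn, map_add, Matrix.add_apply,
    coeff_upperSeries_fst hlt, PowerSeries.coeff_one, if_neg n.ne_zero, Matrix.zero_apply,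
    zero_add] at h₂
  rw [← h₂]
  refine (polyIntegral_legendreP n.natPred).trans ?_
  have : n.natPred = 0 ↔ n = 1 := by
    rw [← PNat.natPred_inj]; rfl
  simp only [this]

/-- The corner entry of `exp Ω` is `∫₀¹ P₀ ∫₀ˣ P₁ = ∫₀¹ (x² - x) dx = -1/6`. It equals the
coordinate of `[A₁, A₂]` because the correction `ab/2` contains the coordinate of `A₂`, which is
`0`. The `-1/3` of the order condition arises by doubling. -/
theorem repr_magnusLie_pair (hN : 3 ≤ N) :
    hallBasis.repr (magnusLie N) hallA₁A₂ = -(1 / 6) := by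
  obtain ⟨Y, h, h₀, h₁⟩ := exists_flow N
  have hY : IsFlow N Y := ⟨h, h₀⟩
  have hlt : (1 : ℕ+) < 2 := by decide
  have h₂ := eval_one_flowFun Y ((1 : ℕ+) + (2 : ℕ+)) (matrixEntry 1 2 0 2)
  rw [h₁, coeff_powExp_matrixRep hlt, hY.matrixEntry_pair (by simpa using hN), map_add,
    Matrix.add_apply, coeff_upperSeries_pair, PowerSeries.coeff_one, if_neg (by simp),
    Matrix.zero_apply, zero_add, repr_magnusLie_gen (n := 2) (by simp; omega), if_neg (by decide),
    mul_zero, zero_div, add_zero] at h₂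
  refine h₂.symm.trans ?_
  have h₃ : polyPrimitive (legendreP 1) = Polynomial.X ^ 2 - Polynomial.X := by
    have : Polynomial.derivative (Polynomial.X ^ 2 - Polynomial.X : Polynomial ℝ) = legendreP 1 := by
      simp [legendreP, one_add_one_eq_two]
      rfl
    rw [← this, polyPrimitive_derivative]
    simp
  have h₄ : Polynomial.derivative (Polynomial.C (1 / 3 : ℝ) * Polynomial.X ^ 3 -
      Polynomial.C (1 / 2 : ℝ) * Polynomial.X ^ 2) = Polynomial.X ^ 2 - Polynomial.X := by
    simp only [Polynomial.derivative_sub, Polynomial.derivative_C_mul, Polynomial.derivative_X_pow,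
      ← mul_assoc, ← Polynomial.C_mul]
    norm_num
  change (polyPrimitive (1 * polyPrimitive (legendreP 1))).eval 1 = _
  rw [one_mul, h₃, ← h₄, polyPrimitive_derivative]
  norm_num

end Magnus

section Conditions

variable {s N : ℕ} {f : Fin s → ℕ+ → ℝ} {W : ℕ → FreeLie} (hW : IsCfetExponent N f W)

include hW in
theorem orderCondition_hallGen {n : ℕ+} (hn : (n : ℕ) ≤ N) :
    OrderCondition hallBasis N W (hallGen n) ↔ ∑ i, f i n = if n = 1 then 1 else 0 := by
  rw [OrderCondition, repr_exponent_gen hW hn, repr_magnusLie_gen hn]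

include hW in
theorem orderCondition_hallA₁A₂ (hN : 3 ≤ N) : OrderCondition hallBasis N W hallA₁A₂ ↔
    ∑ i, ∑ j ∈ Finset.Ioi i, (f i 1 * f j 2 - f j 1 * f i 2) = -(1 / 3) := by
  have h := repr_exponent_pair hW (p := 1) (q := 2) (by decide) (by simpa using hN)
  rw [OrderCondition, repr_magnusLie_pair hN]
  refine (Eq.congr_left h).trans ⟨fun h => ?_, fun h => ?_⟩ <;> linarith

end Conditions

end LowOrder

/-! ### Convergence of the Magnus expansion -/

section Majorant

/-- The majorant `2ⁿ⁻¹ Cₙ₋₁` of the terms of the Magnus expansion, with the Catalan numbers `C`. -/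
def majorant (n : ℕ) : ℝ := 2 ^ (n - 1) * catalan (n - 1)

theorem majorant_nonneg (n : ℕ) : 0 ≤ majorant n := by unfold majorant; positivity

theorem catalan_le (n : ℕ) : catalan n ≤ 4 ^ n := by
  rw [catalan_eq_centralBinom_div]
  exact (Nat.div_le_self _ _).trans (Nat.centralBinom_le_four_pow n)

theorem majorant_le (n : ℕ) : majorant n ≤ 8 ^ n := by
  have h : (catalan (n - 1) : ℝ) ≤ 4 ^ (n - 1) := by exact_mod_cast catalan_le _
  calc majorant n ≤ 2 ^ (n - 1) * 4 ^ (n - 1) := by unfold majorant; gcongr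
    _ = 8 ^ (n - 1) := by rw [← mul_pow]; norm_num
    _ ≤ 8 ^ n := pow_le_pow_right₀ (by norm_num) (Nat.sub_le n 1)

/-- This is the Catalan recursion; the powers of two in `majorant` are there to produce the factor
`2` on the left. -/
theorem majorant_convolution {n : ℕ} (hn : 2 ≤ n) :
    2 * ∑ j ∈ Finset.Ico 1 n, majorant j * majorant (n - j) = majorant n := by
  obtain ⟨k, rfl⟩ : ∃ k, n = k + 2 := ⟨n - 2, by omega⟩
  rw [Finset.sum_Ico_eq_sum_range, majorant, show k + 2 - 1 = k + 1 by omega, catalan_succ,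
    Finset.sum_range, Nat.cast_sum, Finset.mul_sum, Finset.mul_sum]
  refine Finset.sum_congr rfl fun i _ => ?_
  have hi : (i : ℕ) ≤ k := by have := i.2; omega
  obtain ⟨m, hm⟩ := Nat.exists_eq_add_of_le hi
  rw [majorant, majorant, Nat.add_sub_cancel_left, show k + 2 - (1 + (i : ℕ)) - 1 = m by omega,
    show k - (i : ℕ) = m by omega, Nat.cast_mul]
  have h : (2 : ℝ) ^ (k + 1) = 2 * (2 ^ (i : ℕ) * 2 ^ m) := by rw [← pow_add, ← hm, pow_succ']
  rw [h]
  ring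

/-- The nested sums of the majorant. -/
def majorantSum : ℕ → ℕ → ℝ
  | 0, n => majorant n
  | m + 1, n => ∑ j ∈ Finset.Ico 1 n, majorant j * majorantSum m (n - j)

theorem majorantSum_nonneg (m : ℕ) : ∀ n, 0 ≤ majorantSum m n := by
  induction m with
  | zero => exact majorant_nonneg
  | succ m ih => exact fun n => Finset.sum_nonneg fun j _ => mul_nonneg (majorant_nonneg _) (ih _)

/-- The nests of positive depth add up to at most `2 ∑ majorant j * majorant (n - j)`, which is
`majorant n` by the convolution identity; depth zero gives the other `majorant n`. -/
theorem sum_majorantSum_le (M : ℕ) : ∀ n, 1 ≤ n →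
    ∑ m ∈ Finset.range M, majorantSum m n ≤ 2 * majorant n := by
  induction M with
  | zero => intro n _; simpa using majorant_nonneg n
  | succ M ih =>
    intro n hn
    rw [Finset.sum_range_succ']
    simp only [majorantSum]
    rw [Finset.sum_comm]
    have h : ∑ j ∈ Finset.Ico 1 n, ∑ m ∈ Finset.range M, majorant j * majorantSum m (n - j) ≤
        2 * ∑ j ∈ Finset.Ico 1 n, majorant j * majorant (n - j) := by
      rw [Finset.mul_sum]
      refine Finset.sum_le_sum fun j hj => ?_
      rw [Finset.mem_Ico] at hj
      rw [← Finset.mul_sum]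
      calc _ ≤ majorant j * (2 * majorant (n - j)) :=
            mul_le_mul_of_nonneg_left (ih _ (by omega)) (majorant_nonneg j)
        _ = _ := by ring
    rcases Nat.lt_or_ge n 2 with h₂ | h₂
    · obtain rfl : n = 1 := by omega
      simpa [two_mul] using majorant_nonneg 1
    · rw [majorant_convolution h₂] at h
      linarith

theorem sum_majorantSum_Icc_le {n : ℕ} (hn : 2 ≤ n) :
    ∑ m ∈ Finset.Icc 1 (n - 1), majorantSum m n ≤ majorant n := by
  have h := sum_majorantSum_le n n (by omega)
  have h₁ : Finset.Icc 1 (n - 1) = Finset.Ico 1 n := by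
    ext; simp only [Finset.mem_Icc, Finset.mem_Ico]; omega
  rw [Finset.range_eq_Ico, Finset.sum_eq_sum_Ico_succ_bot (by omega), majorantSum] at h
  rw [h₁]
  linarith

end Majorant

section Convergence

variable {𝔸 : Type*} [NormedRing 𝔸] [NormedAlgebra ℝ 𝔸] {A : ℝ → 𝔸} {K r : ℝ}

/-- The integration `∫₀ᵗ`. -/
def primitiveFun (F : ℝ → 𝔸) (u : ℝ) : 𝔸 := ∫ v in (0 : ℝ)..u, F v

omit [NormedAlgebra ℝ 𝔸] in
theorem norm_commutator_le (x y : 𝔸) : ‖x * y - y * x‖ ≤ 2 * (‖x‖ * ‖y‖) := by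
  have h₁ := norm_sub_le (x * y) (y * x)
  have h₂ := norm_mul_le x y
  have h₃ := norm_mul_le y x
  nlinarith

omit [NormedAlgebra ℝ 𝔸] in
-- Each commutator costs a factor `2`. The extra factor `e`, later `r⁻¹`, belongs to the innermost
-- entry, which has not been integrated.
theorem norm_nestedSum_le {W D : ℕ → ℝ → 𝔸} {u c e : ℝ} (hc : 0 ≤ c) {n : ℕ}
    (hW : ∀ j < n, 1 ≤ j → ‖W j u‖ ≤ majorant j * c ^ j)
    (hD : ∀ j < n, 1 ≤ j → ‖D j u‖ ≤ majorant j * c ^ j * e) (m : ℕ) :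
    (∀ k < n, 1 ≤ k → ‖nestedSum W D m k u‖ ≤ 2 ^ m * majorantSum m k * c ^ k * e) ∧
      ‖nestedSum W D (m + 1) n u‖ ≤ 2 ^ (m + 1) * majorantSum (m + 1) n * c ^ n * e := by
  have step : ∀ m,
      (∀ k < n, 1 ≤ k → ‖nestedSum W D m k u‖ ≤ 2 ^ m * majorantSum m k * c ^ k * e) →
      ∀ k ≤ n, ‖nestedSum W D (m + 1) k u‖ ≤ 2 ^ (m + 1) * majorantSum (m + 1) k * c ^ k * e := by
    intro m h k hk
    rw [nestedSum, Finset.sum_apply, majorantSum, Finset.mul_sum, Finset.sum_mul, Finset.sum_mul]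
    refine norm_sum_le_of_le _ fun j hj => ?_
    rw [Finset.mem_Ico] at hj
    have h₁ := hW j (by omega) hj.1
    have h₂ := h (k - j) (by omega) (by omega)
    have h₃ := majorantSum_nonneg m (k - j)
    rw [Ring.lie_def]
    calc _ ≤ 2 * (‖W j u‖ * ‖nestedSum W D m (k - j) u‖) := norm_commutator_le _ _
      _ ≤ 2 * (majorant j * c ^ j * (2 ^ m * majorantSum m (k - j) * c ^ (k - j) * e)) := by
          have := majorant_nonneg j
          gcongr
      _ = 2 ^ (m + 1) * (majorant j * majorantSum m (k - j)) * (c ^ j * c ^ (k - j)) * e := by ring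
      _ = _ := by rw [← pow_add, Nat.add_sub_cancel' hj.2.le]
  have h : ∀ k < n, 1 ≤ k → ‖nestedSum W D m k u‖ ≤ 2 ^ m * majorantSum m k * c ^ k * e := by
    induction m with
    | zero => simpa [nestedSum, majorantSum] using hD
    | succ m ih => exact fun k hk _ => step m ih k hk.le
  exact ⟨h, step m h n le_rfl⟩

theorem two_pow_le_factorial (m : ℕ) : (2 : ℝ) ^ m ≤ (m + 1).factorial := by
  exact_mod_cast (show 2 ^ m ≤ (m + 1).factorial by
    induction m with
    | zero => simp
    | succ m ih => rw [pow_succ, Nat.factorial_succ, mul_comm]; gcongr; omega)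

/-- The factor `2 ^ m` from the commutators is absorbed by `(m + 1)!`, and the remaining sum over
depths reproduces the majorant. Integration over a length at most `r` cancels `r⁻¹`. -/
theorem norm_magnusDot_le (hK : ∀ u, |u| ≤ r → ‖A u‖ ≤ K) (hr : 0 < r) {n : ℕ} (hn : 1 ≤ n) :
    ∀ u, |u| ≤ r → ‖magnusDot primitiveFun A n u‖ ≤ majorant n * (K * r) ^ n * r⁻¹ ∧
      ‖magnusTerm primitiveFun A n u‖ ≤ majorant n * (K * r) ^ n := by
  have hK₀ : 0 ≤ K := (norm_nonneg _).trans (hK 0 (by simpa using hr.le))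
  induction n using Nat.strong_induction_on with
  | _ n ih =>
    have hd : ∀ u, |u| ≤ r → ‖magnusDot primitiveFun A n u‖ ≤ majorant n * (K * r) ^ n * r⁻¹ := by
      intro u hu
      rcases Nat.lt_or_ge n 2 with h₂ | h₂
      · obtain rfl : n = 1 := by omega
        have := hK u hu
        simpa [magnusDot, majorant, mul_assoc, hr.ne'] using this
      · rw [magnusDot_eq _ _ h₂, Pi.neg_apply, norm_neg, Finset.sum_apply]
        have h₁ : ∀ m ∈ Finset.Icc 1 (n - 1), ‖((((m + 1).factorial : ℝ)⁻¹) •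
            nestedSum (fun j => magnusTerm primitiveFun A j) (fun k => magnusDot primitiveFun A k)
              m n) u‖ ≤ majorantSum m n * ((K * r) ^ n * r⁻¹) := by
          intro m hm
          rw [Finset.mem_Icc] at hm
          obtain ⟨m, rfl⟩ : ∃ k, m = k + 1 := ⟨m - 1, by omega⟩
          have h₃ := (norm_nestedSum_le (by positivity)
            (fun j hj hj' => (ih j hj hj' u hu).2) (fun j hj hj' => (ih j hj hj' u hu).1) m).2
          rw [Pi.smul_apply, norm_smul, Real.norm_of_nonneg (by positivity)]
          have h₄ := two_pow_le_factorial (m + 1)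
          have h₅ := majorantSum_nonneg (m + 1) n
          rw [inv_mul_le_iff₀ (by positivity)]
          refine h₃.trans ?_
          rw [mul_assoc, mul_assoc]
          gcongr
        refine (norm_sum_le_of_le _ h₁).trans ?_
        rw [← Finset.sum_mul, mul_assoc]
        gcongr
        exact sum_majorantSum_Icc_le h₂
    refine fun u hu => ⟨hd u hu, ?_⟩
    have h₁ := intervalIntegral.norm_integral_le_of_norm_le_const (a := 0) (b := u)
      (f := magnusDot primitiveFun A n) (C := majorant n * (K * r) ^ n * r⁻¹) fun v hv => by
        refine hd v (le_trans ?_ hu)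
        rw [Set.mem_uIoc] at hv
        rcases hv with hv | hv
        · rw [abs_of_pos hv.1, abs_of_nonneg (hv.1.le.trans hv.2)]; exact hv.2
        · rw [abs_of_nonpos hv.2, abs_of_neg (hv.1.trans_le hv.2)]; linarith
    have h₂ := majorant_nonneg n
    calc _ ≤ _ := h₁
      _ ≤ majorant n * (K * r) ^ n * r⁻¹ * r := by rw [sub_zero]; gcongr
      _ = _ := by rw [inv_mul_cancel_right₀ hr.ne']

/-- The radius is chosen as `r = |t|` to obtain powers of `t`; since `r` must be positive, `t = 0`
is separate. -/
theorem norm_magnusFun_le {ρ : ℝ} (hK : ∀ u, |u| ≤ ρ → ‖A u‖ ≤ K) {t : ℝ} (ht : |t| ≤ ρ) {n : ℕ}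
    (hn : 1 ≤ n) : ‖magnusFun A n t‖ ≤ (8 * K * |t|) ^ n := by
  rcases eq_or_ne t 0 with rfl | h₀
  · simp [magnusFun, magnusTerm]
  · have hK₀ : 0 ≤ K := (norm_nonneg _).trans (hK t ht)
    refine ((norm_magnusDot_le (fun u hu => hK u (hu.trans ht)) (abs_pos.2 h₀) hn t le_rfl).2).trans
      ?_
    rw [mul_assoc 8, mul_pow 8]
    gcongr
    exact majorant_le n

theorem magnusFun_summable_tail [CompleteSpace 𝔸] (hA : ContinuousAt A 0) (N : ℕ) :
    (∀ᶠ t in 𝓝 (0 : ℝ), Summable fun n : ℕ => magnusFun A (n + 1) t) ∧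
    (fun t => ∑' n : ℕ, magnusFun A (n + 1) t - ∑ n ∈ Finset.Icc 1 N, magnusFun A n t)
      =O[𝓝 0] fun t => t ^ (N + 1) := by
  obtain ⟨ρ, hρ, hK⟩ : ∃ ρ > 0, ∀ u, |u| ≤ ρ → ‖A u‖ ≤ ‖A 0‖ + 1 := by
    have h := hA.norm.eventually_le_const (lt_add_one ‖A 0‖)
    obtain ⟨ρ, hρ, h⟩ := Metric.nhds_basis_closedBall.eventually_iff.1 h
    exact ⟨ρ, hρ, fun u hu => h (by simpa using hu)⟩
  set K := ‖A 0‖ + 1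
  have hK₀ : 0 < K := by positivity
  have hsmall : ∀ᶠ t in 𝓝 (0 : ℝ), |t| ≤ ρ ∧ 8 * K * |t| ≤ 1 / 2 := by
    have h : Tendsto (fun t : ℝ => |t|) (𝓝 0) (𝓝 0) := by
      simpa using (continuous_abs (G := ℝ)).tendsto 0
    refine (h.eventually_le_const hρ).and ?_
    have h₁ := h.const_mul (8 * K)
    rw [mul_zero] at h₁
    exact h₁.eventually_le_const (by norm_num)
  have hsum : ∀ t, |t| ≤ ρ ∧ 8 * K * |t| ≤ 1 / 2 → ∀ M, HasSum
      (fun n : ℕ => (8 * K * |t|) ^ (n + M)) ((1 - 8 * K * |t|)⁻¹ * (8 * K * |t|) ^ M) := by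
    intro t ht M
    simp only [pow_add]
    exact (hasSum_geometric_of_lt_one (by positivity) (by linarith [ht.2])).mul_right _
  have hs : ∀ t, |t| ≤ ρ ∧ 8 * K * |t| ≤ 1 / 2 → Summable fun n : ℕ => magnusFun A (n + 1) t :=
    fun t ht => Summable.of_norm_bounded (hsum t ht 1).summable
      fun n => norm_magnusFun_le hK ht.1 (by omega)
  refine ⟨hsmall.mono hs, ?_⟩
  refine Asymptotics.IsBigO.of_bound (2 * (8 * K) ^ (N + 1)) (hsmall.mono fun t ht => ?_)
  have h₁ : ∑ n ∈ Finset.Icc 1 N, magnusFun A n t = ∑ n ∈ Finset.range N, magnusFun A (n + 1) t := by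
    rw [← Finset.Ico_succ_right_eq_Icc, Finset.sum_Ico_eq_sum_range]
    exact Finset.sum_congr rfl fun n _ => by rw [add_comm]
  rw [h₁, ← (hs t ht).sum_add_tsum_nat_add N, add_sub_cancel_left]
  refine (tsum_of_norm_bounded (hsum t ht (N + 1)) fun n => ?_).trans ?_
  · rw [add_assoc]
    exact norm_magnusFun_le hK ht.1 (by omega)
  · rw [mul_pow, norm_pow, Real.norm_eq_abs, mul_assoc 2]
    gcongr
    rw [inv_le_comm₀ (by linarith [ht.2]) two_pos]
    linarith [ht.2]

end Convergence

/-! ### The Legendre expansion of an analytic coefficient -/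

section Legendre

open Asymptotics

variable {𝔸 : Type*} [NormedRing 𝔸] [NormedAlgebra ℝ 𝔸] {A : ℝ → 𝔸}

/-- The filter for `(δt, x)` with `δt → 0`, uniformly in `0 ≤ x ≤ 1`. -/
def unifFilter : Filter (ℝ × ℝ) := 𝓝 0 ×ˢ 𝓟 (Set.Icc 0 1)

theorem eventually_unifFilter {P : ℝ × ℝ → Prop} :
    (∀ᶠ p in unifFilter, P p) ↔ ∀ᶠ δ in 𝓝 (0 : ℝ), ∀ x ∈ Set.Icc (0 : ℝ) 1, P (δ, x) :=
  eventually_prod_principal_iff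

theorem eventually_mem_unifFilter : ∀ᶠ p in unifFilter, p.2 ∈ Set.Icc (0 : ℝ) 1 :=
  eventually_unifFilter.2 (Eventually.of_forall fun _ _ hx => hx)

theorem tendsto_fst_unifFilter : Tendsto (fun p : ℝ × ℝ => p.1) unifFilter (𝓝 0) := tendsto_fst

theorem abs_snd_le {x : ℝ} (hx : x ∈ Set.Icc (0 : ℝ) 1) : |x| ≤ 1 :=
  abs_le.2 ⟨by linarith [hx.1], hx.2⟩

theorem snd_mul_fst_isBigO : (fun p : ℝ × ℝ => p.2 * p.1) =O[unifFilter] fun p => p.1 := by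
  refine IsBigO.of_bound 1 (eventually_mem_unifFilter.mono fun p hp => ?_)
  rw [norm_mul]
  exact mul_le_mul_of_nonneg_right (abs_snd_le hp) (norm_nonneg _)

theorem tendsto_mul_unifFilter : Tendsto (fun p : ℝ × ℝ => p.2 * p.1) unifFilter (𝓝 0) :=
  snd_mul_fst_isBigO.trans_tendsto tendsto_fst_unifFilter

theorem eval_isBigO_one (q : Polynomial ℝ) :
    (fun p : ℝ × ℝ => q.eval p.2) =O[unifFilter] fun _ => (1 : ℝ) := by
  obtain ⟨C, hC⟩ := (isCompact_Icc (a := (0 : ℝ)) (b := 1)).exists_bound_of_continuousOn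
    q.continuous.continuousOn
  exact IsBigO.of_bound C (eventually_mem_unifFilter.mono fun p hp => by simpa using hC _ hp)

/-- A bound for an integrand that is uniform on `[0, 1]` is a bound for the integral. -/
theorem integral_isBigO {E : ℝ × ℝ → 𝔸} {n : ℕ} (hE : E =O[unifFilter] fun p => p.1 ^ n) :
    (fun p : ℝ × ℝ => ∫ y in (0 : ℝ)..p.2, E (p.1, y)) =O[unifFilter] fun p => p.1 ^ n := by
  obtain ⟨C, hC, h⟩ := hE.exists_nonneg
  rw [IsBigOWith, eventually_unifFilter] at h
  refine IsBigO.of_bound C (eventually_unifFilter.2 (h.mono fun δ hδ x hx => ?_))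
  refine (intervalIntegral.norm_integral_le_of_norm_le_const (C := C * ‖δ ^ n‖) fun y hy => ?_).trans
    (mul_le_of_le_one_right (by positivity) (by rw [sub_zero]; exact abs_snd_le hx))
  rw [Set.uIoc_of_le hx.1] at hy
  exact hδ y ⟨hy.1.le, hy.2.trans hx.2⟩

omit [NormedAlgebra ℝ 𝔸] in
theorem IsBigO.at_one {E : ℝ × ℝ → 𝔸} {g : ℝ → ℝ} (hE : E =O[unifFilter] fun p => g p.1) :
    (fun δ => E (δ, 1)) =O[𝓝 0] g := by
  have : Tendsto (fun δ : ℝ => (δ, (1 : ℝ))) (𝓝 0) unifFilter :=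
    tendsto_id.prodMk (tendsto_principal.2 (Eventually.of_forall fun _ => by simp))
  exact hE.comp_tendsto this

omit [NormedAlgebra ℝ 𝔸] in
theorem fst_isBigO_of {g : ℝ → 𝔸} {n : ℕ} (hg : g =O[𝓝 0] fun δ => δ ^ n) :
    (fun p : ℝ × ℝ => g p.1) =O[unifFilter] fun p => p.1 ^ n :=
  hg.comp_tendsto tendsto_fst_unifFilter

theorem exists_taylor (hA : AnalyticAt ℝ A 0) : ∃ c : ℕ → 𝔸, ∀ M : ℕ,
    (fun t => A t - ∑ j ∈ Finset.range M, t ^ j • c j) =O[𝓝 0] fun t => t ^ M := by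
  obtain ⟨q, hq⟩ := hA
  refine ⟨q.coeff, fun M => ?_⟩
  have h := hq.isBigO_sub_partialSum_pow M
  simp only [zero_add, FormalMultilinearSeries.partialSum,
    FormalMultilinearSeries.apply_eq_pow_smul_coeff] at h
  refine h.trans (IsBigO.of_bound 1 (Eventually.of_forall fun t => by simp))

theorem taylor_comp {c : ℕ → 𝔸} {M : ℕ}
    (hc : (fun t => A t - ∑ j ∈ Finset.range M, t ^ j • c j) =O[𝓝 0] fun t => t ^ M) :
    (fun p : ℝ × ℝ => A (p.2 * p.1) - ∑ j ∈ Finset.range M, (p.2 * p.1) ^ j • c j)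
      =O[unifFilter] fun p => p.1 ^ M :=
  (hc.comp_tendsto tendsto_mul_unifFilter).trans (snd_mul_fst_isBigO.pow M)

omit [NormedAlgebra ℝ 𝔸] in
theorem eventually_continuous_comp (hA : ∀ᶠ t in 𝓝 0, ContinuousAt A t) :
    ∀ᶠ δ in 𝓝 (0 : ℝ), ContinuousOn (fun x => A (x * δ)) (Set.Icc 0 1) := by
  have h := eventually_unifFilter.1 (tendsto_mul_unifFilter.eventually hA)
  refine h.mono fun δ hδ x hx => ?_
  have h₁ : ContinuousAt A (x * δ) := hδ x hx
  exact (h₁.comp (f := fun x : ℝ => x * δ) (by fun_prop)).continuousWithinAt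

variable [CompleteSpace 𝔸]

theorem legendreCoeff_sub_isBigO (hA : ∀ᶠ t in 𝓝 0, ContinuousAt A t) {c : ℕ → 𝔸} {M : ℕ}
    (hc : (fun t => A t - ∑ j ∈ Finset.range M, t ^ j • c j) =O[𝓝 0] fun t => t ^ M) (k : ℕ) :
    (fun δ => legendreCoeff A δ k.succPNat - ∑ j ∈ Finset.range M,
      ((2 * k + 1) * polyIntegral (Polynomial.X ^ j * legendreP k)) • δ ^ (j + 1) • c j)
      =O[𝓝 0] fun δ => δ ^ (M + 1) := by
  have h₁ : (fun p : ℝ × ℝ => (legendreP k).eval p.2 •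
      (A (p.2 * p.1) - ∑ j ∈ Finset.range M, (p.2 * p.1) ^ j • c j))
      =O[unifFilter] fun p => p.1 ^ M := by
    simpa only [smul_eq_mul, one_mul] using (eval_isBigO_one (legendreP k)).smul (taylor_comp hc)
  have h₂ := (IsBigO.at_one (g := fun δ => δ ^ M) (integral_isBigO h₁))
  have h₃ := ((isBigO_refl (fun δ : ℝ => (2 * k + 1) * δ) (𝓝 0)).smul h₂)
  refine (h₃.congr' ?_ (Eventually.of_forall fun _ => rfl)).trans
    (IsBigO.of_bound (2 * k + 1) (Eventually.of_forall fun δ => ?_))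
  · filter_upwards [eventually_continuous_comp hA] with δ hδ
    have hi : IntervalIntegrable (fun x => (legendreP k).eval x • A (x * δ)) MeasureTheory.volume
        0 1 := by
      refine ContinuousOn.intervalIntegrable ?_
      rw [Set.uIcc_of_le zero_le_one]
      exact (legendreP k).continuous.continuousOn.smul hδ
    have hj : ∀ j : ℕ, IntervalIntegrable (fun x : ℝ => (Polynomial.X ^ j * legendreP k).eval x •
        δ ^ j • c j) MeasureTheory.volume 0 1 := fun j =>
      (((Polynomial.X ^ j * legendreP k).continuous).smul continuous_const).intervalIntegrable _ _
    have h₄ : ∀ x : ℝ, (legendreP k).eval x •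
        (A (x * δ) - ∑ j ∈ Finset.range M, (x * δ) ^ j • c j) =
        (legendreP k).eval x • A (x * δ) - ∑ j ∈ Finset.range M,
          (Polynomial.X ^ j * legendreP k).eval x • δ ^ j • c j := by
      intro x
      rw [smul_sub, Finset.smul_sum]
      congr 1
      refine Finset.sum_congr rfl fun j _ => ?_
      rw [smul_smul, smul_smul, Polynomial.eval_mul, Polynomial.eval_pow, Polynomial.eval_X]
      congr 1
      ring
    simp only [h₄]
    rw [intervalIntegral.integral_sub hi ((continuous_finsetSum _ fun j _ =>
        ((Polynomial.X ^ j * legendreP k).continuous).smul continuous_const).intervalIntegrable _ _),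
      intervalIntegral.integral_finsetSum fun j _ => hj j, smul_sub, legendreCoeff,
      Finset.smul_sum, Nat.natPred_succPNat, Nat.succPNat_coe]
    congr 1
    · congr 1
      push_cast
      ring
    · refine Finset.sum_congr rfl fun j _ => ?_
      rw [intervalIntegral.integral_smul_const, polyIntegral_eq, smul_smul, smul_smul, smul_smul]
      congr 1
      ring
  · rw [smul_eq_mul, mul_assoc, ← pow_succ', norm_mul]
    refine mul_le_mul_of_nonneg_right ?_ (norm_nonneg _)
    rw [Real.norm_of_nonneg (by positivity)]

theorem eventually_continuousAt_of_analyticAt (hA : AnalyticAt ℝ A 0) :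
    ∀ᶠ t in 𝓝 0, ContinuousAt A t := hA.eventually_analyticAt.mono fun _ h => h.continuousAt

/-- `Pₙ₋₁` is orthogonal to the Taylor polynomial of degree below `n - 1`. The remainder has order
`n - 1`, and the prefactor `δt` adds one. -/
theorem legendreCoeff_isBigO (hA : AnalyticAt ℝ A 0) (n : ℕ+) :
    (fun δ => legendreCoeff A δ n) =O[𝓝 0] fun δ => δ ^ (n : ℕ) := by
  obtain ⟨c, hc⟩ := exists_taylor hA
  have h := legendreCoeff_sub_isBigO (eventually_continuousAt_of_analyticAt hA) (hc n.natPred) n.natPred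
  rw [PNat.succPNat_natPred, PNat.natPred_add_one] at h
  refine h.congr_left fun δ => ?_
  rw [Finset.sum_eq_zero, sub_zero]
  intro j hj
  rw [polyIntegral_mul_legendreP_of_natDegree_lt (by simpa using hj), mul_zero, zero_smul]

/-- The Legendre expansion of `A` up to order `N`, uniformly on `[0, δt]`. -/
theorem legendre_expansion_isBigO (hA : AnalyticAt ℝ A 0) (N : ℕ) :
    (fun p : ℝ × ℝ => p.1 • A (p.2 * p.1) - ∑ k ∈ Finset.range N,
      (legendreP k).eval p.2 • legendreCoeff A p.1 k.succPNat)
      =O[unifFilter] fun p => p.1 ^ (N + 1) := by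
  obtain ⟨c, hc⟩ := exists_taylor hA
  set a : ℕ → ℝ → 𝔸 := fun k δ => ∑ j ∈ Finset.range N,
      ((2 * k + 1) * polyIntegral (Polynomial.X ^ j * legendreP k)) • δ ^ (j + 1) • c j with ha
  have h₁ : (fun p : ℝ × ℝ => p.1 • (A (p.2 * p.1) - ∑ j ∈ Finset.range N, (p.2 * p.1) ^ j • c j))
      =O[unifFilter] fun p => p.1 ^ (N + 1) := by
    simpa only [smul_eq_mul, pow_succ'] using
      (isBigO_refl (fun p : ℝ × ℝ => p.1) unifFilter).smul (taylor_comp (hc N))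
  have h₂ : (fun p : ℝ × ℝ => ∑ k ∈ Finset.range N,
      (legendreP k).eval p.2 • (legendreCoeff A p.1 k.succPNat - a k p.1))
      =O[unifFilter] fun p => p.1 ^ (N + 1) := by
    refine IsBigO.fun_sum fun k _ => ?_
    simpa only [smul_eq_mul, one_mul] using (eval_isBigO_one (legendreP k)).smul
      (fst_isBigO_of (legendreCoeff_sub_isBigO (eventually_continuousAt_of_analyticAt hA) (hc N) k))
  refine (h₁.sub h₂).congr_left fun p => ?_
  -- Monomials of degree below `N` equal their Legendre expansions, so the Taylor polynomials cancel
  -- and only remainders are left.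
  have h₃ : ∑ k ∈ Finset.range N, (legendreP k).eval p.2 • a k p.1 =
      ∑ j ∈ Finset.range N, p.1 • (p.2 * p.1) ^ j • c j := by
    simp only [ha, Finset.smul_sum]
    rw [Finset.sum_comm]
    refine Finset.sum_congr rfl fun j hj => ?_
    have h₄ := congrArg (Polynomial.eval p.2) (sum_legendre_expansion (N := N)
      (q := Polynomial.X ^ j) (by
        rw [Polynomial.degree_X_pow]; exact_mod_cast Finset.mem_range.1 hj))
    rw [Polynomial.eval_finsetSum, Polynomial.eval_pow, Polynomial.eval_X] at h₄
    rw [mul_pow, ← h₄, Finset.sum_mul, Finset.sum_smul, Finset.smul_sum]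
    refine Finset.sum_congr rfl fun k _ => ?_
    rw [Polynomial.eval_smul, smul_smul, smul_smul, smul_smul, smul_eq_mul]
    congr 1
    ring
  simp only [smul_sub, Finset.sum_sub_distrib, h₃, Finset.smul_sum]
  abel

end Legendre

/-! ### The Magnus expansion of an analytic coefficient in nested commutators -/

section Substitution

open Asymptotics
open scoped TensorProduct

attribute [local instance 100] LieRing.ofAssociativeRing

/-- The value at time `x` of a polynomial with coefficients in the free Lie algebra. -/
def evalAt (x : ℝ) : PolyLie →ₗ[ℝ] FreeLie :=
  (TensorProduct.lid ℝ FreeLie).toLinearMap ∘ₗ LinearMap.rTensor FreeLie (Polynomial.leval x)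

theorem evalAt_tmul (x : ℝ) (p : Polynomial ℝ) (l : FreeLie) : evalAt x (p ⊗ₜ l) = p.eval x • l := by
  simp [evalAt, Polynomial.leval]

theorem evalAt_lie (x : ℝ) (y z : PolyLie) : evalAt x ⁅y, z⁆ = ⁅evalAt x y, evalAt x z⁆ := by
  induction y using TensorProduct.induction_on with
  | zero =>
    have : ⁅(0 : PolyLie), z⁆ = 0 := zero_lie z
    rw [this, map_zero, zero_lie]
  | add y₁ y₂ h₁ h₂ =>
    have : ⁅y₁ + y₂, z⁆ = ⁅y₁, z⁆ + ⁅y₂, z⁆ := add_lie y₁ y₂ z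
    rw [this, map_add, map_add, h₁, h₂, add_lie]
  | tmul p l =>
    induction z using TensorProduct.induction_on with
    | zero =>
      have : ⁅p ⊗ₜ[ℝ] l, (0 : PolyLie)⁆ = 0 := lie_zero (p ⊗ₜ[ℝ] l : PolyLie)
      rw [this, map_zero, lie_zero]
    | add z₁ z₂ h₁ h₂ =>
      have : ⁅p ⊗ₜ[ℝ] l, z₁ + z₂⁆ = ⁅p ⊗ₜ[ℝ] l, z₁⁆ + ⁅p ⊗ₜ[ℝ] l, z₂⁆ :=
        lie_add (p ⊗ₜ[ℝ] l : PolyLie) z₁ z₂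
      rw [this, map_add, map_add, h₁, h₂, lie_add]
    | tmul q m =>
      rw [LieAlgebra.ExtendScalars.bracket_tmul, evalAt_tmul, evalAt_tmul, evalAt_tmul, smul_lie,
        lie_smul, smul_smul, Polynomial.eval_mul]

variable {𝔸 : Type*} [NormedRing 𝔸] [NormedAlgebra ℝ 𝔸]

theorem continuous_evalAt (φ : FreeLie →ₗ[ℝ] 𝔸) (z : PolyLie) :
    Continuous fun x => φ (evalAt x z) := by
  induction z using TensorProduct.induction_on with
  | zero => simpa using continuous_const
  | add y z hy hz =>
    simp only [map_add]
    exact hy.add hz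
  | tmul p l =>
    simp only [evalAt_tmul, map_smul]
    exact p.continuous.smul continuous_const

theorem integral_evalAt [CompleteSpace 𝔸] (φ : FreeLie →ₗ[ℝ] 𝔸) (z : PolyLie) (x : ℝ) :
    ∫ y in (0 : ℝ)..x, φ (evalAt y z) =
      φ (evalAt x (LinearMap.rTensor FreeLie polyPrimitive z)) := by
  induction z using TensorProduct.induction_on with
  | zero => simp
  | add y z hy hz =>
    simp only [map_add]
    rw [intervalIntegral.integral_add ((continuous_evalAt φ y).intervalIntegrable _ _)
      ((continuous_evalAt φ z).intervalIntegrable _ _), hy, hz]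
  | tmul p l =>
    simp only [LinearMap.rTensor_tmul, evalAt_tmul, map_smul]
    rw [intervalIntegral.integral_smul_const, integral_eval_polyPrimitive]

variable (A : ℝ → 𝔸)

/-- The substitution of the Legendre coefficients of `A` for the generators. -/
def legendreSubst (δ : ℝ) : FreeLie →ₗ⁅ℝ⁆ 𝔸 := FreeLieAlgebra.lift ℝ (legendreCoeff A δ)

theorem legendreSubst_of (δ : ℝ) (n : ℕ+) :
    legendreSubst A δ (FreeLieAlgebra.of ℝ n) = legendreCoeff A δ n :=
  FreeLieAlgebra.lift_of_apply _ _

theorem legendreSubst_lie (δ : ℝ) (x y : FreeLie) : legendreSubst A δ ⁅x, y⁆ =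
    legendreSubst A δ x * legendreSubst A δ y - legendreSubst A δ y * legendreSubst A δ x := by
  rw [LieHom.map_lie]; rfl

theorem legendreSubst_smul (δ r : ℝ) (x : FreeLie) :
    legendreSubst A δ (r • x) = r • legendreSubst A δ x := map_smul _ _ _

/-- `c F(x δt)` agrees with the substitution in `z` up to order `N`; `c` is `1` or `δt`. -/
def SubstRel (N : ℕ) (c : ℝ → ℝ) (F : ℝ → 𝔸) (z : PolyLie) : Prop :=
  (∀ᶠ t in 𝓝 0, ContinuousAt F t) ∧
    (fun p : ℝ × ℝ => c p.1 • F (p.2 * p.1) - legendreSubst A p.1 (evalAt p.2 z))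
      =O[unifFilter] fun p => p.1 ^ (N + 1)

variable {A} {N : ℕ}

omit [NormedAlgebra ℝ 𝔸] in
theorem isBigO_comp_of_continuousAt {F : ℝ → 𝔸} (hF : ∀ᶠ t in 𝓝 0, ContinuousAt F t) :
    (fun p : ℝ × ℝ => F (p.2 * p.1)) =O[unifFilter] fun _ => (1 : ℝ) :=
  (hF.self_of_nhds.tendsto.comp tendsto_mul_unifFilter).isBigO_one ℝ

theorem pow_isBigO_one (n : ℕ) : (fun p : ℝ × ℝ => p.1 ^ n) =O[unifFilter] fun _ => (1 : ℝ) :=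
  (tendsto_fst_unifFilter.pow n).isBigO_one ℝ

omit [NormedAlgebra ℝ 𝔸] in
theorem commutator_isBigO {l : Filter (ℝ × ℝ)} {a b c d : ℝ × ℝ → 𝔸} {g : ℝ × ℝ → ℝ}
    (hb : b =O[l] fun _ => (1 : ℝ)) (hc : c =O[l] fun _ => (1 : ℝ))
    (hac : (fun p => a p - c p) =O[l] g) (hbd : (fun p => b p - d p) =O[l] g) :
    (fun p => (a p * b p - b p * a p) - (c p * d p - d p * c p)) =O[l] g := by
  have h₁ := hac.mul hb
  have h₂ := hc.mul hbd
  have h₃ := hb.mul hac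
  have h₄ := hbd.mul hc
  simp only [mul_one, one_mul] at h₁ h₂ h₃ h₄
  refine ((h₁.add h₂).sub (h₃.add h₄)).congr_left fun p => ?_
  noncomm_ring

/-- Terms `Ω` are compared unscaled and terms `Ω̇` with a factor `δt`; a nest contains exactly one
`Ω̇`, so the bracket keeps a single factor. -/
theorem SubstRel.lie {F G : ℝ → 𝔸} {z w : PolyLie} (hF : SubstRel A N (fun _ => 1) F z)
    (hG : SubstRel A N id G w) : SubstRel A N id ⁅F, G⁆ ⁅z, w⁆ := by
  obtain ⟨hF, hF'⟩ := hF
  obtain ⟨hG, hG'⟩ := hG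
  refine ⟨?_, ?_⟩
  · filter_upwards [hF, hG] with t h₁ h₂
    exact (h₁.mul h₂).sub (h₂.mul h₁)
  · have hb : (fun p : ℝ × ℝ => id p.1 • G (p.2 * p.1)) =O[unifFilter] fun _ => (1 : ℝ) := by
      simpa using (tendsto_fst_unifFilter.isBigO_one ℝ).smul (isBigO_comp_of_continuousAt hG)
    have hc : (fun p : ℝ × ℝ => legendreSubst A p.1 (evalAt p.2 z)) =O[unifFilter]
        fun _ => (1 : ℝ) := by
      have h₁ := (isBigO_comp_of_continuousAt hF).sub (hF'.trans (pow_isBigO_one _))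
      refine h₁.congr_left fun p => ?_
      rw [one_smul, sub_sub_cancel]
    refine (commutator_isBigO hb hc hF' hG').congr_left fun p => ?_
    rw [evalAt_lie, legendreSubst_lie, one_smul, Ring.lie_def, Pi.sub_apply, Pi.mul_apply,
      Pi.mul_apply, mul_smul_comm, smul_mul_assoc, smul_sub]

theorem primitiveFun_mul [CompleteSpace 𝔸] (F : ℝ → 𝔸) (x δ : ℝ) :
    primitiveFun F (x * δ) = ∫ y in (0 : ℝ)..x, δ • F (y * δ) := by
  rw [intervalIntegral.integral_smul, intervalIntegral.smul_integral_comp_mul_right, zero_mul,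
    primitiveFun]

theorem eventually_continuousAt_primitiveFun [CompleteSpace 𝔸] {F : ℝ → 𝔸}
    (hF : ∀ᶠ t in 𝓝 0, ContinuousAt F t) : ∀ᶠ t in 𝓝 0, ContinuousAt (primitiveFun F) t := by
  obtain ⟨ρ, hρ, h⟩ := Metric.eventually_nhds_iff_ball.1 hF
  have hc : ContinuousOn F (Metric.ball 0 ρ) := fun t ht => (h t ht).continuousWithinAt
  refine Metric.eventually_nhds_iff_ball.2 ⟨ρ, hρ, fun t ht => ?_⟩
  refine (intervalIntegral.integral_hasDerivAt_right ?_
    (hc.stronglyMeasurableAtFilter Metric.isOpen_ball t ht) (h t ht)).continuousAt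
  refine (hc.mono ?_).intervalIntegrable
  exact (convex_ball 0 ρ).ordConnected.uIcc_subset (Metric.mem_ball_self hρ) ht

/-- Substituting `v = y δ` turns `∫₀^{xδ} F` into `∫₀ˣ δ F(yδ) dy`, so the integration absorbs the
factor `δt`. -/
theorem SubstRel.primitive [CompleteSpace 𝔸] {F : ℝ → 𝔸} {z : PolyLie} (hF : SubstRel A N id F z) :
    SubstRel A N (fun _ => 1) (primitiveFun F) (LinearMap.rTensor FreeLie polyPrimitive z) := by
  obtain ⟨hF, hF'⟩ := hF
  refine ⟨eventually_continuousAt_primitiveFun hF, ?_⟩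
  refine (integral_isBigO hF').congr' ?_ EventuallyEq.rfl
  refine eventually_unifFilter.2 ((eventually_continuous_comp hF).mono fun δ hδ x hx => ?_)
  simp only [id]
  rw [intervalIntegral.integral_sub, ← primitiveFun_mul, one_smul]
  · congr 1
    exact integral_evalAt (legendreSubst A δ : FreeLie →ₗ[ℝ] 𝔸) z x
  · refine ContinuousOn.intervalIntegrable ?_
    rw [Set.uIcc_of_le hx.1]
    exact (hδ.mono (Set.Icc_subset_Icc_right hx.2)).const_smul δ
  · exact (continuous_evalAt (legendreSubst A δ : FreeLie →ₗ[ℝ] 𝔸) z).intervalIntegrable _ _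

theorem substRel_formalA [CompleteSpace 𝔸] (hA : AnalyticAt ℝ A 0) :
    SubstRel A N id A (formalA N) := by
  refine ⟨eventually_continuousAt_of_analyticAt hA, ?_⟩
  refine (legendre_expansion_isBigO hA N).congr_left fun p => ?_
  simp only [id, formalA, map_sum, evalAt_tmul, legendreSubst_smul, legendreSubst_of]

theorem substRel_magnusDot [CompleteSpace 𝔸] (hA : AnalyticAt ℝ A 0) (n : ℕ) :
    SubstRel A N id (magnusDot primitiveFun A n)
      (magnusDot (fun z => LinearMap.rTensor FreeLie polyPrimitive z) (formalA N) n) := by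
  refine magnusDot_rel_of_rel (fun _ => SubstRel A N id) (fun _ => SubstRel A N fun _ => 1)
    ?_ ?_ ?_ (fun _ _ _ _ _ _ => SubstRel.lie) (fun _ _ _ => SubstRel.primitive)
    (substRel_formalA hA) n
  · refine fun _ => ⟨Eventually.of_forall fun t => continuousAt_const, ?_⟩
    simpa using isBigO_zero _ _
  · rintro _ F z G w ⟨hF, hF'⟩ ⟨hG, hG'⟩
    refine ⟨by filter_upwards [hF, hG] with t h₁ h₂ using h₁.add h₂, ?_⟩
    refine (hF'.add hG').congr_left fun p => ?_
    rw [map_add, map_add, Pi.add_apply, smul_add]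
    abel
  · rintro _ r F z ⟨hF, hF'⟩
    refine ⟨hF.mono fun t h => h.const_smul r, ?_⟩
    refine (hF'.const_smul_left r).congr_left fun p => ?_
    rw [Pi.smul_apply, map_smul, legendreSubst_smul, Pi.smul_apply, smul_sub, smul_comm r]

theorem sum_magnusFun_isBigO [CompleteSpace 𝔸] (hA : AnalyticAt ℝ A 0) (N : ℕ) :
    (fun δ => ∑ n ∈ Finset.Icc 1 N, magnusFun A n δ - legendreSubst A δ (magnusLie N))
      =O[𝓝 0] fun δ => δ ^ (N + 1) := by
  have h : (fun δ => ∑ n ∈ Finset.Icc 1 N, (magnusFun A n δ - legendreSubst A δ (evalOne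
      (magnusTerm (fun z => LinearMap.rTensor FreeLie polyPrimitive z) (formalA N) n))))
      =O[𝓝 0] fun δ => δ ^ (N + 1) := by
    refine IsBigO.fun_sum fun n _ => ?_
    refine (IsBigO.at_one (g := fun δ => δ ^ (N + 1))
      (substRel_magnusDot (N := N) hA n).primitive.2).congr_left fun δ => ?_
    rw [one_smul, one_mul]
    rfl
  refine h.congr_left fun δ => ?_
  rw [Finset.sum_sub_distrib, magnusLie, map_sum]

end Substitution

/-! ### Order estimates for products of exponentials -/

section Estimates

open Asymptotics

attribute [local instance 100] LieRing.ofAssociativeRing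

variable {𝔸 : Type*} [NormedRing 𝔸] [NormedAlgebra ℝ 𝔸] {A : ℝ → 𝔸}

theorem pow_isBigO_pow {m n : ℕ} (h : n ≤ m) :
    (fun δ : ℝ => δ ^ m) =O[𝓝 0] fun δ => δ ^ n := by
  obtain ⟨k, rfl⟩ := Nat.exists_eq_add_of_le h
  have h₁ : (fun δ : ℝ => δ ^ k) =O[𝓝 0] fun _ => (1 : ℝ) :=
    ((continuous_pow k).tendsto 0).isBigO_one ℝ
  simpa only [pow_add, mul_one] using (isBigO_refl (fun δ : ℝ => δ ^ n) (𝓝 0)).mul h₁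

theorem smul_isBigO {F : ℝ → 𝔸} {g : ℝ → ℝ} (r : ℝ) (h : F =O[𝓝 0] g) :
    (fun δ => r • F δ) =O[𝓝 0] g := h.const_smul_left r

variable [CompleteSpace 𝔸]

theorem legendreSubst_word_isBigO (hA : AnalyticAt ℝ A 0) (w : LieWord) :
    (fun δ => legendreSubst A δ w.toLie) =O[𝓝 0] fun δ => δ ^ w.order := by
  induction w with
  | gen n =>
    simp only [LieWord.toLie, legendreSubst_of]
    exact legendreCoeff_isBigO hA n
  | br x y hx hy =>
    simp only [LieWord.toLie, legendreSubst_lie, LieWord.order]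
    refine ((hx.mul hy).congr_right fun δ => ?_).sub ((hy.mul hx).congr_right fun δ => ?_)
    · rw [pow_add]
    · rw [pow_add, mul_comm]

theorem legendreSubst_isBigO (hA : AnalyticAt ℝ A 0) {x : FreeLie} {d : ℕ}
    (hx : ∀ h : HallElement, h.1.order < d → hallBasis.repr x h = 0) :
    (fun δ => legendreSubst A δ x) =O[𝓝 0] fun δ => δ ^ d := by
  have h₁ : ∀ δ, legendreSubst A δ x = ∑ h ∈ (hallBasis.repr x).support,
      hallBasis.repr x h • legendreSubst A δ h.1.toLie := by
    intro δ
    conv_lhs => rw [← hall_sum x, map_sum]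
    exact Finset.sum_congr rfl fun h _ => legendreSubst_smul _ _ _ _
  simp only [h₁]
  refine IsBigO.fun_sum fun h hh => smul_isBigO _
    ((legendreSubst_word_isBigO hA h.1).trans (pow_isBigO_pow ?_))
  by_contra hd
  exact Finsupp.mem_support_iff.1 hh (hx h (not_le.1 hd))

variable (A) in
/-- The substitution of the Legendre coefficients of `A` in associative polynomials. -/
def assocSubst (δ : ℝ) : FreeAssoc →ₐ[ℝ] 𝔸 := FreeAlgebra.lift ℝ (legendreCoeff A δ)

omit [CompleteSpace 𝔸] in
theorem assocSubst_ι (δ : ℝ) (n : ℕ+) :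
    assocSubst A δ (FreeAlgebra.ι ℝ n) = legendreCoeff A δ n := by simp [assocSubst]

omit [CompleteSpace 𝔸] in
theorem assocSubst_toAssoc (δ : ℝ) (x : FreeLie) :
    assocSubst A δ (toAssoc x) = legendreSubst A δ x := by
  have : (assocSubst A δ : FreeAssoc →ₗ⁅ℝ⁆ 𝔸).comp toAssoc = legendreSubst A δ := by
    ext n
    simp [toAssoc_of, assocSubst_ι, legendreSubst_of]
  exact congrArg (fun f : FreeLie →ₗ⁅ℝ⁆ 𝔸 => f x) this

variable (A) in
/-- `G` agrees with the substitution of the Legendre coefficients in `g` up to order `N`. -/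
structure SeriesRel (N : ℕ) (g : PowerSeries FreeAssoc) (G : ℝ → 𝔸) : Prop where
  coeff : ∀ d, (fun δ => assocSubst A δ (PowerSeries.coeff d g)) =O[𝓝 0] fun δ => δ ^ d
  sub : (fun δ => G δ - ∑ d ∈ Finset.range (N + 1), assocSubst A δ (PowerSeries.coeff d g))
    =O[𝓝 0] fun δ => δ ^ (N + 1)

namespace SeriesRel

variable {N : ℕ} {g g' : PowerSeries FreeAssoc} {G G' : ℝ → 𝔸}

omit [CompleteSpace 𝔸] in
theorem unique (h : SeriesRel A N g G) (h' : SeriesRel A N g G') :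
    (fun δ => G δ - G' δ) =O[𝓝 0] fun δ => δ ^ (N + 1) :=
  (h.sub.sub h'.sub).congr_left fun δ => by abel

omit [CompleteSpace 𝔸] in
theorem one : SeriesRel A N 1 fun _ => 1 := by
  have h (d : ℕ) (δ : ℝ) : assocSubst A δ (PowerSeries.coeff d (1 : PowerSeries FreeAssoc)) =
      if d = 0 then 1 else 0 := by
    rw [PowerSeries.coeff_one]; split_ifs <;> simp
  refine ⟨fun d => ?_, ?_⟩
  · simp only [h]
    split_ifs with hd
    · simpa only [hd, pow_zero] using isBigO_const_const (1 : 𝔸) one_ne_zero _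
    · exact isBigO_zero _ _
  · simpa [h] using isBigO_zero _ _

omit [CompleteSpace 𝔸] in
theorem add (h : SeriesRel A N g G) (h' : SeriesRel A N g' G') :
    SeriesRel A N (g + g') fun δ => G δ + G' δ := by
  refine ⟨fun d => ?_, ?_⟩
  · simpa only [map_add] using (h.coeff d).add (h'.coeff d)
  · refine (h.sub.add h'.sub).congr_left fun δ => ?_
    simp only [map_add, Finset.sum_add_distrib]
    abel

omit [CompleteSpace 𝔸] in
theorem smul (r : ℝ) (h : SeriesRel A N g G) : SeriesRel A N (r • g) fun δ => r • G δ := by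
  have hr (d : ℕ) : PowerSeries.coeff d (r • g) = r • PowerSeries.coeff d g :=
    LinearMap.map_smul_of_tower _ _ _
  refine ⟨fun d => ?_, ?_⟩
  · simpa only [hr, map_smul] using smul_isBigO r (h.coeff d)
  · refine (h.sub.const_smul_left r).congr_left fun δ => ?_
    simp only [Pi.smul_apply, hr, map_smul, smul_sub, Finset.smul_sum]

omit [CompleteSpace 𝔸] in
theorem isBigO_pow (h : SeriesRel A N g G) {k : ℕ} (hk : k ≤ N + 1) (h₀ : EqBelow k g 0) :
    G =O[𝓝 0] fun δ => δ ^ k := by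
  have h₁ : (fun δ => ∑ d ∈ Finset.range (N + 1), assocSubst A δ (PowerSeries.coeff d g))
      =O[𝓝 0] fun δ => δ ^ k := by
    refine IsBigO.fun_sum fun d _ => ?_
    by_cases hd : d < k
    · simpa [h₀ d hd] using isBigO_zero _ _
    · exact (h.coeff d).trans (pow_isBigO_pow (not_lt.1 hd))
  refine ((h.sub.trans (pow_isBigO_pow hk)).add h₁).congr_left fun δ => ?_
  abel

omit [CompleteSpace 𝔸] in
theorem isBigO_one (h : SeriesRel A N g G) : G =O[𝓝 0] fun _ => (1 : ℝ) := by
  simpa only [pow_zero] using h.isBigO_pow (Nat.zero_le _) fun d hd => absurd hd (Nat.not_lt_zero d)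

omit [CompleteSpace 𝔸] in
theorem mul (h : SeriesRel A N g G) (h' : SeriesRel A N g' G') :
    SeriesRel A N (g * g') fun δ => G δ * G' δ := by
  have hc (d : ℕ) (δ : ℝ) : assocSubst A δ (PowerSeries.coeff d (g * g')) =
      ∑ p ∈ Finset.HasAntidiagonal.antidiagonal d, assocSubst A δ (PowerSeries.coeff p.1 g) *
        assocSubst A δ (PowerSeries.coeff p.2 g') := by
    rw [PowerSeries.coeff_mul, map_sum]
    simp only [map_mul]
  have hp (p : ℕ × ℕ) : (fun δ => assocSubst A δ (PowerSeries.coeff p.1 g) *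
      assocSubst A δ (PowerSeries.coeff p.2 g')) =O[𝓝 0] fun δ => δ ^ (p.1 + p.2) := by
    simpa only [pow_add] using (h.coeff p.1).mul (h'.coeff p.2)
  refine ⟨fun d => ?_, ?_⟩
  · simp only [hc]
    refine IsBigO.fun_sum fun p hp' => ?_
    rw [← Finset.HasAntidiagonal.mem_antidiagonal.1 hp']
    exact hp p
  · set E : ℝ → 𝔸 := fun δ => ∑ d ∈ Finset.range (N + 1), assocSubst A δ (PowerSeries.coeff d g)
    set E' : ℝ → 𝔸 := fun δ => ∑ d ∈ Finset.range (N + 1), assocSubst A δ (PowerSeries.coeff d g')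
    have hE : E =O[𝓝 0] fun _ => (1 : ℝ) := by
      have h₁ := h.sub.trans (pow_isBigO_pow (Nat.zero_le _))
      simp only [pow_zero] at h₁
      exact (h.isBigO_one.sub h₁).congr_left fun δ => sub_sub_cancel _ _
    have h₁ : (fun δ => (G δ - E δ) * G' δ) =O[𝓝 0] fun δ => δ ^ (N + 1) := by
      simpa only [mul_one] using h.sub.mul h'.isBigO_one
    have h₂ : (fun δ => E δ * (G' δ - E' δ)) =O[𝓝 0] fun δ => δ ^ (N + 1) := by
      simpa only [one_mul] using hE.mul h'.sub
    -- The product of the two truncations also contains pairs of total order above `N`, which are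
    -- negligible.
    have h₃ : (fun δ => ∑ p ∈ (Finset.range (N + 1) ×ˢ Finset.range (N + 1)).filter
        fun p : ℕ × ℕ => ¬p.1 + p.2 ≤ N,
        assocSubst A δ (PowerSeries.coeff p.1 g) * assocSubst A δ (PowerSeries.coeff p.2 g'))
        =O[𝓝 0] fun δ => δ ^ (N + 1) := by
      refine IsBigO.fun_sum fun p hp' => (hp p).trans (pow_isBigO_pow ?_)
      have := (Finset.mem_filter.1 hp').2
      omega
    refine ((h₁.add h₂).add h₃).congr_left fun δ => ?_
    have h₄ : ∑ d ∈ Finset.range (N + 1), assocSubst A δ (PowerSeries.coeff d (g * g')) =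
        ∑ p ∈ (Finset.range (N + 1) ×ˢ Finset.range (N + 1)).filter
          fun p : ℕ × ℕ => p.1 + p.2 ≤ N,
          assocSubst A δ (PowerSeries.coeff p.1 g) * assocSubst A δ (PowerSeries.coeff p.2 g') := by
      have hm : ∀ p ∈ (Finset.range (N + 1) ×ˢ Finset.range (N + 1)).filter
          fun p : ℕ × ℕ => p.1 + p.2 ≤ N, p.1 + p.2 ∈ Finset.range (N + 1) := fun p hp' => by
        have := (Finset.mem_filter.1 hp').2
        rw [Finset.mem_range]; omega
      rw [← Finset.sum_fiberwise_of_maps_to hm]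
      refine Finset.sum_congr rfl fun d hd => ?_
      rw [hc]
      refine Finset.sum_congr ?_ fun _ _ => rfl
      ext p
      rw [Finset.HasAntidiagonal.mem_antidiagonal, Finset.mem_filter, Finset.mem_filter,
        Finset.mem_product, Finset.mem_range, Finset.mem_range]
      rw [Finset.mem_range] at hd
      omega
    have h₅ : E δ * E' δ = _ := Finset.sum_mul_sum _ _ _ _
    rw [← Finset.sum_product', ← Finset.sum_filter_add_sum_filter_not _
      (fun p : ℕ × ℕ => p.1 + p.2 ≤ N), ← h₄] at h₅
    rw [sub_mul, mul_sub, h₅]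
    abel

omit [CompleteSpace 𝔸] in
theorem pow (h : SeriesRel A N g G) (k : ℕ) : SeriesRel A N (g ^ k) fun δ => G δ ^ k := by
  induction k with
  | zero => simpa only [pow_zero] using one
  | succ k ih => simpa only [pow_succ] using ih.mul h

omit [CompleteSpace 𝔸] in
theorem sum {ι : Type*} (s : Finset ι) {g : ι → PowerSeries FreeAssoc} {G : ι → ℝ → 𝔸}
    (h : ∀ i, SeriesRel A N (g i) (G i)) :
    SeriesRel A N (∑ i ∈ s, g i) fun δ => ∑ i ∈ s, G i δ := by
  induction s using Finset.cons_induction with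
  | empty =>
    simp only [Finset.sum_empty]
    exact ⟨fun d => by simpa using isBigO_zero _ _, by simpa using isBigO_zero _ _⟩
  | cons i s hi ih => simpa only [Finset.sum_cons] using (h i).add ih

omit [CompleteSpace 𝔸] in
theorem prod_ofFn {s : ℕ} {g : Fin s → PowerSeries FreeAssoc} {G : Fin s → ℝ → 𝔸}
    (h : ∀ i, SeriesRel A N (g i) (G i)) :
    SeriesRel A N (List.ofFn g).prod fun δ => (List.ofFn fun i => G i δ).prod := by
  induction s with
  | zero => simpa using one
  | succ s ih =>
    simp only [List.ofFn_succ, List.prod_cons]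
    exact (h 0).mul (ih fun i => h i.succ)

omit [CompleteSpace 𝔸] in
theorem congr_right (h : SeriesRel A N g G)
    (hG : (fun δ => G' δ - G δ) =O[𝓝 0] fun δ => δ ^ (N + 1)) : SeriesRel A N g G' :=
  ⟨h.coeff, (hG.add h.sub).congr_left fun δ => by abel⟩

/-- Since `G = O(δt)`, the exponential series may be cut after the power `N`; what remains is a
finite sum of powers. -/
theorem exp (h : SeriesRel A N g G) (h₀ : EqBelow 1 g 0) :
    SeriesRel A N (powExp g) fun δ => NormedSpace.exp (G δ) := by
  have h₁ : SeriesRel A N (powExpSum (N + 1) g)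
      fun δ => ∑ k ∈ Finset.range (N + 1), ((k.factorial : ℝ)⁻¹) • G δ ^ k :=
    sum _ fun k => (h.pow k).smul _
  have hG : G =O[𝓝 0] fun δ => δ := by simpa only [pow_one] using h.isBigO_pow (by omega) h₀
  have h₂ : (fun δ => NormedSpace.exp (G δ) -
      ∑ k ∈ Finset.range (N + 1), ((k.factorial : ℝ)⁻¹) • G δ ^ k)
      =O[𝓝 0] fun δ => δ ^ (N + 1) := by
    have h₃ := (NormedSpace.exp_hasFPowerSeriesAt_zero (𝕂 := ℝ)
      (𝔸 := 𝔸)).isBigO_sub_partialSum_pow (N + 1)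
    simp only [zero_add, FormalMultilinearSeries.partialSum, NormedSpace.expSeries_apply_eq] at h₃
    exact (h₃.comp_tendsto (hG.trans_tendsto tendsto_id)).trans (hG.norm_left.pow (N + 1))
  refine ⟨fun d => ?_, (h₁.congr_right h₂).sub.congr_left fun δ => ?_⟩
  · have h₃ : ∀ δ, assocSubst A δ (PowerSeries.coeff d (powExp g)) = ∑ k ∈ Finset.range (d + 1),
        ((k.factorial : ℝ)⁻¹) • assocSubst A δ (PowerSeries.coeff d (g ^ k)) := by
      intro δ
      rw [powExp, PowerSeries.coeff_mk, map_sum]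
      simp only [map_smul]
    simp only [h₃]
    exact IsBigO.fun_sum fun k _ => smul_isBigO _ ((h.pow k).coeff d)
  · congr 1
    refine Finset.sum_congr rfl fun d hd => ?_
    rw [powExp_eqBelow h₀ le_rfl d (Finset.mem_range.1 hd)]

end SeriesRel

variable {s N : ℕ} {f : Fin s → ℕ+ → ℝ} {W : ℕ → FreeLie}

theorem seriesRel_formalExponent (hA : AnalyticAt ℝ A 0) (i : Fin s) :
    SeriesRel A N (formalExponent N f i)
      fun δ => ∑ k ∈ Finset.range N, f i k.succPNat • legendreCoeff A δ k.succPNat := by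
  have h (d : ℕ) (δ : ℝ) : assocSubst A δ (PowerSeries.coeff d (formalExponent N f i)) =
      ∑ k ∈ Finset.range N, if d = k + 1 then f i k.succPNat • legendreCoeff A δ k.succPNat
        else 0 := by
    rw [coeff_formalExponent, map_sum]
    refine Finset.sum_congr rfl fun k _ => ?_
    split_ifs
    · rw [map_smul, assocSubst_ι]
    · rw [map_zero]
  refine ⟨fun d => ?_, ?_⟩
  · simp only [h]
    refine IsBigO.fun_sum fun k _ => ?_
    split_ifs with hd
    · rw [hd]
      exact smul_isBigO _ (legendreCoeff_isBigO hA k.succPNat)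
    · exact isBigO_zero _ _
  · refine (isBigO_zero _ _).congr_left fun δ => ?_
    simp only [h]
    rw [Finset.sum_comm, eq_comm, sub_eq_zero]
    refine Finset.sum_congr rfl fun k hk => ?_
    rw [Finset.mem_range] at hk
    rw [Finset.sum_ite_eq', if_pos (Finset.mem_range.2 (by omega))]

/-- The order conditions imply agreement with the Magnus expansion. -/
theorem agreesWithMagnus_of_orderCondition (hW : IsCfetExponent N f W) (hA : AnalyticAt ℝ A 0)
    (h : ∀ h : HallElement, h.1.order ≤ N → OrderCondition hallBasis N W h) :
    AgreesWithMagnus N f A := by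
  obtain ⟨hs, ht⟩ := magnusFun_summable_tail hA.continuousAt N
  refine ⟨hs, ?_⟩
  obtain ⟨hW₀, hg⟩ := (isCfetExponent_iff N f W).1 hW
  have h₁ : (fun δ => legendreSubst A δ (magnusLie N) -
      legendreSubst A δ (∑ d ∈ Finset.range (N + 1), W d)) =O[𝓝 0] fun δ => δ ^ (N + 1) := by
    simp only [← map_sub]
    refine legendreSubst_isBigO hA fun g hg => ?_
    rw [map_sub, Finsupp.sub_apply, sub_eq_zero]
    exact (h g (by omega)).symm
  -- Three errors separate the Magnus expansion from `W`: the tail of the series, the Legendre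
  -- truncation and substitution, and the mismatch of coordinates, which the order conditions
  -- confine to orders above `N`.
  have h₂ : SeriesRel A N (lieSeries W)
      fun δ => ∑' n : ℕ, magnusFun A (n + 1) δ := by
    refine ⟨fun d => ?_, ?_⟩
    · simp only [coeff_lieSeries, assocSubst_toAssoc]
      exact legendreSubst_isBigO hA fun g hg => repr_exponent hW d hg.ne
    · refine ((ht.add (sum_magnusFun_isBigO hA N)).add h₁).congr_left fun δ => ?_
      simp only [coeff_lieSeries, assocSubst_toAssoc, map_sum]
      abel
  have h₃ : SeriesRel A N (powExp (lieSeries W)) (cfetProduct N f A) := by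
    rw [hg, List.map_ofFn]
    exact SeriesRel.prod_ofFn fun i =>
      (seriesRel_formalExponent hA i).exp (formalExponent_eqBelow_one N f i)
  exact h₃.unique (h₂.exp hW₀)

end Estimates

end CFET

end

theorem mainTheorem3 :
    -- the Hall elements form a basis `b` of the free Lie algebra
    ∃ b : Module.Basis CFET.HallElement ℝ CFET.FreeLie,
      (∀ h : CFET.HallElement, b h = h.1.toLie) ∧
      (∀ (N s : ℕ), Even N → ∀ f : Fin s → ℕ+ → ℝ,
        -- the exponent of the product of exponentials exists and is unique as a formal Lie series
        (∃! W : ℕ → CFET.FreeLie, CFET.IsCfetExponent N f W) ∧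
        ∀ W : ℕ → CFET.FreeLie, CFET.IsCfetExponent N f W →
          -- the order conditions of `Aₙ` and of `[A₁, A₂]`
          (∀ n : ℕ+, (n : ℕ) ≤ N → (CFET.OrderCondition b N W (CFET.hallGen n) ↔
            ∑ i : Fin s, f i n = if n = 1 then 1 else 0)) ∧
          (3 ≤ N → (CFET.OrderCondition b N W CFET.hallA₁A₂ ↔
            ∑ i : Fin s, ∑ j ∈ Finset.Ioi i, (f i 1 * f j 2 - f j 1 * f i 2) = -(1 / 3))) ∧
          -- rule (R1)
          (CFET.TimeSymmetric N f → ∀ h : CFET.HallElement, h.1.order ≤ N → Even h.1.order →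
            CFET.OrderCondition b N W h) ∧
          -- rule (R2)
          (CFET.HalfSupported N f → ∀ h : CFET.HallElement, h.1.order ≤ N →
            (∃ n : ℕ+, N < 2 * (n : ℕ) ∧ h.1.Contains n) → CFET.OrderCondition b N W h) ∧
          -- the remaining order conditions are sufficient
          (CFET.TimeSymmetric N f → CFET.HalfSupported N f →
            (∀ h ∈ CFET.remainingElements N, CFET.OrderCondition b N W h) →
            (∀ h : CFET.HallElement, h.1.order ≤ N → CFET.OrderCondition b N W h) ∧
            ∀ (𝔸 : Type*) [NormedRing 𝔸] [NormedAlgebra ℝ 𝔸] [CompleteSpace 𝔸] (A : ℝ → 𝔸),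
              AnalyticAt ℝ A 0 → CFET.AgreesWithMagnus N f A)) ∧
      -- the remaining order conditions for `N = 4, 6, 8`
      (∀ N ∈ ({4, 6, 8} : Set ℕ), Subtype.val '' CFET.remainingElements N =
        {w : CFET.LieWord | w ∈ CFET.hallTable ∧ w.order ≤ N ∧
          ∀ n : ℕ+, w.Contains n → 2 * (n : ℕ) ≤ N}) ∧
      (CFET.remainingElements 4).ncard = 2 ∧
      (CFET.remainingElements 6).ncard = 7 ∧
      (CFET.remainingElements 8).ncard = 22 := by
  refine ⟨CFET.hallBasis, CFET.hallBasis_apply, fun N s hN f =>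
    ⟨CFET.existsUnique_isCfetExponent N f, fun W hW =>
      ⟨fun n hn => CFET.orderCondition_hallGen hW hn, fun h₃ => CFET.orderCondition_hallA₁A₂ hW h₃,
        fun hf h ho he => CFET.orderCondition_of_timeSymmetric hW hf ho he,
        fun hf h ho ⟨n, hn, hc⟩ => CFET.orderCondition_of_halfSupported hW hN hf ho hn hc,
        fun hsym hhalf hrem => ?_⟩⟩, ?_, ?_, ?_, ?_⟩
  · have hall : ∀ h : CFET.HallElement, h.1.order ≤ N →
        CFET.OrderCondition CFET.hallBasis N W h := by
      intro h ho
      -- Rule (R2) covers the elements with a high generator and rule (R1) the even ones; what is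
      -- left is exactly `remainingElements N`.
      by_cases hc : ∃ n : ℕ+, N < 2 * (n : ℕ) ∧ h.1.Contains n
      · obtain ⟨n, hn, hc⟩ := hc
        exact CFET.orderCondition_of_halfSupported hW hN hhalf ho hn hc
      · rcases Nat.even_or_odd h.1.order with he | hodd
        · exact CFET.orderCondition_of_timeSymmetric hW hsym ho he
        · exact hrem h ⟨hodd, ho, fun n hn => not_lt.1 fun hlt => hc ⟨n, hlt, hn⟩⟩
    exact ⟨hall, fun 𝔸 _ _ _ A hA => CFET.agreesWithMagnus_of_orderCondition hW hA hall⟩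
  · intro N hN
    refine CFET.LieWord.image_remainingElements ?_
    rcases hN with rfl | rfl | rfl <;> norm_num
  · exact (CFET.LieWord.ncard_remainingElements (by norm_num)).trans (by decide +kernel)
  · exact (CFET.LieWord.ncard_remainingElements (by norm_num)).trans (by decide +kernel)
  · exact (CFET.LieWord.ncard_remainingElements (by norm_num)).trans (by decide +kernel)
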